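/- **Notation.** Let $d,s\in\mathbb N$ and $\langle x\rangle=\sqrt{1+|x|^2}$. The closed unit ball $\mathbb B^d=\mathbb R^d\sqcup\mathbb S^{d-1}$ is the radial compactification of $\mathbb R^d$, where $\mathbb R^d$ is identified with the open ball via $x\mapsto x/\langle x\rangle$; thus $\partial(\mathbb B^d\times\mathbb B^s)=(\mathbb R^d\times\mathbb S^{s-1})\cup(\mathbb S^{d-1}\times\mathbb R^s)\cup(\mathbb S^{d-1}\times\mathbb S^{s-1})$. We write $f\gtrsim g$ on a set if $f\ge Cg$ there for some constant $C>0$. *Symbols.* $\mathbf{SG}^{m,\mu}(\mathbb R^d,\mathbb R^s)$, $(m,\mu)\in\mathbb R^2$, is the space of smooth $a:\mathbb R^d\times\mathbb R^s\to\mathbb C$ with $|\partial_x^\alpha\partial_\xi^\beta a(x,\xi)|\le C_{\alpha,\beta}\langle x\rangle^{m-|\alpha|}\langle\xi\rangle^{\mu-|\beta|}$ for all $\alpha,\beta$, with the Fréchet topology given by the best constants; $\mathbf{SG}^{\infty,\infty}=\bigcup_{m,\mu}\mathbf{SG}^{m,\mu}$ and $\mathbf{SG}^{-\infty,-\infty}=\bigcap_{m,\mu}\mathbf{SG}^{m,\mu}$.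 *Phase functions.* An admissible inhomogeneous $\mathbf{SG}$-phase function of order $(n,\nu)$, $n,\nu>0$, is a real-valued $\varphi\in\mathbf{SG}^{n,\nu}(\mathbb R^d,\mathbb R^s)$ such that, for some $R>0$, $\langle x\rangle^2|\nabla_x\varphi|^2+\langle\xi\rangle^2|\nabla_\xi\varphi|^2\gtrsim\langle x\rangle^{2n}\langle\xi\rangle^{2\nu}$ for $|x|+|\xi|\ge R$. *Stationary points.* $M_\varphi$ is the set of $(y,\theta)\in\partial(\mathbb B^d\times\mathbb B^s)$ having no open neighbourhood $W$ in $\mathbb B^d\times\mathbb B^s$ with $|\nabla_\xi\varphi(x,\xi)|^2\gtrsim\langle x\rangle^{2n}\langle\xi\rangle^{2\nu-2}$ on $W\cap(\mathbb R^d\times\mathbb R^s)$. Let $\pi_M:M_\varphi\times\mathbb B^d\to\mathbb B^d\times\mathbb B^d$, $(y,\theta,q)\mapsto(y,q)$. Then $\mathrm{SP}_\varphi$ is the set of $(y,q)\in\partial(\mathbb B^d\times\mathbb B^d)$ for which there are **no** open neighbourhood $U$ of $(y,q)$ in $\mathbb B^d\times\mathbb B^d$ and open neighbourhood $V$ of $\pi_M^{-1}(U)$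 in $\mathbb B^d\times\mathbb B^s\times\mathbb B^d$ with $|\nabla_x\varphi(x,\xi)-p|\gtrsim\langle x\rangle^{n-1}\langle\xi\rangle^{\nu}+|p|$ for all $(x,\xi,p)\in V\cap(\mathbb R^d\times\mathbb R^s\times\mathbb R^d)$. *Wave front set.* Fix $\chi\in C_c^\infty(\mathbb R^d)$ with $\chi=1$ near $0$. For $\psi\in C^\infty(\mathbb S^{d-1})$ and $R>0$ let $\psi_R(x)=(1-\chi(x/R))\,\psi(x/|x|)$. For $u\in\mathcal S'(\mathbb R^d)$ let $\widehat u$ be the Fourier transform, normalized as $\widehat u(p)=\int e^{-ix\cdot p}u(x)\,dx$. The cone singular support $\mathrm{Css}(u)\subset\mathbb B^d$ is the union of the singular support of $u$ and of the set of $\omega\in\mathbb S^{d-1}$ for which there are no $R>0$, $\psi$ with $\psi(\omega)\ne0$ and $\psi_Ru\in\mathcal S(\mathbb R^d)$. The global wave front set $\mathrm{WF}(u)\subset\partial(\mathbb B^d\times\mathbb B^d)$ is the union of Hörmander's wave front set of $u$ in $\mathbb R^d\times\mathbb S^{d-1}$ and of the set of $(\omega,q)\in\mathbb S^{d-1}\times\mathbb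 B^d$ for which there are no $R>0$, $\psi$ with $\psi(\omega)\neq0$ and $q\notin\mathrm{Css}(\widehat{\psi_Ru})$. **Theorem.** Let $\varphi$ be an admissible inhomogeneous $\mathbf{SG}$-phase function of order $(n,\nu)$ on $\mathbb R^d\times\mathbb R^s$. There is exactly one linear map $I_\varphi:\mathbf{SG}^{\infty,\infty}(\mathbb R^d,\mathbb R^s)\to\mathcal S'(\mathbb R^d)$ whose restriction to every $\mathbf{SG}^{m,\mu}(\mathbb R^d,\mathbb R^s)$ is continuous (for the topology of pointwise convergence on $\mathcal S'(\mathbb R^d)$) and which satisfies $I_\varphi(a)(x)=\int_{\mathbb R^s}e^{i\varphi(x,\xi)}a(x,\xi)\,d\xi$ for $a\in\mathbf{SG}^{-\infty,-\infty}(\mathbb R^d,\mathbb R^s)$. For every $a\in\mathbf{SG}^{\infty,\infty}(\mathbb R^d,\mathbb R^s)$, the tempered oscillatory integral $I_\varphi(a)$ satisfies $$\mathrm{WF}(I_\varphi(a))\subset\mathrm{SP}_\varphi .$$ -/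

import Mathlib

open MeasureTheory Topology
open scoped SchwartzMap ContDiff FourierTransform Gradient

noncomputable section

namespace SGOsc

/-! ### Euclidean spaces and the radial (directional) compactification -/

/-- The Euclidean space `ℝ^d`. -/
abbrev E (d : ℕ) : Type := EuclideanSpace ℝ (Fin d)

/-- The closed unit ball `𝔹^d` of `ℝ^d`, with its usual topology. -/
abbrev Ball (d : ℕ) : Type := Metric.closedBall (0 : E d) 1

/-- The bracket `⟨x⟩ = √(1 + |x|²)`. -/
def bracket {d : ℕ} (x : E d) : ℝ := Real.sqrt (1 + ‖x‖ ^ 2)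

theorem one_le_bracket {d : ℕ} (x : E d) : 1 ≤ bracket x := by
  rw [bracket, Real.one_le_sqrt]
  nlinarith [sq_nonneg ‖x‖]

theorem bracket_pos {d : ℕ} (x : E d) : 0 < bracket x :=
  lt_of_lt_of_le one_pos (one_le_bracket x)

theorem norm_le_bracket {d : ℕ} (x : E d) : ‖x‖ ≤ bracket x :=
  Real.le_sqrt_of_sq_le (by linarith)

/-- The embedding `x ↦ x / ⟨x⟩` of `ℝ^d` onto the interior of `𝔹^d`. Points of the compactification
`ℝ^d ⊔ 𝕊^{d-1} ≅ 𝔹^d` are points of `𝔹^d`: those of norm `1` are the asymptotic directions, the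
others are the images under `toBall` of the points of `ℝ^d`. -/
def toBall {d : ℕ} (x : E d) : Ball d :=
  ⟨(bracket x)⁻¹ • x, by
    rw [mem_closedBall_zero_iff, norm_smul, norm_inv, Real.norm_of_nonneg (bracket_pos x).le,
      inv_mul_le_iff₀ (bracket_pos x), mul_one]
    exact norm_le_bracket x⟩

/-- The boundary `∂(𝔹^d × 𝔹^s) = (ℝ^d × 𝕊^{s-1}) ∪ (𝕊^{d-1} × ℝ^s) ∪ (𝕊^{d-1} × 𝕊^{s-1})`. -/
def ballBoundary (d s : ℕ) : Set (Ball d × Ball s) :=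
  {z | ‖(z.1 : E d)‖ = 1 ∨ ‖(z.2 : E s)‖ = 1}

/-! ### `SG`-symbols -/

/-- The coordinate directions of `ℝ^d × ℝ^s`. -/
def dir {d s : ℕ} : Fin d ⊕ Fin s → E d × E s
  | Sum.inl i => (EuclideanSpace.single i 1, 0)
  | Sum.inr j => (0, EuclideanSpace.single j 1)

/-- Iterated partial derivatives, indexed by words of coordinate directions. For smooth functions
the order of the letters does not matter, so that the words with `α_i` letters `inl i` and `β_j`
letters `inr j` all give `∂_x^α ∂_ξ^β a`. -/
def partialD {d s : ℕ} : List (Fin d ⊕ Fin s) → (E d × E s → ℂ) → E d × E s → ℂ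
  | [], a => a
  | j :: L, a => fun z => fderiv ℝ (partialD L a) z (dir j)

/-- The number `|α|` of `x`-derivatives in a word. -/
def xOrder {d s : ℕ} (L : List (Fin d ⊕ Fin s)) : ℕ := L.countP Sum.isLeft

/-- The number `|β|` of `ξ`-derivatives in a word. -/
def xiOrder {d s : ℕ} (L : List (Fin d ⊕ Fin s)) : ℕ := L.countP Sum.isRight

/-- The weight `⟨x⟩^(m - |α|) ⟨ξ⟩^(μ - |β|)`. -/
def sgWeight {d s : ℕ} (m μ : ℝ) (L : List (Fin d ⊕ Fin s)) (z : E d × E s) : ℝ :=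
  bracket z.1 ^ (m - xOrder L) * bracket z.2 ^ (μ - xiOrder L)

theorem sgWeight_pos {d s : ℕ} (m μ : ℝ) (L : List (Fin d ⊕ Fin s)) (z : E d × E s) :
    0 < sgWeight m μ L z :=
  mul_pos (Real.rpow_pos_of_pos (bracket_pos _) _) (Real.rpow_pos_of_pos (bracket_pos _) _)

theorem sgWeight_mono {d s : ℕ} {m m' μ μ' : ℝ} (hm : m ≤ m') (hμ : μ ≤ μ')
    (L : List (Fin d ⊕ Fin s)) (z : E d × E s) : sgWeight m μ L z ≤ sgWeight m' μ' L z :=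
  mul_le_mul
    (Real.rpow_le_rpow_of_exponent_le (one_le_bracket _) (by linarith))
    (Real.rpow_le_rpow_of_exponent_le (one_le_bracket _) (by linarith))
    (Real.rpow_nonneg (bracket_pos _).le _) (Real.rpow_nonneg (bracket_pos _).le _)

theorem contDiff_partialD {d s : ℕ} {a : E d × E s → ℂ} (ha : ContDiff ℝ ∞ a)
    (L : List (Fin d ⊕ Fin s)) : ContDiff ℝ ∞ (partialD L a) := by
  induction L with
  | nil => exact ha
  | cons j L ih => exact (ih.fderiv_right (m := ∞) (by simp)).clm_apply contDiff_const

theorem partialD_add {d s : ℕ} {a b : E d × E s → ℂ} (ha : ContDiff ℝ ∞ a)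
    (hb : ContDiff ℝ ∞ b) (L : List (Fin d ⊕ Fin s)) :
    partialD L (a + b) = partialD L a + partialD L b := by
  induction L with
  | nil => rfl
  | cons j L ih =>
    funext z
    have h1 := ((contDiff_partialD ha L).differentiable (by simp)) z
    have h2 := ((contDiff_partialD hb L).differentiable (by simp)) z
    simp only [partialD, ih, Pi.add_apply]
    rw [fderiv_add h1 h2]
    rfl

theorem partialD_smul {d s : ℕ} {a : E d × E s → ℂ} (ha : ContDiff ℝ ∞ a) (c : ℂ)
    (L : List (Fin d ⊕ Fin s)) : partialD L (c • a) = c • partialD L a := by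
  induction L with
  | nil => rfl
  | cons j L ih =>
    funext z
    have h1 := ((contDiff_partialD ha L).differentiable (by simp)) z
    simp only [partialD, ih, Pi.smul_apply]
    rw [fderiv_const_smul h1]
    rfl

theorem partialD_zero {d s : ℕ} (L : List (Fin d ⊕ Fin s)) :
    partialD L (0 : E d × E s → ℂ) = 0 := by
  simpa using partialD_smul (a := (0 : E d × E s → ℂ)) contDiff_const 0 L

/-- The space `SG^{m,μ}(ℝ^d, ℝ^s)` of `SG`-symbols of order `(m, μ)`. -/
def SG (d s : ℕ) (m μ : ℝ) : Submodule ℂ (E d × E s → ℂ) where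
  carrier := {a | ContDiff ℝ ∞ a ∧ ∀ L : List (Fin d ⊕ Fin s), ∃ C : ℝ, ∀ z,
    ‖partialD L a z‖ ≤ C * sgWeight m μ L z}
  zero_mem' := ⟨contDiff_const, fun L => ⟨0, fun z => by simp [partialD_zero]⟩⟩
  add_mem' := by
    rintro a b ⟨ha, ha'⟩ ⟨hb, hb'⟩
    refine ⟨ha.add hb, fun L => ?_⟩
    obtain ⟨C, hC⟩ := ha' L
    obtain ⟨D, hD⟩ := hb' L
    refine ⟨C + D, fun z => ?_⟩
    rw [partialD_add ha hb, Pi.add_apply, add_mul]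
    exact (norm_add_le _ _).trans (add_le_add (hC z) (hD z))
  smul_mem' := by
    rintro c a ⟨ha, ha'⟩
    refine ⟨contDiff_const.smul ha, fun L => ?_⟩
    obtain ⟨C, hC⟩ := ha' L
    refine ⟨‖c‖ * C, fun z => ?_⟩
    rw [partialD_smul ha, Pi.smul_apply, norm_smul, mul_assoc]
    exact mul_le_mul_of_nonneg_left (hC z) (norm_nonneg _)

theorem SG_mono {d s : ℕ} {m m' μ μ' : ℝ} (hm : m ≤ m') (hμ : μ ≤ μ') :
    SG d s m μ ≤ SG d s m' μ' := by
  rintro a ⟨ha, ha'⟩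
  refine ⟨ha, fun L => ?_⟩
  obtain ⟨C, hC⟩ := ha' L
  refine ⟨|C|, fun z => (hC z).trans ?_⟩
  exact (mul_le_mul_of_nonneg_right (le_abs_self C) (sgWeight_pos _ _ _ _).le).trans
    (mul_le_mul_of_nonneg_left (sgWeight_mono hm hμ L z) (abs_nonneg C))

/-- The space `SG^{∞,∞}(ℝ^d, ℝ^s) = ⋃ SG^{m,μ}(ℝ^d, ℝ^s)` of all `SG`-symbols. -/
def SGInf (d s : ℕ) : Submodule ℂ (E d × E s → ℂ) where
  carrier := {a | ∃ m μ : ℝ, a ∈ SG d s m μ}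
  zero_mem' := ⟨0, 0, zero_mem _⟩
  add_mem' := by
    rintro a b ⟨m, μ, ha⟩ ⟨m', μ', hb⟩
    exact ⟨max m m', max μ μ',
      add_mem (SG_mono (le_max_left _ _) (le_max_left _ _) ha)
        (SG_mono (le_max_right _ _) (le_max_right _ _) hb)⟩
  smul_mem' := by
    rintro c a ⟨m, μ, ha⟩
    exact ⟨m, μ, (SG d s m μ).smul_mem c ha⟩

theorem SG_le_SGInf (d s : ℕ) (m μ : ℝ) : SG d s m μ ≤ SGInf d s := fun _ ha => ⟨m, μ, ha⟩

theorem bddAbove_sg {d s : ℕ} {m μ : ℝ} (L : List (Fin d ⊕ Fin s)) (a : SG d s m μ) :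
    BddAbove (Set.range fun z => ‖partialD L (a : E d × E s → ℂ) z‖ / sgWeight m μ L z) := by
  obtain ⟨C, hC⟩ := a.2.2 L
  refine ⟨C, ?_⟩
  rintro _ ⟨z, rfl⟩
  exact (div_le_iff₀ (sgWeight_pos _ _ _ _)).2 (hC z)

/-- The `SG`-seminorms
`sup_{x,ξ} |∂_x^α ∂_ξ^β a(x,ξ)| ⟨x⟩^(-m + |α|) ⟨ξ⟩^(-μ + |β|)` on `SG^{m,μ}(ℝ^d, ℝ^s)`. -/
def sgSeminorm (d s : ℕ) (m μ : ℝ) (L : List (Fin d ⊕ Fin s)) : Seminorm ℂ (SG d s m μ) :=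
  Seminorm.ofSMulLE
    (fun a => ⨆ z, ‖partialD L (a : E d × E s → ℂ) z‖ / sgWeight m μ L z)
    (by simp [partialD_zero])
    (by
      intro a b
      refine ciSup_le fun z => ?_
      refine le_trans ?_ (add_le_add (le_ciSup (bddAbove_sg L a) z) (le_ciSup (bddAbove_sg L b) z))
      rw [Submodule.coe_add, partialD_add a.2.1 b.2.1, Pi.add_apply, ← add_div]
      exact div_le_div_of_nonneg_right (norm_add_le _ _) (sgWeight_pos _ _ _ _).le)
    (by
      intro c a
      refine ciSup_le fun z => ?_
      rw [Submodule.coe_smul, partialD_smul a.2.1, Pi.smul_apply, norm_smul, mul_div_assoc]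
      exact mul_le_mul_of_nonneg_left (le_ciSup (bddAbove_sg L a) z) (norm_nonneg _))

/-- The Fréchet topology of `SG^{m,μ}(ℝ^d, ℝ^s)`, generated by the `SG`-seminorms. -/
@[reducible] def sgTopology (d s : ℕ) (m μ : ℝ) : TopologicalSpace (SG d s m μ) :=
  (SeminormFamily.moduleFilterBasis (𝕜 := ℂ) (sgSeminorm d s m μ)).topology

/-! ### Ellipticity and phase functions -/

/-- A nonnegative function `b` on `ℝ^d × ℝ^s` satisfies the ellipticity estimate
`b(x,ξ) ≳ ⟨x⟩^m ⟨ξ⟩^μ` near the boundary point `w` of `𝔹^d × 𝔹^s`. -/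
def EllipticAt {d s : ℕ} (m μ : ℝ) (b : E d × E s → ℝ) (w : Ball d × Ball s) : Prop :=
  ∃ U : Set (Ball d × Ball s), IsOpen U ∧ w ∈ U ∧ ∃ C : ℝ, 0 < C ∧ ∀ (x : E d) (ξ : E s),
    (toBall x, toBall ξ) ∈ U → C * (bracket x ^ m * bracket ξ ^ μ) ≤ b (x, ξ)

/-- The partial gradient `∇_x φ`. -/
def gradX {d s : ℕ} (φ : E d × E s → ℝ) (x : E d) (ξ : E s) : E d := ∇ (fun x' => φ (x', ξ)) x

/-- The partial gradient `∇_ξ φ`. -/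
def gradXi {d s : ℕ} (φ : E d × E s → ℝ) (x : E d) (ξ : E s) : E s := ∇ (fun ξ' => φ (x, ξ')) ξ

/-- The function `η = ⟨x⟩² |∇_x φ|² + ⟨ξ⟩² |∇_ξ φ|²`. -/
def phaseEta {d s : ℕ} (φ : E d × E s → ℝ) (x : E d) (ξ : E s) : ℝ :=
  bracket x ^ 2 * ‖gradX φ x ξ‖ ^ 2 + bracket ξ ^ 2 * ‖gradXi φ x ξ‖ ^ 2

/-- Admissible inhomogeneous `SG`-phase functions of order `(n, ν)`. -/
structure IsAdmissiblePhase {d s : ℕ} (n ν : ℝ) (φ : E d × E s → ℝ) : Prop where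
  n_pos : 0 < n
  nu_pos : 0 < ν
  symbol : (fun z => (φ z : ℂ)) ∈ SG d s n ν
  nondegenerate : ∃ R : ℝ, 0 < R ∧ ∃ C : ℝ, 0 < C ∧ ∀ (x : E d) (ξ : E s), R ≤ ‖x‖ + ‖ξ‖ →
    C * (bracket x ^ (2 * n) * bracket ξ ^ (2 * ν)) ≤ phaseEta φ x ξ

/-- The set `M_φ ⊆ ∂(𝔹^d × 𝔹^s)` of boundary points at which `|∇_ξ φ|²`, as a symbol of order
`(2n, 2ν - 2)`, is not elliptic. -/
def statM {d s : ℕ} (n ν : ℝ) (φ : E d × E s → ℝ) : Set (Ball d × Ball s) :=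
  {w | w ∈ ballBoundary d s ∧
    ¬ EllipticAt (2 * n) (2 * ν - 2) (fun z => ‖gradXi φ z.1 z.2‖ ^ 2) w}

/-- The set of stationary phase `SP_φ ⊆ ∂(𝔹^d × 𝔹^d)`. A boundary point `(y, q)` is outside of it
iff there are an open neighbourhood `U` of `(y, q)` and an open neighbourhood `V` of the preimage
of `U` in `M_φ × 𝔹^d` under `(y', θ, q') ↦ (y', q')` such that
`|∇_x φ(x,ξ) - p| ≳ ⟨x⟩^(n-1) ⟨ξ⟩^ν + |p|` for all finite points `(x, ξ, p)` of `V`. -/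
def statSP {d s : ℕ} (n ν : ℝ) (φ : E d × E s → ℝ) : Set (Ball d × Ball d) :=
  {w | w ∈ ballBoundary d d ∧
    ¬ ∃ (U : Set (Ball d × Ball d)) (V : Set ((Ball d × Ball s) × Ball d)),
      IsOpen U ∧ w ∈ U ∧ IsOpen V ∧
      (∀ (y : Ball d) (θ : Ball s) (q : Ball d),
        (y, θ) ∈ statM n ν φ → (y, q) ∈ U → ((y, θ), q) ∈ V) ∧
      ∃ C : ℝ, 0 < C ∧ ∀ (x : E d) (ξ : E s) (p : E d),
        ((toBall x, toBall ξ), toBall p) ∈ V →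
          C * (bracket x ^ (n - 1) * bracket ξ ^ ν + ‖p‖) ≤ ‖gradX φ x ξ - p‖}

/-! ### Oscillatory integrals -/

/-- `I` is the map `a ↦ I_φ(a)`, from `SG`-symbols to tempered distributions: it is linear, it is
given by the absolutely convergent integrals `∫ e^{iφ(x,ξ)} a(x,ξ) dξ` for
`a ∈ SG^{-∞,-∞} = ⋂ SG^{m,μ}`, and its restriction to every `SG^{m,μ}` is continuous. -/
structure IsOscillatoryIntegral {d s : ℕ} (φ : E d × E s → ℝ)
    (I : SGInf d s →ₗ[ℂ] 𝓢'(E d, ℂ)) : Prop where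
  eq_integral : ∀ a : SGInf d s, (∀ m μ : ℝ, (a : E d × E s → ℂ) ∈ SG d s m μ) →
    ∀ f : 𝓢(E d, ℂ), I a f =
      ∫ x : E d, (∫ ξ : E s, Complex.exp (Complex.I * φ (x, ξ)) * (a : E d × E s → ℂ) (x, ξ)) * f x
  continuous_restrict : ∀ m μ : ℝ, Continuous[sgTopology d s m μ, inferInstance]
    (fun a : SG d s m μ => I (Submodule.inclusion (SG_le_SGInf d s m μ) a))

/-! ### The Fourier transform `∫ e^{-i x·p} u(x) dx` -/

/-- The dilation `x ↦ (2π)⁻¹ x`. -/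
def dilation (d : ℕ) : E d ≃L[ℝ] E d :=
  ContinuousLinearEquiv.smulLeft (Units.mk0 ((2 * Real.pi)⁻¹) (by positivity))

/-- The Fourier transform `f ↦ (p ↦ ∫ e^{-i x·p} f(x) dx)` on Schwartz functions. -/
def fourierS (d : ℕ) : 𝓢(E d, ℂ) →L[ℂ] 𝓢(E d, ℂ) :=
  (SchwartzMap.compCLMOfContinuousLinearEquiv ℂ (dilation d)) ∘L
    (FourierTransform.fourierCLM ℂ 𝓢(E d, ℂ))

theorem fourierS_apply {d : ℕ} (f : 𝓢(E d, ℂ)) (p : E d) :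
    fourierS d f p = ∫ x : E d, Complex.exp (-(Complex.I * inner ℝ x p)) * f x := by
  have h : fourierS d f p = 𝓕 (f : E d → ℂ) ((2 * Real.pi)⁻¹ • p) := rfl
  rw [h, Real.fourier_eq']
  refine integral_congr_ae (Filter.Eventually.of_forall fun x => ?_)
  simp only [inner_smul_right, smul_eq_mul]
  congr 2
  have : (Real.pi : ℂ) ≠ 0 := by exact_mod_cast Real.pi_ne_zero
  push_cast
  field_simp

/-- The Fourier transform of tempered distributions, by duality. -/
def fourierD {d : ℕ} (u : 𝓢'(E d, ℂ)) : 𝓢'(E d, ℂ) :=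
  PointwiseConvergenceCLM.precomp ℂ (fourierS d) u

theorem fourierD_apply {d : ℕ} (u : 𝓢'(E d, ℂ)) (f : 𝓢(E d, ℂ)) :
    fourierD u f = u (fourierS d f) := rfl

/-! ### Wave front sets -/

/-- The distribution `u` is (given by) a Schwartz function. -/
def IsSchwartz {d : ℕ} (u : 𝓢'(E d, ℂ)) : Prop :=
  ∃ g : 𝓢(E d, ℂ), ∀ f : 𝓢(E d, ℂ), u f = ∫ x : E d, g x * f x

/-- The singular support of `u`: the complement of the largest open set on which `u` is (given by)
a smooth function. -/
def singSupp {d : ℕ} (u : 𝓢'(E d, ℂ)) : Set (E d) :=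
  {x | ¬ ∃ O : Set (E d), IsOpen O ∧ x ∈ O ∧ ∃ g : E d → ℂ, ContDiffOn ℝ ∞ g O ∧
    ∀ f : 𝓢(E d, ℂ), HasCompactSupport f → tsupport f ⊆ O → u f = ∫ x : E d, g x * f x}

/-- For a compactly supported smooth `κ`, the Schwartz function `x ↦ κ(x) e^{-i x·p}`. -/
def modulate {d : ℕ} (κ : E d → ℂ) (hκ : ContDiff ℝ ∞ κ) (hκ' : HasCompactSupport κ) (p : E d) :
    𝓢(E d, ℂ) :=
  HasCompactSupport.toSchwartzMap
    (f := fun x => κ x * Complex.exp (-(Complex.I * (inner ℝ x p : ℝ))))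
    hκ'.mul_right
    (hκ.mul (((contDiff_const.mul
      (Complex.ofRealCLM.contDiff.comp (contDiff_id.inner ℝ contDiff_const))).neg).cexp))

/-- The classical (Hörmander) wave front set of `u`, as a subset of `ℝ^d × 𝕊^{d-1}`. The point
`(x, ω)` is outside of it iff there are `κ ∈ C_c^∞` with `κ(x) ≠ 0` and an open cone `Γ ∋ ω` such
that the Fourier transform `p ↦ ⟨u, κ e^{-i p·}⟩` of `κ u` is rapidly decreasing in `Γ`. -/
def classicalWF {d : ℕ} (u : 𝓢'(E d, ℂ)) : Set (E d × E d) :=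
  {w | ‖w.2‖ = 1 ∧ ¬ ∃ (κ : E d → ℂ) (hκ : ContDiff ℝ ∞ κ) (hκ' : HasCompactSupport κ),
    κ w.1 ≠ 0 ∧ ∃ Γ : Set (E d), IsOpen Γ ∧ w.2 ∈ Γ ∧ (∀ p ∈ Γ, ∀ t : ℝ, 0 < t → t • p ∈ Γ) ∧
      ∀ N : ℕ, ∃ C : ℝ, ∀ p ∈ Γ, ‖u (modulate κ hκ hκ' p)‖ * (1 + ‖p‖) ^ N ≤ C}

/-- Cut-off functions: compactly supported smooth functions equal to `1` around `0`. -/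
structure IsCutoff {d : ℕ} (χ : E d → ℂ) : Prop where
  smooth : ContDiff ℝ ∞ χ
  compact : HasCompactSupport χ
  eq_one : ∀ᶠ x in 𝓝 (0 : E d), χ x = 1

/-- `ψ` is smooth on the sphere `𝕊^{d-1}`, that is, its `0`-homogeneous extension `x ↦ ψ(x/|x|)` is
smooth on `ℝ^d ∖ {0}` (the values of `ψ` off the sphere are irrelevant). -/
def SmoothOnSphere {d : ℕ} (ψ : E d → ℂ) : Prop :=
  ContDiffOn ℝ ∞ (fun x => ψ (‖x‖⁻¹ • x)) {0}ᶜ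

/-- The asymptotic cut-off `ψ_R(x) = (1 - χ(x/R)) ψ(x/|x|)`. -/
def asympCutoff {d : ℕ} (χ ψ : E d → ℂ) (R : ℝ) (x : E d) : ℂ :=
  (1 - χ (R⁻¹ • x)) * ψ (‖x‖⁻¹ • x)

/-- The product `ψ_R u`. An asymptotic cut-off is of temperate growth, so that this is the product
`⟨ψ_R u, f⟩ = ⟨u, ψ_R f⟩`. -/
def cutMul {d : ℕ} (χ ψ : E d → ℂ) (R : ℝ) (u : 𝓢'(E d, ℂ)) : 𝓢'(E d, ℂ) :=
  TemperedDistribution.smulLeftCLM ℂ (asympCutoff χ ψ R) u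

/-- The cone singular support `Css(u) ⊆ 𝔹^d`, with asymptotic cut-offs built from `χ`. -/
def Css {d : ℕ} (χ : E d → ℂ) (u : 𝓢'(E d, ℂ)) : Set (Ball d) :=
  {y | (∃ x : E d, toBall x = y ∧ x ∈ singSupp u) ∨
    (‖(y : E d)‖ = 1 ∧ ¬ ∃ (R : ℝ) (ψ : E d → ℂ), 0 < R ∧ SmoothOnSphere ψ ∧ ψ y ≠ 0 ∧
      IsSchwartz (cutMul χ ψ R u))}

/-- The global wave front set `WF(u) ⊆ ∂(𝔹^d × 𝔹^d)`, with asymptotic cut-offs built from `χ`. -/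
def globalWF {d : ℕ} (χ : E d → ℂ) (u : 𝓢'(E d, ℂ)) : Set (Ball d × Ball d) :=
  {w | (∃ x : E d, toBall x = w.1 ∧ (x, (w.2 : E d)) ∈ classicalWF u) ∨
    (‖(w.1 : E d)‖ = 1 ∧ ¬ ∃ (R : ℝ) (ψ : E d → ℂ), 0 < R ∧ SmoothOnSphere ψ ∧ ψ w.1 ≠ 0 ∧
      w.2 ∉ Css χ (fourierD (cutMul χ ψ R u)))}

end SGOsc

end

open SGOsc
open scoped SchwartzMap

/-!
Everything rests on one estimate, `PhaseElliptic.exists_bound`: if, on the support of the amplitudes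
`b`, the phase `φ(x, ξ) - x·p` has no stationary points in the quantitative sense of
`PhaseElliptic`, that is, if `⟨x⟩² |∇_x φ - p|² + ⟨ξ⟩² |∇_ξ φ|² ≳ (⟨x⟩^n ⟨ξ⟩^ν + ⟨x⟩ |p|)²` up to an
error of order zero, then `∫ e^{i(φ(x, ξ) - x·p)} b(x, ξ) dx dξ` is `O((1 + |p|)^{-M})` for every
`M`, uniformly for compactly supported `b` in a bounded set of symbols of some order `(m, μ)`. It is
obtained by integrating by parts with a first order operator whose coefficients are symbols in `(x,
ξ)`, uniformly in `p`, and which gains the factor `(⟨x⟩^n ⟨ξ⟩^ν + ⟨x⟩ |p|)⁻¹`. To make the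
uniformity automatic, symbol estimates are proved for families of functions throughout (`Sym`).

*Existence and uniqueness.* Let `cut k` be cut-offs at scale `2^k` in `(x, ξ)`. Both `cut k` and
`2^k (cut (k + 1) - cut k)` are bounded families of symbols, and for `p = 0` the ellipticity of the
phase is the admissibility of `φ`. So, for a symbol `a` and a Schwartz function `f`, the integrals
of `e^{iφ} (cut k) a f` form a Cauchy sequence, and they are bounded for `a` and `f` in bounded
sets, which is continuity for the metrizable topologies in question; the limit is `I_φ(a)(f)`.
Conversely `(cut k) a` tends to `a` in a symbol class of slightly larger order, so that every
continuous extension is given by this limit (`IsOscillatoryIntegral.tendsto`).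

*Wave front set.* If `(y, q)` is a boundary point outside of `SP_φ`, then the phase is elliptic for
`x` near `y`, `p` near `q` and all `ξ` (`IsAdmissiblePhase.exists_phaseElliptic_nhds`): near `M_φ`
by the estimate for `∇_x φ - p`, and elsewhere by that for `∇_ξ φ`; the two regions are separated
with the compactness of the balls. If `y` is finite, the estimate, applied to `a κ` with a bump
function `κ` at `y`, is the rapid decay which defines Hörmander's wave front set. If `y` is an
asymptotic direction, let `ψ` be an asymptotic cut-off at `y`. The Fourier transform of `ψ I_φ(a)`
is the limit of the functions `p ↦ ∫ e^{i(φ - x·p)} (cut k) a ψ`; a `p`-derivative turns the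
amplitude into a symbol of larger order, so that the estimate applies to it as well, and cut off to
`p` near `q` the sequence converges in the Schwartz space (`PhaseElliptic.exists_schwartz_tendsto`).
Hence `q` is not in the cone singular support.
-/

noncomputable section

namespace SGOsc

section

variable {d s : ℕ} {ι κ : Type*}

/-! ### Uniform symbol estimates for families of functions -/

/-- The bracket of the variable (`x` or `ξ`) to which the coordinate direction `j` belongs. -/
def br (j : Fin d ⊕ Fin s) (z : E d × E s) : ℝ :=
  Sum.elim (fun _ => bracket z.1) (fun _ => bracket z.2) j

theorem one_le_br (j : Fin d ⊕ Fin s) (z : E d × E s) : 1 ≤ br j z := by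
  cases j <;> exact one_le_bracket _

theorem br_pos (j : Fin d ⊕ Fin s) (z : E d × E s) : 0 < br j z :=
  one_pos.trans_le (one_le_br j z)

/-- Uniform symbol estimates of weight `w`, up to order `k`, for a family of functions `a i`: the
`a i` are bounded by a multiple of `w i`, and every derivative in an `x`-direction (a
`ξ`-direction) gains a factor `⟨x⟩⁻¹` (a factor `⟨ξ⟩⁻¹`). The constants do not depend on `i`. -/
def SymB {F : Type*} [NormedAddCommGroup F] [NormedSpace ℝ F] :
    ℕ → (ι → E d × E s → ℝ) → (ι → E d × E s → F) → Prop
  | 0, w, a => ∃ C : ℝ, 0 ≤ C ∧ ∀ i z, ‖a i z‖ ≤ C * w i z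
  | k + 1, w, a => (∃ C : ℝ, 0 ≤ C ∧ ∀ i z, ‖a i z‖ ≤ C * w i z) ∧
      ∀ j, SymB k (fun i z => w i z / br j z) (fun i z => fderiv ℝ (a i) z (dir j))

/-- A family of smooth functions which satisfies the uniform symbol estimates of weight `w` of all
orders. -/
structure Sym {F : Type*} [NormedAddCommGroup F] [NormedSpace ℝ F]
    (w : ι → E d × E s → ℝ) (a : ι → E d × E s → F) : Prop where
  smooth : ∀ i, ContDiff ℝ ∞ (a i)
  symB : ∀ k, SymB k w a

section Vector

variable {F G : Type*} [NormedAddCommGroup F] [NormedSpace ℝ F] [NormedAddCommGroup G]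
  [NormedSpace ℝ G] {w w' : ι → E d × E s → ℝ} {a b : ι → E d × E s → F}

theorem SymB.bound {k : ℕ} (h : SymB k w a) : ∃ C : ℝ, 0 ≤ C ∧ ∀ i z, ‖a i z‖ ≤ C * w i z := by
  cases k with
  | zero => exact h
  | succ k => exact h.1

theorem SymB.of_succ {k : ℕ} (h : SymB (k + 1) w a) : SymB k w a := by
  induction k generalizing w a with
  | zero => exact h.1
  | succ k ih => exact ⟨h.1, fun j => ih (h.2 j)⟩

theorem SymB.mono {k : ℕ} (h : SymB k w a) {K : ℝ} (hK : 0 ≤ K)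
    (hw : ∀ i z, w i z ≤ K * w' i z) : SymB k w' a := by
  induction k generalizing w w' a with
  | zero =>
    obtain ⟨C, hC, h⟩ := h
    exact ⟨C * K, by positivity, fun i z => (h i z).trans (by
      rw [mul_assoc]; exact mul_le_mul_of_nonneg_left (hw i z) hC)⟩
  | succ k ih =>
    obtain ⟨⟨C, hC, h⟩, h'⟩ := h
    refine ⟨⟨C * K, by positivity, fun i z => (h i z).trans (by
      rw [mul_assoc]; exact mul_le_mul_of_nonneg_left (hw i z) hC)⟩, fun j => ih (h' j) ?_⟩
    intro i z
    rw [← mul_div_assoc]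
    exact div_le_div_of_nonneg_right (hw i z) (br_pos j z).le

theorem SymB.reindex {k : ℕ} (h : SymB k w a) (g : κ → ι) :
    SymB k (fun i => w (g i)) (fun i => a (g i)) := by
  induction k generalizing w a with
  | zero =>
    obtain ⟨C, hC, h⟩ := h
    exact ⟨C, hC, fun i z => h _ z⟩
  | succ k ih =>
    obtain ⟨⟨C, hC, h⟩, h'⟩ := h
    exact ⟨⟨C, hC, fun i z => h _ z⟩, fun j => ih (h' j)⟩

theorem SymB.zero {k : ℕ} (hw : ∀ i z, 0 ≤ w i z) :
    SymB k w (fun (_ : ι) (_ : E d × E s) => (0 : F)) := by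
  induction k generalizing w with
  | zero => exact ⟨0, le_rfl, fun i z => by simp⟩
  | succ k ih =>
    refine ⟨⟨0, le_rfl, fun i z => by simp⟩, fun j => ?_⟩
    simp only [fderiv_fun_const, Pi.zero_apply, zero_apply]
    exact ih fun i z => div_nonneg (hw i z) (br_pos j z).le

theorem SymB.add {k : ℕ} (ha : SymB k w a) (hb : SymB k w b) (ha' : ∀ i, ContDiff ℝ ∞ (a i))
    (hb' : ∀ i, ContDiff ℝ ∞ (b i)) : SymB k w (fun i z => a i z + b i z) := by
  have key : ∀ {w : ι → E d × E s → ℝ} {a b : ι → E d × E s → F},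
      (∃ C : ℝ, 0 ≤ C ∧ ∀ i z, ‖a i z‖ ≤ C * w i z) →
      (∃ C : ℝ, 0 ≤ C ∧ ∀ i z, ‖b i z‖ ≤ C * w i z) →
      ∃ C : ℝ, 0 ≤ C ∧ ∀ i z, ‖a i z + b i z‖ ≤ C * w i z := by
    rintro w a b ⟨C, hC, h⟩ ⟨C', hC', h'⟩
    exact ⟨C + C', by positivity, fun i z => (norm_add_le _ _).trans (by
      rw [add_mul]; exact add_le_add (h i z) (h' i z))⟩
  induction k generalizing w a b with
  | zero => exact key ha hb
  | succ k ih =>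
    refine ⟨key ha.1 hb.1, fun j => ?_⟩
    have : (fun i z => fderiv ℝ (fun z => a i z + b i z) z (dir j)) =
        fun i z => fderiv ℝ (a i) z (dir j) + fderiv ℝ (b i) z (dir j) := by
      funext i z
      rw [fderiv_fun_add ((ha' i).differentiable (by simp) z)
        ((hb' i).differentiable (by simp) z)]
      rfl
    rw [this]
    exact ih (ha.2 j) (hb.2 j)
      (fun i => ((ha' i).fderiv_right (m := ∞) (by simp)).clm_apply contDiff_const)
      (fun i => ((hb' i).fderiv_right (m := ∞) (by simp)).clm_apply contDiff_const)

theorem SymB.clm {k : ℕ} (ha : SymB k w a) (ha' : ∀ i, ContDiff ℝ ∞ (a i)) (L : F →L[ℝ] G) :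
    SymB k w (fun i z => L (a i z)) := by
  have key : ∀ {w : ι → E d × E s → ℝ} {a : ι → E d × E s → F},
      (∃ C : ℝ, 0 ≤ C ∧ ∀ i z, ‖a i z‖ ≤ C * w i z) →
      ∃ C : ℝ, 0 ≤ C ∧ ∀ i z, ‖L (a i z)‖ ≤ C * w i z := by
    rintro w a ⟨C, hC, h⟩
    refine ⟨‖L‖ * C, by positivity, fun i z => (L.le_opNorm _).trans ?_⟩
    rw [mul_assoc]
    exact mul_le_mul_of_nonneg_left (h i z) (norm_nonneg _)
  induction k generalizing w a with
  | zero => exact key ha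
  | succ k ih =>
    refine ⟨key ha.1, fun j => ?_⟩
    have : (fun i z => fderiv ℝ (fun z => L (a i z)) z (dir j)) =
        fun i z => L (fderiv ℝ (a i) z (dir j)) := by
      funext i z
      have := (L.hasFDerivAt.comp z ((ha' i).differentiable (by simp) z).hasFDerivAt).fderiv
      exact DFunLike.congr_fun this (dir j)
    rw [this]
    exact ih (ha.2 j)
      (fun i => ((ha' i).fderiv_right (m := ∞) (by simp)).clm_apply contDiff_const)

namespace Sym

theorem bound (h : Sym w a) : ∃ C : ℝ, 0 ≤ C ∧ ∀ i z, ‖a i z‖ ≤ C * w i z := (h.symB 0).bound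

theorem fderiv (h : Sym w a) (j : Fin d ⊕ Fin s) :
    Sym (fun i z => w i z / br j z) (fun i z => fderiv ℝ (a i) z (dir j)) :=
  ⟨fun i => ((h.smooth i).fderiv_right (m := ∞) (by simp)).clm_apply contDiff_const,
    fun k => (h.symB (k + 1)).2 j⟩

theorem mono (h : Sym w a) {K : ℝ} (hK : 0 ≤ K) (hw : ∀ i z, w i z ≤ K * w' i z) : Sym w' a :=
  ⟨h.smooth, fun k => (h.symB k).mono hK hw⟩

theorem mono' (h : Sym w a) (hw : ∀ i z, w i z ≤ w' i z) : Sym w' a :=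
  h.mono zero_le_one fun i z => by simpa using hw i z

theorem reindex (h : Sym w a) (g : κ → ι) : Sym (fun i => w (g i)) (fun i => a (g i)) :=
  ⟨fun _ => h.smooth _, fun k => (h.symB k).reindex g⟩

theorem add (ha : Sym w a) (hb : Sym w b) : Sym w (fun i z => a i z + b i z) :=
  ⟨fun i => (ha.smooth i).add (hb.smooth i),
    fun k => (ha.symB k).add (hb.symB k) ha.smooth hb.smooth⟩

theorem clm (ha : Sym w a) (L : F →L[ℝ] G) : Sym w (fun i z => L (a i z)) :=
  ⟨fun i => L.contDiff.comp (ha.smooth i), fun k => (ha.symB k).clm ha.smooth L⟩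

theorem sub (ha : Sym w a) (hb : Sym w b) : Sym w (fun i z => a i z - b i z) := by
  simpa [sub_eq_add_neg] using ha.add (hb.clm (-ContinuousLinearMap.id ℝ F))

theorem zero (hw : ∀ i z, 0 ≤ w i z) : Sym w (fun (_ : ι) (_ : E d × E s) => (0 : F)) :=
  ⟨fun _ => contDiff_const, fun _ => SymB.zero hw⟩

theorem sum {J : Type*} (S : Finset J) {a : J → ι → E d × E s → F} (hw : ∀ i z, 0 ≤ w i z)
    (h : ∀ j ∈ S, Sym w (a j)) : Sym w (fun i z => ∑ j ∈ S, a j i z) := by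
  classical
  induction S using Finset.induction_on with
  | empty => simpa using zero hw
  | insert j S hj ih =>
    simp only [Finset.sum_insert hj]
    exact (h j (Finset.mem_insert_self _ _)).add
      (ih fun _ hi => h _ (Finset.mem_insert_of_mem hi))

/-- Constants depending on the index are symbols of any weight which dominates them. The weight
need not be constant. -/
theorem const {c : ι → F} (hw : ∀ i z, ‖c i‖ ≤ w i z) :
    Sym w (fun i (_ : E d × E s) => c i) := by
  refine ⟨fun _ => contDiff_const, fun k => ?_⟩
  have h0 : ∃ C : ℝ, 0 ≤ C ∧ ∀ (i : ι) (z : E d × E s), ‖c i‖ ≤ C * w i z :=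
    ⟨1, zero_le_one, fun i z => by simpa using hw i z⟩
  cases k with
  | zero => exact h0
  | succ k =>
    refine ⟨h0, fun j => ?_⟩
    simp only [fderiv_fun_const, Pi.zero_apply, zero_apply]
    exact SymB.zero fun i z => div_nonneg ((norm_nonneg _).trans (hw i z)) (br_pos j z).le

end Sym

end Vector

section Algebra

variable {A : Type*} [NormedCommRing A] [NormedAlgebra ℝ A]
  {w w' : ι → E d × E s → ℝ} {a b : ι → E d × E s → A}

theorem SymB.mul {k : ℕ} (ha : SymB k w a) (hb : SymB k w' b) (ha' : ∀ i, ContDiff ℝ ∞ (a i))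
    (hb' : ∀ i, ContDiff ℝ ∞ (b i)) : SymB k (fun i z => w i z * w' i z)
      (fun i z => a i z * b i z) := by
  have key : ∀ {w w' : ι → E d × E s → ℝ} {a b : ι → E d × E s → A},
      (∃ C : ℝ, 0 ≤ C ∧ ∀ i z, ‖a i z‖ ≤ C * w i z) →
      (∃ C : ℝ, 0 ≤ C ∧ ∀ i z, ‖b i z‖ ≤ C * w' i z) →
      ∃ C : ℝ, 0 ≤ C ∧ ∀ i z, ‖a i z * b i z‖ ≤ C * (w i z * w' i z) := by
    rintro w w' a b ⟨C, hC, h⟩ ⟨C', hC', h'⟩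
    refine ⟨C * C', by positivity, fun i z => (norm_mul_le _ _).trans ?_⟩
    have := mul_le_mul (h i z) (h' i z) (norm_nonneg _) ((norm_nonneg _).trans (h i z))
    linarith
  induction k generalizing w w' a b with
  | zero => exact key ha hb
  | succ k ih =>
    refine ⟨key ha.1 hb.1, fun j => ?_⟩
    have : (fun i z => fderiv ℝ (fun z => a i z * b i z) z (dir j)) =
        fun i z => a i z * fderiv ℝ (b i) z (dir j) + fderiv ℝ (a i) z (dir j) * b i z := by
      funext i z
      rw [fderiv_fun_mul ((ha' i).differentiable (by simp) z)
        ((hb' i).differentiable (by simp) z)]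
      simp [mul_comm]
    rw [this]
    have da := fun i => ((ha' i).fderiv_right (m := ∞) (by simp)).clm_apply
      (contDiff_const (c := dir (d := d) (s := s) j))
    have db := fun i => ((hb' i).fderiv_right (m := ∞) (by simp)).clm_apply
      (contDiff_const (c := dir (d := d) (s := s) j))
    refine SymB.add ?_ ?_ (fun i => (ha' i).mul (db i)) (fun i => (da i).mul (hb' i))
    · exact (ih ha.of_succ (hb.2 j) ha' db).mono zero_le_one fun i z => by
        rw [one_mul, mul_div_assoc]
    · exact (ih (ha.2 j) hb.of_succ da hb').mono zero_le_one fun i z => by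
        rw [one_mul, div_mul_eq_mul_div]

theorem Sym.mul (ha : Sym w a) (hb : Sym w' b) :
    Sym (fun i z => w i z * w' i z) (fun i z => a i z * b i z) :=
  ⟨fun i => (ha.smooth i).mul (hb.smooth i),
    fun k => (ha.symB k).mul (hb.symB k) ha.smooth hb.smooth⟩

theorem Sym.ofReal {w : ι → E d × E s → ℝ} {a : ι → E d × E s → ℝ} (ha : Sym w a) :
    Sym w (fun i z => (a i z : ℂ)) := ha.clm Complex.ofRealCLM

end Algebra

/-! ### Elementary symbols -/

/-- Real powers of positive elliptic symbols are symbols, by induction on the number of derivatives,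
for all exponents `r` at once: `∂ (a^r) = r a^(r - 1) ∂a`. -/
theorem Sym.rpow {w a : ι → E d × E s → ℝ} (ha : Sym w a) {c : ℝ} (hc : 0 < c)
    (hw : ∀ i z, 0 < w i z) (h : ∀ i z, c * w i z ≤ a i z) (r : ℝ) :
    Sym (fun i z => w i z ^ r) (fun i z => a i z ^ r) := by
  have hpos : ∀ i z, 0 < a i z := fun i z => (mul_pos hc (hw i z)).trans_le (h i z)
  have hsm : ∀ r : ℝ, ∀ i, ContDiff ℝ ∞ (fun z => a i z ^ r) := fun r i =>
    (ha.smooth i).rpow_const_of_ne fun z => (hpos i z).ne'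
  refine ⟨hsm r, fun k => ?_⟩
  have h0 : ∀ r : ℝ, ∃ C : ℝ, 0 ≤ C ∧ ∀ i z, ‖a i z ^ r‖ ≤ C * w i z ^ r := by
    intro r
    obtain ⟨C, hC, hb⟩ := ha.bound
    rcases le_total 0 r with hr | hr
    · refine ⟨C ^ r, by positivity, fun i z => ?_⟩
      rw [Real.norm_of_nonneg (Real.rpow_nonneg (hpos i z).le _), ← Real.mul_rpow hC (hw i z).le]
      exact Real.rpow_le_rpow (hpos i z).le ((le_abs_self _).trans (hb i z)) hr
    · refine ⟨c ^ r, by positivity, fun i z => ?_⟩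
      rw [Real.norm_of_nonneg (Real.rpow_nonneg (hpos i z).le _),
        ← Real.mul_rpow hc.le (hw i z).le]
      exact Real.rpow_le_rpow_of_nonpos (mul_pos hc (hw i z)) (h i z) hr
  induction k generalizing r with
  | zero => exact h0 r
  | succ k ih =>
    refine ⟨h0 r, fun j => ?_⟩
    have : (fun i z => _root_.fderiv ℝ (fun z => a i z ^ r) z (dir j)) =
        fun i z => a i z ^ (r - 1) * (r * _root_.fderiv ℝ (a i) z (dir j)) := by
      funext i z
      rw [(((ha.smooth i).differentiable (by simp) z).hasFDerivAt.rpow_const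
        (p := r) (Or.inl (hpos i z).ne')).fderiv]
      simp only [FunLike.coe_smul, Pi.smul_apply, smul_eq_mul]
      ring
    rw [this]
    have h1 := ((ha.fderiv j).clm (r • ContinuousLinearMap.id ℝ ℝ))
    have := (ih (r - 1)).mul (h1.symB k) (hsm _) h1.smooth
    simp only [FunLike.coe_smul, Pi.smul_apply, smul_eq_mul,
      ContinuousLinearMap.id_apply] at this
    refine this.mono zero_le_one fun i z => le_of_eq ?_
    rw [one_mul, Real.rpow_sub_one (hw i z).ne']
    have := (hw i z).ne'
    field_simp

theorem bracket_sq (x : E d) : bracket x ^ 2 = 1 + ‖x‖ ^ 2 := Real.sq_sqrt (by positivity)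

theorem sym_coord (j : Fin d ⊕ Fin s) :
    Sym (fun (_ : ι) z => br j z)
      (fun _ z => Sum.elim (fun l => z.1 l) (fun l => z.2 l) j) := by
  have hL : ∃ L : E d × E s →L[ℝ] ℝ, (∀ z, L z = Sum.elim (fun l => z.1 l) (fun l => z.2 l) j) ∧
      (∀ z, ‖L z‖ ≤ br j z) ∧ ∀ j', ‖L (dir j')‖ ≤ if j = j' then 1 else 0 := by
    cases j with
    | inl l =>
      refine ⟨(EuclideanSpace.proj l).comp (ContinuousLinearMap.fst ℝ _ _), fun z => rfl,
        fun z => (PiLp.norm_apply_le z.1 l).trans (norm_le_bracket _), fun j' => ?_⟩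
      rcases j' with l' | l' <;> simp [dir]
      split_ifs <;> simp
    | inr l =>
      refine ⟨(EuclideanSpace.proj l).comp (ContinuousLinearMap.snd ℝ _ _), fun z => rfl,
        fun z => (PiLp.norm_apply_le z.2 l).trans (norm_le_bracket _), fun j' => ?_⟩
      rcases j' with l' | l' <;> simp [dir]
      split_ifs <;> simp
  obtain ⟨L, h1, h2, h3⟩ := hL
  simp only [← h1]
  refine ⟨fun _ => L.contDiff, fun k => ?_⟩
  have h0 : ∃ C : ℝ, 0 ≤ C ∧ ∀ (_ : ι) z, ‖L z‖ ≤ C * br j z :=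
    ⟨1, zero_le_one, fun i z => by simpa using h2 z⟩
  cases k with
  | zero => exact h0
  | succ k =>
    refine ⟨h0, fun j' => ?_⟩
    simp only [ContinuousLinearMap.fderiv]
    refine (Sym.const (c := fun _ : ι => L (dir j')) fun i z => (h3 j').trans ?_).symB k
    split_ifs with h
    · rw [h, div_self (br_pos j' z).ne']
    · exact div_nonneg (br_pos j z).le (br_pos j' z).le

theorem sym_bracket_sq_fst :
    Sym (fun (_ : ι) (z : E d × E s) => bracket z.1 ^ 2) (fun _ z => bracket z.1 ^ 2) := by
  have h1 : Sym (fun (_ : ι) (z : E d × E s) => bracket z.1 ^ 2)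
      (fun _ z => ∑ l : Fin d, z.1 l * z.1 l) :=
    Sym.sum _ (fun _ _ => by positivity) fun l _ =>
      ((sym_coord (Sum.inl l)).mul (sym_coord (Sum.inl l))).mono' fun i z => by
        simp [br, sq]
  have h2 : Sym (fun (_ : ι) (z : E d × E s) => bracket z.1 ^ 2) (fun _ _ => (1 : ℝ)) :=
    Sym.const fun i z => by
      rw [norm_one]; exact one_le_pow₀ (one_le_bracket z.1)
  convert h2.add h1 using 3 with i z
  rw [bracket_sq, EuclideanSpace.norm_sq_eq]
  simp [sq]

theorem sym_bracket_sq_snd :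
    Sym (fun (_ : ι) (z : E d × E s) => bracket z.2 ^ 2) (fun _ z => bracket z.2 ^ 2) := by
  have h1 : Sym (fun (_ : ι) (z : E d × E s) => bracket z.2 ^ 2)
      (fun _ z => ∑ l : Fin s, z.2 l * z.2 l) :=
    Sym.sum _ (fun _ _ => by positivity) fun l _ =>
      ((sym_coord (Sum.inr l)).mul (sym_coord (Sum.inr l))).mono' fun i z => by
        simp [br, sq]
  have h2 : Sym (fun (_ : ι) (z : E d × E s) => bracket z.2 ^ 2) (fun _ _ => (1 : ℝ)) :=
    Sym.const fun i z => by
      rw [norm_one]; exact one_le_pow₀ (one_le_bracket z.2)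
  convert h2.add h1 using 3 with i z
  rw [bracket_sq, EuclideanSpace.norm_sq_eq]
  simp [sq]

theorem bracket_rpow (x : E d) (m : ℝ) : (bracket x ^ 2) ^ (m / 2) = bracket x ^ m := by
  rw [← Real.rpow_natCast, ← Real.rpow_mul (bracket_pos x).le]
  congr 1
  push_cast
  ring

/-- The weight `⟨x⟩^m ⟨ξ⟩^μ`. -/
def sgw (m μ : ℝ) (z : E d × E s) : ℝ := bracket z.1 ^ m * bracket z.2 ^ μ

theorem sgw_pos (m μ : ℝ) (z : E d × E s) : 0 < sgw m μ z :=
  mul_pos (Real.rpow_pos_of_pos (bracket_pos _) _) (Real.rpow_pos_of_pos (bracket_pos _) _)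

theorem sgw_mul (m μ m' μ' : ℝ) (z : E d × E s) :
    sgw m μ z * sgw m' μ' z = sgw (m + m') (μ + μ') z := by
  simp only [sgw, Real.rpow_add (bracket_pos _)]
  ring

theorem sym_bracket_rpow_fst (m : ℝ) :
    Sym (fun (_ : ι) (z : E d × E s) => bracket z.1 ^ m) (fun _ z => bracket z.1 ^ m) := by
  have := (sym_bracket_sq_fst (ι := ι) (d := d) (s := s)).rpow one_pos
    (fun _ z => pow_pos (bracket_pos z.1) 2) (fun _ z => by simp) (m / 2)
  simpa only [bracket_rpow] using this

theorem sym_bracket_rpow_snd (m : ℝ) :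
    Sym (fun (_ : ι) (z : E d × E s) => bracket z.2 ^ m) (fun _ z => bracket z.2 ^ m) := by
  have := (sym_bracket_sq_snd (ι := ι) (d := d) (s := s)).rpow one_pos
    (fun _ z => pow_pos (bracket_pos z.2) 2) (fun _ z => by simp) (m / 2)
  simpa only [bracket_rpow] using this

theorem sym_sgw (m μ : ℝ) : Sym (fun (_ : ι) (z : E d × E s) => sgw m μ z) (fun _ z => sgw m μ z) :=
  (sym_bracket_rpow_fst m).mul (sym_bracket_rpow_snd μ)

theorem sgw_div_br (m μ : ℝ) (j : Fin d ⊕ Fin s) (z : E d × E s) :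
    sgw m μ z / br j z = Sum.elim (fun _ => sgw (m - 1) μ z) (fun _ => sgw m (μ - 1) z) j := by
  cases j with
  | inl l => simp only [br, sgw, Sum.elim_inl, Real.rpow_sub_one (bracket_pos z.1).ne']; ring
  | inr l => simp only [br, sgw, Sum.elim_inr, Real.rpow_sub_one (bracket_pos z.2).ne']; ring

/-! ### Symbols in terms of iterated partial derivatives -/

theorem partialD_append_singleton (L : List (Fin d ⊕ Fin s)) (j : Fin d ⊕ Fin s)
    (a : E d × E s → ℂ) :
    partialD (L ++ [j]) a = partialD L (fun z => fderiv ℝ a z (dir j)) := by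
  induction L with
  | nil => rfl
  | cons i L ih =>
    simp only [List.cons_append, partialD]
    rw [ih]

theorem sgWeight_append_singleton (m μ : ℝ) (L : List (Fin d ⊕ Fin s)) (j : Fin d ⊕ Fin s)
    (z : E d × E s) :
    sgWeight m μ (L ++ [j]) z =
      Sum.elim (fun _ => sgWeight (m - 1) μ L z) (fun _ => sgWeight m (μ - 1) L z) j := by
  cases j <;>
    simp [sgWeight, xOrder, xiOrder, List.countP_append, List.countP_singleton, sub_sub, add_comm]

/-- Uniform bounds for all iterated partial derivatives give a symbol family. -/
theorem Sym.of_partialD {m μ : ℝ} {a : ι → E d × E s → ℂ} (ha : ∀ i, ContDiff ℝ ∞ (a i))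
    (h : ∀ L : List (Fin d ⊕ Fin s), ∃ C : ℝ, ∀ i z, ‖partialD L (a i) z‖ ≤ C * sgWeight m μ L z) :
    Sym (fun _ => sgw m μ) a := by
  refine ⟨ha, fun k => ?_⟩
  have key : ∀ {m μ : ℝ} {a : ι → E d × E s → ℂ},
      (∀ L : List (Fin d ⊕ Fin s), ∃ C : ℝ, ∀ i z, ‖partialD L (a i) z‖ ≤ C * sgWeight m μ L z) →
      ∃ C : ℝ, 0 ≤ C ∧ ∀ i z, ‖a i z‖ ≤ C * sgw m μ z := by
    intro m μ a h
    obtain ⟨C, hC⟩ := h []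
    refine ⟨|C|, abs_nonneg C, fun i z => (hC i z).trans ?_⟩
    have : sgWeight m μ [] z = sgw m μ z := by simp [sgWeight, sgw, xOrder, xiOrder]
    rw [this]
    exact mul_le_mul_of_nonneg_right (le_abs_self C) (sgw_pos m μ z).le
  induction k generalizing m μ a with
  | zero => exact key h
  | succ k ih =>
    refine ⟨key h, fun j => ?_⟩
    simp only [sgw_div_br]
    have h' := fun L => h (L ++ [j])
    simp only [sgWeight_append_singleton, partialD_append_singleton] at h'
    have hd := fun i => ((ha i).fderiv_right (m := ∞) (by simp)).clm_apply
      (contDiff_const (c := dir (d := d) (s := s) j))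
    cases j with
    | inl l => exact ih hd h'
    | inr l => exact ih hd h'

theorem Sym.partialD_bound {m μ : ℝ} {a : ι → E d × E s → ℂ} (ha : Sym (fun _ => sgw m μ) a)
    (L : List (Fin d ⊕ Fin s)) :
    ∃ C : ℝ, 0 ≤ C ∧ ∀ i z, ‖partialD L (a i) z‖ ≤ C * sgWeight m μ L z := by
  induction L using List.reverseRecOn generalizing m μ a with
  | nil =>
    have : ∀ z : E d × E s, sgWeight m μ [] z = sgw m μ z := by
      intro z; simp [sgWeight, sgw, xOrder, xiOrder]
    simpa only [this, partialD] using ha.bound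
  | append_singleton L j ih =>
    simp only [sgWeight_append_singleton, partialD_append_singleton]
    have h := ha.fderiv j
    simp only [sgw_div_br] at h
    cases j with
    | inl l => exact ih h
    | inr l => exact ih h

theorem SG.sym {m μ : ℝ} {a : E d × E s → ℂ} (ha : a ∈ SG d s m μ) :
    Sym (fun _ : ι => sgw m μ) (fun _ => a) :=
  Sym.of_partialD (fun _ => ha.1) fun L => (ha.2 L).imp fun _ h _ z => h z

theorem Sym.mem_SG {m μ : ℝ} {a : ι → E d × E s → ℂ} (ha : Sym (fun _ => sgw m μ) a) (i : ι) :
    a i ∈ SG d s m μ :=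
  ⟨ha.smooth i, fun L => (ha.partialD_bound L).imp fun _ h z => h.2 i z⟩

end

section

variable {d s : ℕ} {ι κ : Type*}

/-! ### Cut-off functions and compositions as symbols -/

theorem fderiv_fst_comp {F : Type*} [NormedAddCommGroup F] [NormedSpace ℝ F] {f : E d → F}
    (hf : Differentiable ℝ f) (j : Fin d ⊕ Fin s) (z : E d × E s) :
    fderiv ℝ (fun z : E d × E s => f z.1) z (dir j) = fderiv ℝ f z.1 (dir (s := s) j).1 := by
  have := ((hf z.1).hasFDerivAt.comp z (hasFDerivAt_fst (𝕜 := ℝ) (p := z))).fderiv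
  exact DFunLike.congr_fun this (dir j)

/-- Smooth functions on the compactified space, pulled back to `ℝ^d` along `toBall`, are symbols of
order zero: `toBall` has symbols of order zero as its components, and `f` has bounded derivatives on
the closed ball. -/
theorem sym_comp_toBall {f : E d → ℝ} (hf : ContDiff ℝ ∞ f) :
    Sym (fun (_ : ι) (_ : E d × E s) => (1 : ℝ)) (fun _ z => f (toBall z.1)) := by
  have hτe : ∀ l : Fin d, (fun z : E d × E s => (toBall z.1 : E d) l) = fun z =>
      bracket z.1 ^ (-1 : ℝ) * Sum.elim (fun l => z.1 l) (fun l => z.2 l) (Sum.inl l) := by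
    intro l
    funext z
    simp [toBall, Real.rpow_neg_one]
  have hτ : ∀ l : Fin d, Sym (fun (_ : ι) (_ : E d × E s) => (1 : ℝ))
      (fun _ z => (toBall z.1 : E d) l) := by
    intro l
    have := (sym_bracket_rpow_fst (ι := ι) (s := s) (-1)).mul (sym_coord (Sum.inl l))
    rw [hτe]
    refine this.mono' fun i z => ?_
    simp only [br, Sum.elim_inl, Real.rpow_neg_one]
    rw [inv_mul_cancel₀ (bracket_pos z.1).ne']
  have hsm : ContDiff ℝ ∞ (fun z : E d × E s => (toBall z.1 : E d)) := by
    rw [contDiff_euclidean]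
    by_cases hι : Nonempty ι
    · exact fun l => (hτ l).smooth hι.some
    · intro l
      have h1 := ((sym_bracket_rpow_fst (ι := Unit) (d := d) (s := s) (-1)).smooth ()).mul
        ((sym_coord (ι := Unit) (s := s) (Sum.inl l)).smooth ())
      rw [hτe]
      exact h1
  have hfs : ∀ {f : E d → ℝ}, ContDiff ℝ ∞ f →
      ContDiff ℝ ∞ (fun z : E d × E s => f (toBall z.1)) := fun hf => hf.comp hsm
  refine ⟨fun _ => hfs hf, fun k => ?_⟩
  have h0 : ∀ {f : E d → ℝ}, ContDiff ℝ ∞ f → ∃ C : ℝ, 0 ≤ C ∧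
      ∀ (_ : ι) (z : E d × E s), ‖f (toBall z.1)‖ ≤ C * 1 := by
    intro f hf
    obtain ⟨C, hC⟩ := (isCompact_closedBall (0 : E d) 1).exists_bound_of_continuousOn
      hf.continuous.continuousOn
    exact ⟨|C|, abs_nonneg C, fun _ z => by
      simpa using (hC _ (toBall z.1).2).trans (le_abs_self C)⟩
  induction k generalizing f with
  | zero => exact h0 hf
  | succ k ih =>
    refine ⟨h0 hf, fun j => ?_⟩
    have : (fun (_ : ι) (z : E d × E s) => fderiv ℝ (fun z => f (toBall z.1)) z (dir j)) =
        fun _ z => ∑ l, fderiv ℝ f (toBall z.1) (EuclideanSpace.single l 1) *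
          fderiv ℝ (fun z : E d × E s => (toBall z.1 : E d) l) z (dir j) := by
      funext _ z
      have hd := (hsm.differentiable (by simp) z).hasFDerivAt
      have := ((hf.differentiable (by simp) (toBall z.1)).hasFDerivAt.comp z hd).fderiv
      have h2 : fderiv ℝ (fun z => f (toBall z.1)) z (dir j) = fderiv ℝ f (toBall z.1)
        (fderiv ℝ (fun z : E d × E s => (toBall z.1 : E d)) z (dir j)) :=
        DFunLike.congr_fun this (dir j)
      have h3 : ∀ l, fderiv ℝ (fun z : E d × E s => (toBall z.1 : E d) l) z (dir j) =
          (fderiv ℝ (fun z : E d × E s => (toBall z.1 : E d)) z (dir j)) l := fun l =>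
        DFunLike.congr_fun (((EuclideanSpace.proj (𝕜 := ℝ) l).hasFDerivAt.comp z hd).fderiv) (dir j)
      rw [h2]
      simp only [h3]
      generalize fderiv ℝ (fun z : E d × E s => (toBall z.1 : E d)) z (dir j) = v
      conv_lhs => rw [← (EuclideanSpace.basisFun (Fin d) ℝ).sum_repr v]
      simp [mul_comm]
    rw [this]
    have hfl : ∀ l : Fin d, ContDiff ℝ ∞ (fun y => fderiv ℝ f y (EuclideanSpace.single l 1)) :=
      fun l => (hf.fderiv_right (m := ∞) (by simp)).clm_apply contDiff_const
    have hm : ∀ l : Fin d, SymB k (fun (_ : ι) (z : E d × E s) => 1 / br j z)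
        (fun _ z => fderiv ℝ f (toBall z.1) (EuclideanSpace.single l 1) *
          fderiv ℝ (fun z : E d × E s => (toBall z.1 : E d) l) z (dir j)) := fun l =>
      ((ih (hfl l)).mul (((hτ l).fderiv j).symB k) (fun _ => hfs (hfl l))
        ((hτ l).fderiv j).smooth).mono zero_le_one fun i z => by simp
    have : ∀ S : Finset (Fin d), SymB k (fun (_ : ι) (z : E d × E s) => 1 / br j z)
        (fun _ z => ∑ l ∈ S, fderiv ℝ f (toBall z.1) (EuclideanSpace.single l 1) *
          fderiv ℝ (fun z : E d × E s => (toBall z.1 : E d) l) z (dir j)) := by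
      intro S
      classical
      induction S using Finset.induction_on with
      | empty =>
        simpa using SymB.zero (ι := ι) fun _ z => div_nonneg zero_le_one (br_pos j z).le
      | insert l S hl ih' =>
        simp only [Finset.sum_insert hl]
        refine (hm l).add ih' (fun i => ?_) (fun i => ?_)
        · exact (hfs (hfl l)).mul (((hτ l).fderiv j).smooth i)
        · exact ContDiff.sum fun l _ => (hfs (hfl l)).mul (((hτ l).fderiv j).smooth i)
    exact this _

/-- Modulations, with bounded frequencies, of a smooth function of `x` with compact support are
symbols which decay rapidly in `x`. A derivative of the exponential does not gain a power of `⟨x⟩`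
by itself; the power comes from the support of `f`, whence the induction over all `M`. -/
theorem sym_modulation {f : E d → ℂ} (hf : ContDiff ℝ ∞ f) (hc : HasCompactSupport f)
    {p : ι → E d} {R : ℝ} (hp : ∀ i, ‖p i‖ ≤ R) (M : ℕ) :
    Sym (fun (_ : ι) (z : E d × E s) => (bracket z.1 ^ M)⁻¹)
      (fun i z => f z.1 * Complex.exp (-(Complex.I * (inner ℝ z.1 (p i) : ℝ)))) := by
  have hexp : ∀ i, ContDiff ℝ ∞
      (fun x : E d => Complex.exp (-(Complex.I * (inner ℝ x (p i) : ℝ)))) := fun i =>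
    ((contDiff_const.mul
      (Complex.ofRealCLM.contDiff.comp (contDiff_id.inner ℝ contDiff_const))).neg).cexp
  have hsm : ∀ {f : E d → ℂ}, ContDiff ℝ ∞ f → ∀ i, ContDiff ℝ ∞
      (fun z : E d × E s => f z.1 * Complex.exp (-(Complex.I * (inner ℝ z.1 (p i) : ℝ)))) :=
    fun hf i => (hf.mul (hexp i)).comp contDiff_fst
  refine ⟨hsm hf, fun k => ?_⟩
  have h0 : ∀ {f : E d → ℂ}, ContDiff ℝ ∞ f → HasCompactSupport f → ∀ M : ℕ, ∃ C : ℝ, 0 ≤ C ∧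
      ∀ (i : ι) (z : E d × E s), ‖f z.1 * Complex.exp (-(Complex.I * (inner ℝ z.1 (p i) : ℝ)))‖ ≤
        C * (bracket z.1 ^ M)⁻¹ := by
    intro f hf hc M
    have hb : Continuous fun x : E d => bracket x := by unfold bracket; fun_prop
    obtain ⟨C, hC⟩ := (hc.mul_left (f := fun x => ((bracket x ^ M : ℝ) : ℂ))).exists_bound_of_continuous
      (by fun_prop)
    refine ⟨|C|, abs_nonneg C, fun i z => ?_⟩
    have h1 : ‖Complex.exp (-(Complex.I * (inner ℝ z.1 (p i) : ℝ)))‖ = 1 := by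
      rw [Complex.norm_exp]; simp
    rw [norm_mul, h1, mul_one, ← div_eq_mul_inv, le_div_iff₀ (pow_pos (bracket_pos _) _)]
    have := (hC z.1).trans (le_abs_self C)
    simp only [Pi.mul_apply, norm_mul, Complex.norm_real] at this
    rwa [Real.norm_of_nonneg (pow_pos (bracket_pos _) _).le, mul_comm] at this
  induction k generalizing f M with
  | zero => exact h0 hf hc M
  | succ k ih =>
    refine ⟨h0 hf hc M, fun j => ?_⟩
    have hd : ∀ i z, fderiv ℝ (fun z : E d × E s => f z.1 *
        Complex.exp (-(Complex.I * (inner ℝ z.1 (p i) : ℝ)))) z (dir j) =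
        fderiv ℝ f z.1 (dir (s := s) j).1 * Complex.exp (-(Complex.I * (inner ℝ z.1 (p i) : ℝ))) +
        (-(Complex.I * (inner ℝ (dir (s := s) j).1 (p i) : ℝ))) *
          (f z.1 * Complex.exp (-(Complex.I * (inner ℝ z.1 (p i) : ℝ)))) := by
      intro i z
      have h1 := fderiv_fst_comp (s := s) ((hf.mul (hexp i)).differentiable (by simp)) j z
      refine h1.trans ?_
      have hin : HasFDerivAt (fun x : E d => inner ℝ x (p i)) ((innerSL ℝ) (p i)) z.1 := by
        have := ((innerSL ℝ) (p i)).hasFDerivAt (x := z.1)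
        refine this.congr_of_eventuallyEq (Filter.Eventually.of_forall fun x => ?_)
        simp [real_inner_comm]
      have he := ((Complex.ofRealCLM.hasFDerivAt.comp z.1 hin).const_mul Complex.I).neg.cexp
      have hm := ((hf.differentiable (by simp) z.1).hasFDerivAt.mul he).fderiv
      refine (DFunLike.congr_fun hm _).trans ?_
      simp [real_inner_comm]
      ring
    simp only [hd]
    cases j with
    | inr l =>
      simp only [dir, map_zero, zero_mul, inner_zero_left, Complex.ofReal_zero, mul_zero, neg_zero,
        add_zero]
      exact SymB.zero fun i z => div_nonneg (inv_nonneg.2 (pow_pos (bracket_pos _) _).le)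
        (br_pos _ z).le
    | inl l =>
      simp only [dir]
      have hw : ∀ z : E d × E s, (bracket z.1 ^ M)⁻¹ / br (Sum.inl l) z =
          (bracket z.1 ^ (M + 1))⁻¹ := by
        intro z; simp [br, pow_succ, div_eq_mul_inv, mul_comm]
      simp only [hw]
      have hf' : ContDiff ℝ ∞ (fun x => fderiv ℝ f x (EuclideanSpace.single l 1)) :=
        (hf.fderiv_right (m := ∞) (by simp)).clm_apply contDiff_const
      have hc' : HasCompactSupport (fun x => fderiv ℝ f x (EuclideanSpace.single l 1)) :=
        hc.fderiv_apply ℝ _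
      refine SymB.add (ih hf' hc' (M + 1)) ?_ (hsm hf') (fun i => contDiff_const.mul (hsm hf i))
      have hcst : Sym (fun (_ : ι) (_ : E d × E s) => |R|)
          (fun i _ => -(Complex.I * (inner ℝ (EuclideanSpace.single l (1:ℝ)) (p i) : ℝ))) := by
        refine Sym.const fun i z => ?_
        simp only [norm_neg, norm_mul, Complex.norm_I, one_mul, Complex.norm_real]
        refine (norm_inner_le_norm _ _).trans ?_
        simpa using (hp i).trans (le_abs_self R)
      exact ((hcst.symB k).mul (ih hf hc (M + 1)) hcst.smooth (hsm hf)).mono (abs_nonneg R)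
        fun i z => le_rfl

/-- Bounded families of Schwartz functions of `x` are symbols which decay rapidly in `x`. -/
theorem sym_schwartz {f : ι → 𝓢(E d, ℂ)} (hf : Bornology.IsVonNBounded ℂ (Set.range f)) (M : ℕ) :
    Sym (fun (_ : ι) (z : E d × E s) => (bracket z.1 ^ M)⁻¹) (fun i z => f i z.1) := by
  refine ⟨fun i => ((f i).smooth ⊤).comp contDiff_fst, fun k => ?_⟩
  have h0 : ∀ {f : ι → 𝓢(E d, ℂ)}, Bornology.IsVonNBounded ℂ (Set.range f) → ∀ M : ℕ,
      ∃ C : ℝ, 0 ≤ C ∧ ∀ (i : ι) (z : E d × E s), ‖f i z.1‖ ≤ C * (bracket z.1 ^ M)⁻¹ := by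
    intro f hf M
    obtain ⟨r, hr, h⟩ := ((schwartz_withSeminorms ℂ (E d)
      ℂ).isVonNBounded_iff_finset_seminorm_bounded.1 hf) (Finset.Iic (M, 0))
    refine ⟨2 ^ M * r, by positivity, fun i z => ?_⟩
    rw [← div_eq_mul_inv, le_div_iff₀ (pow_pos (bracket_pos _) _)]
    have h1 := SchwartzMap.one_add_le_sup_seminorm_apply (𝕜 := ℂ) (m := (M, 0)) le_rfl le_rfl
      (f i) z.1
    have h2 := (h _ (Set.mem_range_self i)).le
    have h3 : bracket z.1 ≤ 1 + ‖z.1‖ := by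
      rw [bracket, Real.sqrt_le_left (by positivity)]
      nlinarith [norm_nonneg z.1]
    rw [norm_iteratedFDeriv_zero] at h1
    calc ‖f i z.1‖ * bracket z.1 ^ M ≤ (1 + ‖z.1‖) ^ M * ‖f i z.1‖ := by
          rw [mul_comm]
          gcongr
          exact (bracket_pos _).le
      _ ≤ _ := h1
      _ ≤ _ := by gcongr; exact h2
  induction k generalizing f M with
  | zero => exact h0 hf M
  | succ k ih =>
    refine ⟨h0 hf M, fun j => ?_⟩
    have hd : ∀ i, ∀ z : E d × E s, fderiv ℝ (fun z : E d × E s => f i z.1) z (dir j) =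
        fderiv ℝ (f i) z.1 (dir (s := s) j).1 := fun i z =>
      fderiv_fst_comp ((f i).differentiable) j z
    simp only [hd]
    cases j with
    | inr l =>
      simp only [dir, map_zero]
      exact SymB.zero fun i z => div_nonneg (inv_nonneg.2 (pow_pos (bracket_pos _) _).le)
        (br_pos _ z).le
    | inl l =>
      have hw : ∀ z : E d × E s, (bracket z.1 ^ M)⁻¹ / br (Sum.inl l) z =
          (bracket z.1 ^ (M + 1))⁻¹ := by
        intro z; simp [br, pow_succ, div_eq_mul_inv, mul_comm]
      simp only [hw, dir]
      have := hf.image (LineDeriv.lineDerivOpCLM ℂ 𝓢(E d, ℂ) (EuclideanSpace.single l (1 : ℝ)))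
      rw [← Set.range_comp] at this
      exact ih this (M + 1)

/-- Dilates `G(z / 2^k)` of a compactly supported smooth function are uniformly symbols of order
zero. If `G` vanishes on an open set `U` such that `t k ≤ Ω z` as soon as `z / 2^k ∉ U`, then the
dilates may be multiplied by `t k` at the price of the weight `Ω`. The factors `2^(-k (l₁ + l₂))`
account for the derivatives: on the support of the dilate they are `O(⟨x⟩^(-l₁) ⟨ξ⟩^(-l₂))`. -/
theorem symB_dilate {t : ℕ → ℝ} {Ω : E d × E s → ℝ} {U : Set (E d × E s)} (hU : IsOpen U)
    (ht : ∀ k, 0 ≤ t k) (hΩ : ∀ z, 0 ≤ Ω z) (h : ∀ k z, ((2 : ℝ) ^ k)⁻¹ • z ∉ U → t k ≤ Ω z) (n : ℕ)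
    {G : E d × E s → ℝ} (hG : ContDiff ℝ ∞ G) (hc : HasCompactSupport G) (hGU : ∀ z ∈ U, G z = 0)
    (l₁ l₂ : ℕ) :
    SymB n (fun (_ : ℕ) z => Ω z * (bracket z.1 ^ l₁ * bracket z.2 ^ l₂)⁻¹)
      (fun k z => t k * (((2 : ℝ) ^ k)⁻¹ ^ (l₁ + l₂) * G (((2 : ℝ) ^ k)⁻¹ • z))) := by
  have h0 : ∀ {G : E d × E s → ℝ}, ContDiff ℝ ∞ G → HasCompactSupport G → (∀ z ∈ U, G z = 0) →
      ∀ l₁ l₂ : ℕ, ∃ C : ℝ, 0 ≤ C ∧ ∀ (k : ℕ) (z : E d × E s),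
      ‖t k * (((2 : ℝ) ^ k)⁻¹ ^ (l₁ + l₂) * G (((2 : ℝ) ^ k)⁻¹ • z))‖ ≤
        C * (Ω z * (bracket z.1 ^ l₁ * bracket z.2 ^ l₂)⁻¹) := by
    intro G hG hc hGU l₁ l₂
    obtain ⟨C, hC⟩ := hc.exists_bound_of_continuous hG.continuous
    have hC0 : 0 ≤ C := (norm_nonneg _).trans (hC 0)
    obtain ⟨R, hR⟩ := hc.isCompact.isBounded.subset_closedBall (0 : E d × E s)
    refine ⟨(1 + |R|) ^ l₁ * (1 + |R|) ^ l₂ * C, by positivity, fun k z => ?_⟩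
    by_cases hz : G (((2 : ℝ) ^ k)⁻¹ • z) = 0
    · rw [hz]
      simp only [mul_zero, norm_zero]
      have h1 := pow_pos (bracket_pos z.1) l₁
      have h2 := pow_pos (bracket_pos z.2) l₂
      have h3 := hΩ z
      positivity
    -- where the dilate does not vanish, both brackets are `O(2^k)` and `t k ≤ Ω z`
    have hzU : ((2 : ℝ) ^ k)⁻¹ • z ∉ U := fun hu => hz (hGU _ hu)
    have hzR : ‖((2 : ℝ) ^ k)⁻¹ • z‖ ≤ |R| := by
      have := hR (subset_tsupport _ hz)
      rw [mem_closedBall_zero_iff] at this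
      exact this.trans (le_abs_self R)
    set c : ℝ := ((2 : ℝ) ^ k)⁻¹ with hcdef
    have hc0 : 0 < c := by positivity
    have hc1 : c ≤ 1 := inv_le_one_of_one_le₀ (one_le_pow₀ (by norm_num))
    rw [norm_smul, Real.norm_of_nonneg hc0.le] at hzR
    have hb : ∀ {m : ℕ} (x : E m), ‖x‖ ≤ ‖z‖ → c ≤ (1 + |R|) / bracket x := by
      intro m x hx
      rw [le_div_iff₀ (bracket_pos _)]
      have h3 : bracket x ≤ 1 + ‖x‖ := by
        rw [bracket, Real.sqrt_le_left (by positivity)]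
        nlinarith [norm_nonneg x]
      have : c * ‖x‖ ≤ c * ‖z‖ := by gcongr
      nlinarith
    have h1 : c ^ l₁ ≤ ((1 + |R|) / bracket z.1) ^ l₁ :=
      pow_le_pow_left₀ hc0.le (hb _ (norm_fst_le z)) _
    have h2 : c ^ l₂ ≤ ((1 + |R|) / bracket z.2) ^ l₂ :=
      pow_le_pow_left₀ hc0.le (hb _ (norm_snd_le z)) _
    rw [norm_mul, norm_mul, Real.norm_of_nonneg (ht k), Real.norm_of_nonneg (by positivity),
      pow_add]
    calc t k * (c ^ l₁ * c ^ l₂ * ‖G (c • z)‖)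
        ≤ Ω z * (((1 + |R|) / bracket z.1) ^ l₁ * ((1 + |R|) / bracket z.2) ^ l₂ * C) := by
          have hb1 := bracket_pos z.1
          have hb2 := bracket_pos z.2
          have := hΩ z
          have := h k z hzU
          gcongr
          exact hC _
      _ = _ := by
          rw [div_pow, div_pow]
          have hb1 := (bracket_pos z.1).ne'
          have hb2 := (bracket_pos z.2).ne'
          field_simp
  induction n generalizing G l₁ l₂ with
  | zero => exact h0 hG hc hGU l₁ l₂
  | succ n ih =>
    refine ⟨h0 hG hc hGU l₁ l₂, fun j => ?_⟩
    have hG' : ContDiff ℝ ∞ (fun x => fderiv ℝ G x (dir j)) :=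
      (hG.fderiv_right (m := ∞) (by simp)).clm_apply contDiff_const
    have hc' : HasCompactSupport (fun x => fderiv ℝ G x (dir j)) := hc.fderiv_apply ℝ _
    have hGU' : ∀ z ∈ U, fderiv ℝ G z (dir j) = 0 := by
      intro z hz
      have : G =ᶠ[𝓝 z] fun _ => 0 := by
        filter_upwards [hU.mem_nhds hz] with y hy using hGU y hy
      rw [this.fderiv_eq]
      simp
    have hd : ∀ (k : ℕ) (z : E d × E s),
        fderiv ℝ (fun z => t k * (((2 : ℝ) ^ k)⁻¹ ^ (l₁ + l₂) * G (((2 : ℝ) ^ k)⁻¹ • z))) z (dir j)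
        = t k * (((2 : ℝ) ^ k)⁻¹ ^ (l₁ + l₂ + 1) * fderiv ℝ G (((2 : ℝ) ^ k)⁻¹ • z) (dir j)) := by
      intro k z
      have h1 : HasFDerivAt (fun z : E d × E s => ((2 : ℝ) ^ k)⁻¹ • z)
          (((2 : ℝ) ^ k)⁻¹ • ContinuousLinearMap.id ℝ (E d × E s)) z :=
        (((2 : ℝ) ^ k)⁻¹ • ContinuousLinearMap.id ℝ (E d × E s)).hasFDerivAt
      have h2 := ((((hG.differentiable (by simp) _).hasFDerivAt.comp z h1).const_mul
        (((2 : ℝ) ^ k)⁻¹ ^ (l₁ + l₂))).const_mul (t k)).fderiv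
      refine (DFunLike.congr_fun h2 (dir j)).trans ?_
      simp [pow_succ]
      left
      ring
    simp only [hd]
    cases j with
    | inl l =>
      have := ih hG' hc' hGU' (l₁ + 1) l₂
      rw [show l₁ + 1 + l₂ = l₁ + l₂ + 1 by ring] at this
      refine this.mono zero_le_one fun _ z => le_of_eq ?_
      simp only [br, Sum.elim_inl, pow_succ, one_mul]
      have hb1 := (bracket_pos z.1).ne'
      have hb2 := (bracket_pos z.2).ne'
      field_simp
    | inr l =>
      have := ih hG' hc' hGU' l₁ (l₂ + 1)
      rw [show l₁ + (l₂ + 1) = l₁ + l₂ + 1 by ring] at this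
      refine this.mono zero_le_one fun _ z => le_of_eq ?_
      simp only [br, Sum.elim_inr, pow_succ, one_mul]
      have hb1 := (bracket_pos z.1).ne'
      have hb2 := (bracket_pos z.2).ne'
      field_simp

/-- A smooth bump function on `ℝ^d × ℝ^s`, equal to `1` on the unit ball. -/
def unitBump (d s : ℕ) : ContDiffBump (0 : E d × E s) := ⟨1, 2, one_pos, one_lt_two⟩

/-- The smooth cut-offs `χ(z / 2^k)`, equal to `1` on the ball of radius `2^k`. -/
def cut (k : ℕ) (z : E d × E s) : ℝ := unitBump d s (((2 : ℝ) ^ k)⁻¹ • z)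

theorem cut_contDiff (k : ℕ) : ContDiff ℝ ∞ (cut k : E d × E s → ℝ) :=
  (unitBump d s).contDiff.comp (contDiff_const_smul _)

theorem cut_nonneg (k : ℕ) (z : E d × E s) : 0 ≤ cut k z := (unitBump d s).nonneg

theorem cut_le_one (k : ℕ) (z : E d × E s) : cut k z ≤ 1 := (unitBump d s).le_one

theorem cut_eq_one {k : ℕ} {z : E d × E s} (h : ‖z‖ ≤ 2 ^ k) : cut k z = 1 := by
  refine (unitBump d s).one_of_mem_closedBall ?_
  rw [mem_closedBall_zero_iff, norm_smul, norm_inv, norm_pow, Real.norm_ofNat,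
    inv_mul_le_iff₀ (by positivity)]
  simpa [unitBump] using h

theorem cut_hasCompactSupport (k : ℕ) : HasCompactSupport (cut k : E d × E s → ℝ) :=
  (unitBump d s).hasCompactSupport.comp_smul (inv_ne_zero (by positivity))

theorem cut_eventually_eq_one (z : E d × E s) : ∀ᶠ k in Filter.atTop, cut k z = 1 := by
  filter_upwards [(tendsto_pow_atTop_atTop_of_one_lt (one_lt_two (α := ℝ))).eventually_ge_atTop ‖z‖]
    with k hk using cut_eq_one hk

theorem sym_cut : Sym (fun (_ : ℕ) (_ : E d × E s) => (1 : ℝ)) cut := by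
  refine ⟨cut_contDiff, fun n => ?_⟩
  have := symB_dilate (d := d) (s := s) (t := fun _ => 1) (Ω := fun _ => 1) isOpen_empty
    (by simp) (by simp) (by simp) n (unitBump d s).contDiff (unitBump d s).hasCompactSupport
    (by simp) 0 0
  simp only [add_zero, pow_zero, inv_one, one_mul, mul_one] at this
  exact this

theorem norm_le_bracket_mul (z : E d × E s) : ‖z‖ ≤ bracket z.1 * bracket z.2 := by
  rw [Prod.norm_def, max_le_iff]
  have h1 := one_le_bracket z.1
  have h2 := one_le_bracket z.2
  have h3 := norm_le_bracket z.1
  have h4 := norm_le_bracket z.2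
  constructor <;> nlinarith

/-- The differences `1 - χ(z / 2^k)` are `O(2^{-k})` among the symbols of order `(1, 1)`, because they
and their derivatives vanish for `|z| < 2^k`, and `|z| ≤ ⟨x⟩ ⟨ξ⟩`. -/
theorem sym_one_sub_cut :
    Sym (fun (_ : ℕ) (z : E d × E s) => sgw 1 1 z) (fun k z => (2 : ℝ) ^ k * (1 - cut k z)) := by
  have hΩ : ∀ z : E d × E s, sgw 1 1 z = bracket z.1 * bracket z.2 := by intro z; simp [sgw]
  have h0 : ∃ C : ℝ, 0 ≤ C ∧ ∀ (k : ℕ) (z : E d × E s),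
      ‖(2 : ℝ) ^ k * (1 - cut k z)‖ ≤ C * sgw 1 1 z := by
    refine ⟨1, zero_le_one, fun k z => ?_⟩
    rw [one_mul, hΩ]
    rcases le_total ‖z‖ (2 ^ k) with h | h
    · rw [cut_eq_one h]
      simpa using (mul_pos (bracket_pos z.1) (bracket_pos z.2)).le
    · rw [Real.norm_of_nonneg (mul_nonneg (by positivity) (sub_nonneg.2 (cut_le_one k z)))]
      calc (2 : ℝ) ^ k * (1 - cut k z) ≤ 2 ^ k * 1 := by
            gcongr; linarith [cut_nonneg k z]
        _ ≤ _ := by rw [mul_one]; exact h.trans (norm_le_bracket_mul z)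
  refine ⟨fun k => contDiff_const.mul (contDiff_const.sub (cut_contDiff k)), fun n => ?_⟩
  cases n with
  | zero => exact h0
  | succ n =>
    refine ⟨h0, fun j => ?_⟩
    -- the derivatives are dilates of a compactly supported function, unlike `1 - cut k` itself
    have hd : ∀ (k : ℕ) (z : E d × E s),
        fderiv ℝ (fun z => (2 : ℝ) ^ k * (1 - cut k z)) z (dir j) =
        2 ^ k * (((2 : ℝ) ^ k)⁻¹ ^ 1 * -fderiv ℝ (unitBump d s) (((2 : ℝ) ^ k)⁻¹ • z) (dir j)) := by
      intro k z
      have h1 : HasFDerivAt (fun z : E d × E s => ((2 : ℝ) ^ k)⁻¹ • z)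
          (((2 : ℝ) ^ k)⁻¹ • ContinuousLinearMap.id ℝ (E d × E s)) z :=
        (((2 : ℝ) ^ k)⁻¹ • ContinuousLinearMap.id ℝ (E d × E s)).hasFDerivAt
      have h2 := ((((((unitBump d s).contDiff (n := ⊤)).differentiable (by simp)
        _).hasFDerivAt.comp z h1).const_sub 1).const_mul ((2 : ℝ) ^ k)).fderiv
      refine (DFunLike.congr_fun h2 (dir j)).trans ?_
      simp
    simp only [hd]
    have hb : ContDiff ℝ ∞ (unitBump d s : E d × E s → ℝ) := (unitBump d s).contDiff
    have hb' : ContDiff ℝ ∞ (fderiv ℝ (unitBump d s)) := hb.fderiv_right (by simp)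
    have hG' : ContDiff ℝ ∞ (fun x => -fderiv ℝ (unitBump d s) x (dir j)) :=
      (hb'.clm_apply contDiff_const).neg
    have hc' : HasCompactSupport (fun x => -fderiv ℝ (unitBump d s) x (dir j)) :=
      ((unitBump d s).hasCompactSupport.fderiv_apply ℝ _).neg
    have hU : ∀ k (z : E d × E s), ((2 : ℝ) ^ k)⁻¹ • z ∉ Metric.ball (0 : E d × E s) 1 →
        (2 : ℝ) ^ k ≤ bracket z.1 * bracket z.2 := by
      intro k z hz
      rw [mem_ball_zero_iff, norm_smul, norm_inv, norm_pow, Real.norm_ofNat, not_lt,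
        le_inv_mul_iff₀ (by positivity), mul_one] at hz
      exact hz.trans (norm_le_bracket_mul z)
    have hGU : ∀ z ∈ Metric.ball (0 : E d × E s) 1, -fderiv ℝ (unitBump d s) z (dir j) = 0 := by
      intro z hz
      have : (unitBump d s : E d × E s → ℝ) =ᶠ[𝓝 z] fun _ => 1 := by
        filter_upwards [Metric.isOpen_ball.mem_nhds hz] with y hy
        exact (unitBump d s).one_of_mem_closedBall (Metric.ball_subset_closedBall hy)
      rw [this.fderiv_eq]
      simp
    have hpos : ∀ z : E d × E s, 0 ≤ bracket z.1 * bracket z.2 := fun z =>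
      (mul_pos (bracket_pos z.1) (bracket_pos z.2)).le
    cases j with
    | inl l =>
      refine (symB_dilate Metric.isOpen_ball (t := fun k => 2 ^ k)
        (fun k => by positivity) hpos hU n hG' hc' hGU 1 0).mono zero_le_one fun _ z => ?_
      rw [hΩ]; simp [br, div_eq_mul_inv]
    | inr l =>
      refine (symB_dilate Metric.isOpen_ball (t := fun k => 2 ^ k)
        (fun k => by positivity) hpos hU n hG' hc' hGU 0 1).mono zero_le_one fun _ z => ?_
      rw [hΩ]; simp [br, div_eq_mul_inv]

/-- The differences of consecutive cut-offs are `O(2^{-k})` among the symbols of order `(1, 1)`. -/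
theorem sym_cut_sub_cut :
    Sym (fun (_ : ℕ) (z : E d × E s) => sgw 1 1 z)
      (fun k z => (2 : ℝ) ^ k * (cut (k + 1) z - cut k z)) := by
  have h := (sym_one_sub_cut (d := d) (s := s)).sub
    (((sym_one_sub_cut (d := d) (s := s)).reindex (fun k : ℕ => k + 1)).clm
      ((1 / 2 : ℝ) • ContinuousLinearMap.id ℝ ℝ))
  convert h using 3 with k z
  simp only [FunLike.coe_smul, Pi.smul_apply, smul_eq_mul, ContinuousLinearMap.id_apply, pow_succ]
  ring

end

section

variable {d s : ℕ} {ι κ : Type*}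

/-! ### Integration by parts -/

instance isAddHaarMeasure_volume_prod :
    (volume : Measure (E d × E s)).IsAddHaarMeasure :=
  inferInstanceAs ((volume : Measure (E d)).prod (volume : Measure (E s))).IsAddHaarMeasure

/-- The derivative in the coordinate direction `j` of the phase `φ(x,ξ) - x·p`. -/
def phaseD (φ : E d × E s → ℝ) (p : E d) (j : Fin d ⊕ Fin s) (z : E d × E s) : ℝ :=
  fderiv ℝ φ z (dir j) - Sum.elim (fun l => p l) (fun _ => 0) j

/-- The function `⟨x⟩² |∇_x φ - p|² + ⟨ξ⟩² |∇_ξ φ|²`. -/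
def phaseA (φ : E d × E s → ℝ) (p : E d) (z : E d × E s) : ℝ :=
  ∑ j, (br j z * phaseD φ p j z) ^ 2

/-- The weight `⟨x⟩^n ⟨ξ⟩^ν + ⟨x⟩ |p|`, whose square is the order of growth of `phaseA φ p`. -/
def phaseW (n ν : ℝ) (p : E d) (z : E d × E s) : ℝ := sgw n ν z + bracket z.1 * ‖p‖

/-- The oscillating factor `e^{i(φ(x,ξ) - x·p)}`. -/
def osc (φ : E d × E s → ℝ) (p : E d) (z : E d × E s) : ℂ :=
  Complex.exp (Complex.I * ((φ z - inner ℝ z.1 p : ℝ) : ℂ))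

/-- The phases `φ(x,ξ) - x·p`, `p ∈ P`, are uniformly elliptic in both variables on the set where
the symbol `h` vanishes, up to the symbol `e` of order zero. Typically `e` has compact support. -/
structure PhaseElliptic (n ν : ℝ) (φ h e : E d × E s → ℝ) (P : Set (E d)) : Prop where
  n_pos : 0 < n
  nu_pos : 0 < ν
  sym_phase : Sym (fun _ : Unit => sgw n ν) (fun _ => φ)
  sym_h : Sym (fun (_ : Unit) _ => (1 : ℝ)) (fun _ => h)
  sym_e : Sym (fun (_ : Unit) _ => (1 : ℝ)) (fun _ => e)
  elliptic : ∃ c : ℝ, 0 < c ∧ ∀ p ∈ P, ∀ z,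
    c * phaseW n ν p z ^ 2 ≤ phaseA φ p z + h z * phaseW n ν p z ^ 2 + e z

theorem one_le_sgw {n ν : ℝ} (hn : 0 ≤ n) (hν : 0 ≤ ν) (z : E d × E s) : 1 ≤ sgw n ν z :=
  one_le_mul_of_one_le_of_one_le (Real.one_le_rpow (one_le_bracket _) hn)
    (Real.one_le_rpow (one_le_bracket _) hν)

theorem sgw_le_phaseW (n ν : ℝ) (p : E d) (z : E d × E s) : sgw n ν z ≤ phaseW n ν p z :=
  le_add_of_nonneg_right (mul_nonneg (bracket_pos _).le (norm_nonneg _))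

theorem norm_le_phaseW_div (n ν : ℝ) (p : E d) (z : E d × E s) :
    ‖p‖ ≤ phaseW n ν p z / bracket z.1 := by
  rw [le_div_iff₀ (bracket_pos _), phaseW, mul_comm]
  exact le_add_of_nonneg_left (sgw_pos n ν z).le

theorem phaseW_pos (n ν : ℝ) (p : E d) (z : E d × E s) : 0 < phaseW n ν p z :=
  (sgw_pos n ν z).trans_le (sgw_le_phaseW n ν p z)

theorem norm_le_phaseW (n ν : ℝ) (p : E d) (z : E d × E s) : ‖p‖ ≤ phaseW n ν p z :=
  (norm_le_phaseW_div n ν p z).trans (div_le_self (phaseW_pos n ν p z).le (one_le_bracket _))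

theorem sym_phaseW (n ν : ℝ) (p : ι → E d) :
    Sym (fun i (z : E d × E s) => phaseW n ν (p i) z) (fun i z => phaseW n ν (p i) z) := by
  have h1 := (sym_sgw (ι := ι) (d := d) (s := s) n ν).mono' (w' := fun i z => phaseW n ν (p i) z)
    fun i z => sgw_le_phaseW n ν (p i) z
  have h2 : Sym (fun i (_ : E d × E s) => ‖p i‖) (fun i _ => ‖p i‖) := Sym.const fun i z => by simp
  have h3 := (sym_bracket_rpow_fst (ι := ι) (d := d) (s := s) 1).mul h2
  simp only [Real.rpow_one] at h3
  exact h1.add (h3.mono' fun i z => le_add_of_nonneg_left (sgw_pos n ν z).le)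

theorem sym_br_sq (j : Fin d ⊕ Fin s) :
    Sym (fun (_ : ι) z => br j z ^ 2) (fun _ z => br j z ^ 2) := by
  cases j with
  | inl l => exact sym_bracket_sq_fst
  | inr l => exact sym_bracket_sq_snd

section

variable {n ν : ℝ} {φ h e : E d × E s → ℝ} {P : Set (E d)}

theorem sym_phaseD (hφ : Sym (fun _ : Unit => sgw n ν) (fun _ => φ)) (p : ι → E d)
    (j : Fin d ⊕ Fin s) :
    Sym (fun i z => phaseW n ν (p i) z / br j z) (fun i z => phaseD φ (p i) j z) := by
  refine Sym.sub ?_ ?_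
  · exact (((hφ.fderiv j).reindex (fun _ : ι => ()))).mono' fun i z =>
      div_le_div_of_nonneg_right (sgw_le_phaseW n ν _ z) (br_pos j z).le
  · refine Sym.const fun i z => ?_
    cases j with
    | inl l => exact (PiLp.norm_apply_le (p i) l).trans (norm_le_phaseW_div n ν _ z)
    | inr l => simpa using div_nonneg (phaseW_pos n ν (p i) z).le (br_pos _ z).le

theorem sym_phaseA (hφ : Sym (fun _ : Unit => sgw n ν) (fun _ => φ)) (p : ι → E d) :
    Sym (fun i z => phaseW n ν (p i) z ^ 2) (fun i z => phaseA φ (p i) z) := by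
  refine Sym.sum _ (fun i z => by positivity) fun j _ => ?_
  have h1 := sym_phaseD hφ p j
  have h2 := (sym_br_sq (ι := ι) j).mul (h1.mul h1)
  have e1 : (fun i z => (br j z * phaseD φ (p i) j z) ^ 2) =
      fun i z => br j z ^ 2 * (phaseD φ (p i) j z * phaseD φ (p i) j z) := by
    funext i z; ring
  rw [e1]
  refine h2.mono' fun i z => le_of_eq ?_
  have := (br_pos j z).ne'
  field_simp

namespace PhaseElliptic

/-- The elliptic denominator `Q = A + h W² + e`, where `A` is `phaseA φ p` and `W` is the weight
`phaseW n ν p`. It is bounded below by a multiple of `W²`. -/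
def denom (n ν : ℝ) (φ h e : E d × E s → ℝ) (p : E d) (z : E d × E s) : ℝ :=
  phaseA φ p z + h z * phaseW n ν p z ^ 2 + e z

/-- The coefficients `c_j = ⟨·⟩_j² ∂_jΦ / Q` of the operator of integration by parts, where `Φ` is
the phase and `Q` the elliptic denominator. -/
def coef (n ν : ℝ) (φ h e : E d × E s → ℝ) (p : E d) (j : Fin d ⊕ Fin s) (z : E d × E s) : ℝ :=
  br j z ^ 2 * phaseD φ p j z * (denom n ν φ h e p z)⁻¹

/-- The operator `b ↦ i ∑_j ∂_j (c_j b) + (e / Q) b`, which lowers the order of amplitudes and does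
not change oscillatory integrals with phase `φ(x,ξ) - x·p`. -/
def ibp (n ν : ℝ) (φ h e : E d × E s → ℝ) (p : E d) (b : E d × E s → ℂ) (z : E d × E s) : ℂ :=
  Complex.I * ∑ j, fderiv ℝ (fun z => (coef n ν φ h e p j z : ℂ) * b z) z (dir j) +
    ((e z * (denom n ν φ h e p z)⁻¹ : ℝ) : ℂ) * b z

variable (H : PhaseElliptic n ν φ h e P) {p : ι → E d} (hp : ∀ i, p i ∈ P)
include H

theorem one_le_phaseW (p : E d) (z : E d × E s) : 1 ≤ phaseW n ν p z :=
  (one_le_sgw H.n_pos.le H.nu_pos.le z).trans (sgw_le_phaseW n ν p z)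

include hp

theorem denom_pos (i : ι) (z : E d × E s) : 0 < denom n ν φ h e (p i) z := by
  obtain ⟨c, hc, hell⟩ := H.elliptic
  exact (mul_pos hc (pow_pos (phaseW_pos n ν _ z) 2)).trans_le (hell _ (hp i) z)

theorem sym_denom_inv :
    Sym (fun i z => (phaseW n ν (p i) z ^ 2)⁻¹) (fun i z => (denom n ν φ h e (p i) z)⁻¹) := by
  have hW2 : Sym (fun i (z : E d × E s) => phaseW n ν (p i) z ^ 2) (fun i z => phaseW n ν (p i) z ^ 2) := by
    simpa only [sq] using (sym_phaseW (s := s) n ν p).mul (sym_phaseW n ν p)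
  have hA := sym_phaseA H.sym_phase p
  have hh : Sym (fun i z => phaseW n ν (p i) z ^ 2) (fun i z => h z * phaseW n ν (p i) z ^ 2) :=
    ((H.sym_h.reindex (fun _ : ι => ())).mul hW2).mono' fun i z => by rw [one_mul]
  have he : Sym (fun i z => phaseW n ν (p i) z ^ 2) (fun _ z => e z) :=
    (H.sym_e.reindex (fun _ : ι => ())).mono' fun i z => one_le_pow₀ (H.one_le_phaseW _ z)
  obtain ⟨c, hc, hell⟩ := H.elliptic
  have := ((hA.add hh).add he).rpow hc (fun i z => pow_pos (phaseW_pos n ν _ z) 2)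
    (fun i z => hell _ (hp i) z) (-1)
  simp only [Real.rpow_neg_one] at this
  exact this

theorem sym_coef (j : Fin d ⊕ Fin s) :
    Sym (fun i z => br j z / phaseW n ν (p i) z) (fun i z => coef n ν φ h e (p i) j z) := by
  refine (((sym_br_sq (ι := ι) j).mul (sym_phaseD H.sym_phase p j)).mul
    (H.sym_denom_inv hp)).mono' fun i z => le_of_eq ?_
  have h1 := (br_pos j z).ne'
  have h2 := (phaseW_pos n ν (p i) z).ne'
  field_simp

theorem sym_ibp {v : ι → E d × E s → ℝ} (hv : ∀ i z, 0 ≤ v i z) {b : ι → E d × E s → ℂ}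
    (hb : Sym v b) :
    Sym (fun i z => v i z / phaseW n ν (p i) z) (fun i => ibp n ν φ h e (p i) (b i)) := by
  have hv' : ∀ i z, 0 ≤ v i z / phaseW n ν (p i) z := fun i z =>
    div_nonneg (hv i z) (phaseW_pos n ν _ z).le
  refine Sym.add ?_ ?_
  · refine (Sym.sum Finset.univ hv' fun j _ => ?_).clm
      (Complex.I • ContinuousLinearMap.id ℝ ℂ)
    refine (((H.sym_coef hp j).ofReal.mul hb).fderiv j).mono' fun i z => le_of_eq ?_
    have h1 := (br_pos j z).ne'
    have h2 := (phaseW_pos n ν (p i) z).ne'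
    field_simp
  · refine ((((H.sym_e.reindex (fun _ : ι => ())).mul (H.sym_denom_inv hp)).ofReal).mul
      hb).mono' fun i z => ?_
    rw [one_mul, div_eq_mul_inv, mul_comm]
    refine mul_le_mul_of_nonneg_left ?_ (hv i z)
    exact inv_anti₀ (phaseW_pos n ν _ z) (by nlinarith [H.one_le_phaseW (p i) z])

omit hp H in
theorem ibp_eventuallyEq_zero {p : E d} {b : E d × E s → ℂ} {z : E d × E s}
    (hz : b =ᶠ[𝓝 z] 0) : ibp n ν φ h e p b z = 0 := by
  have h1 : ∀ j, fderiv ℝ (fun z => (coef n ν φ h e p j z : ℂ) * b z) z = 0 := by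
    intro j
    have : (fun z => (coef n ν φ h e p j z : ℂ) * b z) =ᶠ[𝓝 z] fun _ => 0 := by
      filter_upwards [hz] with y hy
      simp [hy]
    rw [this.fderiv_eq]
    simp
  simp [ibp, h1, hz.eq_of_nhds]

/-- The identity `∫ e^{iΦ} T b = ∫ e^{iΦ} b` for the operator `T` of `ibp`: integration by parts turns
`i ∂_j` into multiplication by `∂_jΦ`, and `∑_j c_j ∂_jΦ + e / Q = 1` where `h = 0`, hence on the
support of `b`. -/
theorem integral_ibp (i : ι) {b : E d × E s → ℂ} (hb : ContDiff ℝ ∞ b) (hc : HasCompactSupport b)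
    (hhb : ∀ z, h z ≠ 0 → b z = 0) :
    ∫ z, osc φ (p i) z * ibp n ν φ h e (p i) b z = ∫ z, osc φ (p i) z * b z := by
  have hφs : ContDiff ℝ ∞ φ := H.sym_phase.smooth ()
  have hΦ : ContDiff ℝ ∞ (fun z : E d × E s => φ z - inner ℝ z.1 (p i)) :=
    hφs.sub (contDiff_fst.inner ℝ contDiff_const)
  have hosc : ContDiff ℝ ∞ (osc φ (p i)) :=
    (contDiff_const.mul (Complex.ofRealCLM.contDiff.comp hΦ)).cexp
  have hD : ∀ j z, fderiv ℝ (osc φ (p i)) z (dir j) =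
      Complex.I * phaseD φ (p i) j z * osc φ (p i) z := by
    intro j z
    have hin : HasFDerivAt (fun z : E d × E s => inner ℝ z.1 (p i))
        (((innerSL ℝ) (p i)).comp (ContinuousLinearMap.fst ℝ _ _)) z := by
      have := (((innerSL ℝ) (p i)).comp (ContinuousLinearMap.fst ℝ (E d) (E s))).hasFDerivAt (x := z)
      refine this.congr_of_eventuallyEq (Filter.Eventually.of_forall fun x => ?_)
      simp [real_inner_comm]
    have := ((Complex.ofRealCLM.hasFDerivAt.comp z ((hφs.differentiable (by simp)
      z).hasFDerivAt.sub hin)).const_mul Complex.I).cexp.fderiv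
    refine (DFunLike.congr_fun this (dir j)).trans ?_
    have hj : inner ℝ (p i) (dir (s := s) j).1 = Sum.elim (fun l => p i l) (fun _ => 0) j := by
      cases j <;> simp [dir, EuclideanSpace.inner_single_right]
    simp [osc, phaseD, hj]
    ring
  have hcs : ∀ j, ContDiff ℝ ∞ (fun z => (coef n ν φ h e (p i) j z : ℂ)) := fun j =>
    ((H.sym_coef hp j).ofReal.smooth i)
  have hcb : ∀ j, ContDiff ℝ ∞ (fun z => (coef n ν φ h e (p i) j z : ℂ) * b z) := fun j =>
    (hcs j).mul hb
  have hcc : ∀ j, HasCompactSupport (fun z => (coef n ν φ h e (p i) j z : ℂ) * b z) := fun j =>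
    hc.mul_left
  have hfd : ∀ j, ContDiff ℝ ∞
      (fun z => fderiv ℝ (fun z => (coef n ν φ h e (p i) j z : ℂ) * b z) z (dir j)) := fun j =>
    ((hcb j).fderiv_right (m := ∞) (by simp)).clm_apply contDiff_const
  have hI1 : ∀ j, Integrable (fun z => osc φ (p i) z *
      fderiv ℝ (fun z => (coef n ν φ h e (p i) j z : ℂ) * b z) z (dir j)) := fun j =>
    (hosc.continuous.mul (hfd j).continuous).integrable_of_hasCompactSupport
      ((hcc j).fderiv_apply ℝ _).mul_left
  have hI2 : ∀ j, Integrable (fun z => fderiv ℝ (osc φ (p i)) z (dir j) *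
      ((coef n ν φ h e (p i) j z : ℂ) * b z)) := fun j =>
    ((((hosc.fderiv_right (m := ∞) (by simp)).clm_apply contDiff_const).continuous).mul
      (hcb j).continuous).integrable_of_hasCompactSupport (hcc j).mul_left
  have hparts : ∀ j, ∫ z, osc φ (p i) z *
      fderiv ℝ (fun z => (coef n ν φ h e (p i) j z : ℂ) * b z) z (dir j) =
      - ∫ z, fderiv ℝ (osc φ (p i)) z (dir j) * ((coef n ν φ h e (p i) j z : ℂ) * b z) := fun j =>
    integral_mul_fderiv_eq_neg_fderiv_mul_of_integrable (hI2 j) (hI1 j)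
      ((hosc.continuous.mul (hcb j).continuous).integrable_of_hasCompactSupport (hcc j).mul_left)
      (fun z _ => hosc.differentiable (by simp) z) (fun z _ => (hcb j).differentiable (by simp) z)
  have hes : ContDiff ℝ ∞ (fun z => ((e z * (denom n ν φ h e (p i) z)⁻¹ : ℝ) : ℂ)) :=
    (((H.sym_e.reindex (fun _ : ι => ())).mul (H.sym_denom_inv hp)).ofReal).smooth i
  have hI3 : Integrable (fun z => osc φ (p i) z *
      (((e z * (denom n ν φ h e (p i) z)⁻¹ : ℝ) : ℂ) * b z)) :=
    (hosc.continuous.mul (hes.mul hb).continuous).integrable_of_hasCompactSupport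
      hc.mul_left.mul_left
  calc ∫ z, osc φ (p i) z * ibp n ν φ h e (p i) b z
      = ∫ z, ((∑ j, Complex.I * (osc φ (p i) z *
          fderiv ℝ (fun z => (coef n ν φ h e (p i) j z : ℂ) * b z) z (dir j))) +
          osc φ (p i) z * (((e z * (denom n ν φ h e (p i) z)⁻¹ : ℝ) : ℂ) * b z)) := by
        refine integral_congr_ae (Filter.Eventually.of_forall fun z => ?_)
        simp only [ibp, mul_add, Finset.mul_sum]
        congr 1
        refine Finset.sum_congr rfl fun j _ => by ring
    _ = (∑ j, Complex.I * ∫ z, osc φ (p i) z *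
          fderiv ℝ (fun z => (coef n ν φ h e (p i) j z : ℂ) * b z) z (dir j)) +
          ∫ z, osc φ (p i) z * (((e z * (denom n ν φ h e (p i) z)⁻¹ : ℝ) : ℂ) * b z) := by
        rw [integral_add (integrable_finsetSum _ fun j _ => (hI1 j).const_mul _) hI3,
          integral_finsetSum _ fun j _ => (hI1 j).const_mul _]
        simp only [integral_const_mul]
    _ = ∫ z, ((∑ j, (-Complex.I) * (fderiv ℝ (osc φ (p i)) z (dir j) *
          ((coef n ν φ h e (p i) j z : ℂ) * b z))) +
          osc φ (p i) z * (((e z * (denom n ν φ h e (p i) z)⁻¹ : ℝ) : ℂ) * b z)) := by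
        rw [integral_add (integrable_finsetSum _ fun j _ => (hI2 j).const_mul _) hI3,
          integral_finsetSum _ fun j _ => (hI2 j).const_mul _]
        simp only [integral_const_mul, hparts]
        simp
    _ = _ := by
        refine integral_congr_ae (Filter.Eventually.of_forall fun z => ?_)
        simp only [hD]
        by_cases hz : h z = 0
        · have hQ := (H.denom_pos hp i z).ne'
          have hsum : ∑ j, phaseD φ (p i) j z * coef n ν φ h e (p i) j z +
              e z * (denom n ν φ h e (p i) z)⁻¹ = 1 := by
            have : ∑ j, phaseD φ (p i) j z * coef n ν φ h e (p i) j z =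
                phaseA φ (p i) z * (denom n ν φ h e (p i) z)⁻¹ := by
              rw [phaseA, Finset.sum_mul]
              exact Finset.sum_congr rfl fun j _ => by rw [coef]; ring
            rw [this, ← add_mul, mul_inv_eq_one₀ hQ, denom, hz]
            ring
          have hsum' := congrArg (fun t : ℝ => osc φ (p i) z * ((t : ℂ) * b z)) hsum
          simp only [Complex.ofReal_add, Complex.ofReal_sum, Complex.ofReal_one, one_mul] at hsum'
          rw [← hsum', add_mul, mul_add, Finset.sum_mul, Finset.mul_sum]
          congr 1
          refine Finset.sum_congr rfl fun j _ => ?_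
          push_cast
          linear_combination (-(phaseD φ (p i) j z : ℂ) * osc φ (p i) z *
            coef n ν φ h e (p i) j z * b z) * Complex.I_sq
        · simp [hhb z hz]

/-- Repeated integration by parts. The supports of the amplitudes do not grow, so that they stay
compact and within the set where `h = 0`. -/
theorem exists_ibp_iterate {v : ι → E d × E s → ℝ} (hv : ∀ i z, 0 ≤ v i z)
    {b : ι → E d × E s → ℂ} (hb : Sym v b) (hc : ∀ i, HasCompactSupport (b i))
    (hhb : ∀ i z, h z ≠ 0 → b i z = 0) (N : ℕ) :
    ∃ b' : ι → E d × E s → ℂ, Sym (fun i z => v i z / phaseW n ν (p i) z ^ N) b' ∧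
      ∀ i, ∫ z, osc φ (p i) z * b i z = ∫ z, osc φ (p i) z * b' i z := by
  suffices ∃ b' : ι → E d × E s → ℂ, (Sym (fun i z => v i z / phaseW n ν (p i) z ^ N) b' ∧
      ∀ i, ∫ z, osc φ (p i) z * b i z = ∫ z, osc φ (p i) z * b' i z) ∧
      (∀ i, HasCompactSupport (b' i)) ∧ (∀ i z, h z ≠ 0 → b' i z = 0) from
    this.imp fun _ h => h.1
  induction N with
  | zero => exact ⟨b, ⟨by simpa using hb, fun i => rfl⟩, hc, hhb⟩
  | succ N ih =>
    obtain ⟨b', ⟨h1, h2⟩, h3, h4⟩ := ih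
    refine ⟨fun i => ibp n ν φ h e (p i) (b' i), ⟨?_, fun i => ?_⟩, fun i => ?_, fun i z hz => ?_⟩
    · refine (H.sym_ibp hp (fun i z => div_nonneg (hv i z)
        (pow_pos (phaseW_pos n ν _ z) N).le) h1).mono' fun i z => le_of_eq ?_
      rw [div_div, pow_succ]
    · rw [h2, H.integral_ibp hp i (h1.smooth i) (h3 i) (h4 i)]
    · refine (h3 i).mono' fun z hz => ?_
      by_contra hz'
      exact hz (ibp_eventuallyEq_zero (notMem_tsupport_iff_eventuallyEq.1 hz'))
    · refine ibp_eventuallyEq_zero ?_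
      have : IsOpen {z | h z ≠ 0} :=
        isOpen_ne_fun (H.sym_h.smooth ()).continuous continuous_const
      filter_upwards [this.mem_nhds hz] with y hy using h4 i y hy

end PhaseElliptic

theorem integrable_bracket {r : ℝ} (hr : r < -(d : ℝ)) :
    Integrable (fun x : E d => bracket x ^ r) := by
  have := integrable_rpow_neg_one_add_norm_sq (μ := (volume : Measure (E d))) (r := -r)
    (by simpa using by linarith)
  refine this.congr (Filter.Eventually.of_forall fun x => ?_)
  simp only [neg_neg]
  rw [← bracket_rpow, bracket_sq]

theorem integrable_sgw {m μ : ℝ} (hm : m < -(d : ℝ)) (hμ : μ < -(s : ℝ)) :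
    Integrable (fun z : E d × E s => sgw m μ z) :=
  (integrable_bracket hm).mul_prod (integrable_bracket hμ)

theorem norm_osc (φ : E d × E s → ℝ) (p : E d) (z : E d × E s) : ‖osc φ p z‖ = 1 := by
  rw [osc, Complex.norm_exp]
  simp

/-- Oscillatory integrals over regions of ellipticity are bounded, uniformly for bounded families
of compactly supported amplitudes, and decrease rapidly in the frequency `p`. -/
theorem PhaseElliptic.exists_bound (H : PhaseElliptic n ν φ h e P) {p : ι → E d}
    (hp : ∀ i, p i ∈ P) {m μ : ℝ} {b : ι → E d × E s → ℂ} (hb : Sym (fun _ => sgw m μ) b)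
    (hc : ∀ i, HasCompactSupport (b i)) (hhb : ∀ i z, h z ≠ 0 → b i z = 0) (M : ℕ) :
    ∃ C : ℝ, 0 ≤ C ∧ ∀ i, (1 + ‖p i‖) ^ M * ‖∫ z, osc φ (p i) z * b i z‖ ≤ C := by
  have hn := H.n_pos
  have hν := H.nu_pos
  -- `K` integrations by parts make the integral absolutely convergent, `M` more give the decay in `p`
  obtain ⟨K, hK1, hK2⟩ : ∃ K : ℕ, m - n * K < -(d : ℝ) ∧ μ - ν * K < -(s : ℝ) := by
    obtain ⟨K₁, h₁⟩ := exists_nat_gt ((m + d) / n)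
    obtain ⟨K₂, h₂⟩ := exists_nat_gt ((μ + s) / ν)
    rw [div_lt_iff₀ hn] at h₁
    rw [div_lt_iff₀ hν] at h₂
    refine ⟨K₁ + K₂, ?_, ?_⟩ <;> push_cast
    · nlinarith [mul_nonneg hn.le (Nat.cast_nonneg (α := ℝ) K₂)]
    · nlinarith [mul_nonneg hν.le (Nat.cast_nonneg (α := ℝ) K₁)]
  obtain ⟨b', hb', hint⟩ := H.exists_ibp_iterate hp (fun _ z => (sgw_pos m μ z).le) hb hc hhb (K + M)
  obtain ⟨C, hC, hbd⟩ := hb'.bound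
  have hI := integrable_sgw (d := d) (s := s) hK1 hK2
  refine ⟨2 ^ M * (C * ∫ z : E d × E s, sgw (m - n * K) (μ - ν * K) z), ?_, fun i => ?_⟩
  · exact mul_nonneg (by positivity) (mul_nonneg hC (integral_nonneg fun z => (sgw_pos _ _ z).le))
  have hpt : ∀ z, (1 + ‖p i‖) ^ M * ‖osc φ (p i) z * b' i z‖ ≤
      2 ^ M * (C * sgw (m - n * K) (μ - ν * K) z) := by
    intro z
    rw [norm_mul, norm_osc, one_mul]
    have hW := phaseW_pos n ν (p i) z
    have h1 : (1 + ‖p i‖) ^ M ≤ (2 * phaseW n ν (p i) z) ^ M := by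
      refine pow_le_pow_left₀ (by positivity) ?_ M
      linarith [H.one_le_phaseW (p i) z, norm_le_phaseW n ν (p i) z]
    have h2 : sgw m μ z / phaseW n ν (p i) z ^ K ≤ sgw (m - n * K) (μ - ν * K) z := by
      rw [div_le_iff₀ (pow_pos hW K)]
      have h3 : sgw n ν z ^ K = sgw (n * K) (ν * K) z := by
        simp only [sgw, mul_pow, Real.rpow_mul (bracket_pos _).le, Real.rpow_natCast]
      calc sgw m μ z = sgw (m - n * K) (μ - ν * K) z * sgw n ν z ^ K := by
            rw [h3, sgw_mul]; simp
        _ ≤ _ := by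
            have := sgw_pos (m - n * K) (μ - ν * K) z
            have := sgw_pos n ν z
            gcongr
            exact sgw_le_phaseW n ν _ z
    calc (1 + ‖p i‖) ^ M * ‖b' i z‖
        ≤ (2 * phaseW n ν (p i) z) ^ M * (C * (sgw m μ z / phaseW n ν (p i) z ^ (K + M))) := by
          gcongr
          exact hbd i z
      _ = 2 ^ M * (C * (sgw m μ z / phaseW n ν (p i) z ^ K)) := by
          rw [pow_add, mul_pow]
          field_simp
      _ ≤ _ := by gcongr
  rw [hint]
  calc (1 + ‖p i‖) ^ M * ‖∫ z, osc φ (p i) z * b' i z‖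
      = ‖∫ z, (((1 + ‖p i‖) ^ M : ℝ) : ℂ) * (osc φ (p i) z * b' i z)‖ := by
        rw [integral_const_mul, norm_mul, Complex.norm_real, Real.norm_of_nonneg (by positivity)]
    _ ≤ ∫ z, 2 ^ M * (C * sgw (m - n * K) (μ - ν * K) z) := by
        refine norm_integral_le_of_norm_le ((hI.const_mul C).const_mul _)
          (Filter.Eventually.of_forall fun z => ?_)
        rw [norm_mul, Complex.norm_real, Real.norm_of_nonneg (by positivity)]
        exact hpt z
    _ = _ := by rw [integral_const_mul, integral_const_mul]

end

end

section

variable {d s : ℕ} {ι κ : Type*} {n ν : ℝ} {φ h e : E d × E s → ℝ} {P : Set (E d)}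

/-! ### Ellipticity of phase functions -/

theorem IsAdmissiblePhase.sym_phase (hφ : IsAdmissiblePhase n ν φ) :
    Sym (fun _ : Unit => sgw n ν) (fun _ => φ) := by
  simpa using (SG.sym (ι := Unit) hφ.symbol).clm Complex.reCLM

theorem phaseA_eq (hφ : Differentiable ℝ φ) (p : E d) (x : E d) (ξ : E s) :
    phaseA φ p (x, ξ) =
      bracket x ^ 2 * ‖gradX φ x ξ - p‖ ^ 2 + bracket ξ ^ 2 * ‖gradXi φ x ξ‖ ^ 2 := by
  have h1 : ∀ v, inner ℝ (gradX φ x ξ) v = fderiv ℝ φ (x, ξ) (v, 0) := by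
    intro v
    have := ((hφ (x, ξ)).hasFDerivAt.comp x
      (hasFDerivAt_prodMk_left (𝕜 := ℝ) x ξ)).fderiv
    rw [gradX, gradient, InnerProductSpace.toDual_symm_apply]
    exact DFunLike.congr_fun this v
  have h2 : ∀ v, inner ℝ (gradXi φ x ξ) v = fderiv ℝ φ (x, ξ) (0, v) := by
    intro v
    have := ((hφ (x, ξ)).hasFDerivAt.comp ξ
      (hasFDerivAt_prodMk_right (𝕜 := ℝ) x ξ)).fderiv
    rw [gradXi, gradient, InnerProductSpace.toDual_symm_apply]
    exact DFunLike.congr_fun this v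
  rw [phaseA, Fintype.sum_sum_type, EuclideanSpace.norm_sq_eq, EuclideanSpace.norm_sq_eq,
    Finset.mul_sum, Finset.mul_sum]
  congr 1
  · refine Finset.sum_congr rfl fun l _ => ?_
    have := h1 (EuclideanSpace.single l 1)
    simp only [EuclideanSpace.inner_single_right, one_mul, conj_trivial] at this
    simp [phaseD, dir, br, ← this, mul_pow]
  · refine Finset.sum_congr rfl fun l _ => ?_
    have := h2 (EuclideanSpace.single l 1)
    simp only [EuclideanSpace.inner_single_right, one_mul, conj_trivial] at this
    simp [phaseD, dir, br, ← this, mul_pow]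

theorem phaseA_nonneg (p : E d) (z : E d × E s) : 0 ≤ phaseA φ p z :=
  Finset.sum_nonneg fun _ _ => sq_nonneg _

theorem sgw_sq (n ν : ℝ) (z : E d × E s) : sgw n ν z ^ 2 = sgw (2 * n) (2 * ν) z := by
  rw [sq, sgw_mul, two_mul, two_mul]

/-- The frequency `p` is controlled by `∇_x φ - p` and the order of the phase. -/
theorem exists_phaseW_sq_le (hφ : Sym (fun _ : Unit => sgw n ν) (fun _ => φ)) :
    ∃ K : ℝ, 0 < K ∧ ∀ (p : E d) z, phaseW n ν p z ^ 2 ≤ K * (sgw n ν z ^ 2 + phaseA φ p z) := by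
  obtain ⟨C, hC, hb⟩ := (sym_phaseA hφ (fun _ : Unit => (0 : E d))).bound
  have hd : Differentiable ℝ φ := (hφ.smooth ()).differentiable (by simp)
  refine ⟨3 * (1 + C) + 3, by positivity, fun p z => ?_⟩
  obtain ⟨x, ξ⟩ := z
  have h1 := hb () (x, ξ)
  rw [Real.norm_of_nonneg (phaseA_nonneg _ _), phaseA_eq hd, sub_zero] at h1
  have h2 := phaseA_eq hd p x ξ
  have hW : phaseW n ν (0 : E d) (x, ξ) = sgw n ν (x, ξ) := by simp [phaseW]
  rw [hW] at h1
  have h3 : ‖p‖ ≤ ‖gradX φ x ξ‖ + ‖gradX φ x ξ - p‖ := by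
    have := norm_sub_le (gradX φ x ξ) (gradX φ x ξ - p)
    rwa [sub_sub_cancel] at this
  have hbx := bracket_pos x
  have h4 : phaseW n ν p (x, ξ) ≤
      sgw n ν (x, ξ) + bracket x * ‖gradX φ x ξ‖ + bracket x * ‖gradX φ x ξ - p‖ := by
    rw [phaseW, add_assoc, ← mul_add]
    gcongr
  have h5 : phaseW n ν p (x, ξ) ^ 2 ≤
      (sgw n ν (x, ξ) + bracket x * ‖gradX φ x ξ‖ + bracket x * ‖gradX φ x ξ - p‖) ^ 2 :=
    pow_le_pow_left₀ (phaseW_pos n ν p _).le h4 2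
  have h6 : 0 ≤ bracket ξ ^ 2 * ‖gradXi φ x ξ‖ ^ 2 := by positivity
  generalize phaseW n ν p (x, ξ) = W at *
  generalize sgw n ν (x, ξ) = w at *
  rw [← mul_pow] at h1 h2
  generalize bracket x * ‖gradX φ x ξ‖ = a at *
  generalize bracket x * ‖gradX φ x ξ - p‖ = b at *
  generalize bracket ξ ^ 2 * ‖gradXi φ x ξ‖ ^ 2 = g at *
  rw [h2]
  nlinarith [sq_nonneg (w - a), sq_nonneg (a - b), sq_nonneg (w - b), mul_nonneg hC h6,
    mul_nonneg hC (sq_nonneg b), sq_nonneg w]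

/-- Over bounded regions of `ℝ^d × ℝ^s`, only large frequencies `p` are elliptic, so that a constant
has to be added. -/
theorem exists_elliptic_of_norm_le (hφ : Sym (fun _ : Unit => sgw n ν) (fun _ => φ)) (R : ℝ) :
    ∃ c : ℝ, 0 < c ∧ ∀ (p : E d) z, ‖z‖ ≤ R → c * phaseW n ν p z ^ 2 ≤ phaseA φ p z + 1 := by
  obtain ⟨K, hK, hW⟩ := exists_phaseW_sq_le hφ
  have hcont : Continuous (fun z : E d × E s => sgw n ν z ^ 2) :=
    ((sym_sgw (ι := Unit) n ν).smooth ()).continuous.pow 2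
  obtain ⟨B, hB⟩ := (isCompact_closedBall (0 : E d × E s) R).exists_bound_of_continuousOn
    hcont.continuousOn
  refine ⟨(K * (1 + |B|))⁻¹, by positivity, fun p z hz => ?_⟩
  rw [inv_mul_le_iff₀ (by positivity)]
  have h1 := (hB z (by simpa using hz)).trans (le_abs_self B)
  rw [Real.norm_of_nonneg (sq_nonneg _)] at h1
  have h2 := phaseA_nonneg (φ := φ) p z
  calc phaseW n ν p z ^ 2 ≤ K * (sgw n ν z ^ 2 + phaseA φ p z) := hW p z
    _ ≤ K * (|B| + phaseA φ p z) := by gcongr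
    _ ≤ _ := by
      rw [mul_assoc]
      gcongr
      nlinarith [abs_nonneg B]

theorem exists_le_two_pow (R : ℝ) : ∃ k : ℕ, R ≤ 2 ^ k :=
  (tendsto_pow_atTop_atTop_of_one_lt (one_lt_two (α := ℝ))).eventually_ge_atTop R |>.exists

/-- Ellipticity for large `(x, ξ)` yields uniform ellipticity up to a compactly supported error. -/
theorem PhaseElliptic.of_large (hn : 0 < n) (hν : 0 < ν)
    (hφ : Sym (fun _ : Unit => sgw n ν) (fun _ => φ))
    (hh : Sym (fun (_ : Unit) _ => (1 : ℝ)) (fun _ => h)) (hh0 : ∀ z, 0 ≤ h z)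
    (hell : ∃ R c : ℝ, 0 < c ∧ ∀ p ∈ P, ∀ z, R ≤ ‖z‖ →
      c * phaseW n ν p z ^ 2 ≤ phaseA φ p z + h z * phaseW n ν p z ^ 2) :
    ∃ k : ℕ, PhaseElliptic n ν φ h (cut k) P := by
  obtain ⟨R, c, hc, hell⟩ := hell
  obtain ⟨k, hk⟩ := exists_le_two_pow R
  obtain ⟨c', hc', h'⟩ := exists_elliptic_of_norm_le hφ R
  refine ⟨k, hn, hν, hφ, hh, sym_cut.reindex (fun _ => k), min c c', lt_min hc hc',
    fun p hp z => ?_⟩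
  rcases le_total R ‖z‖ with hz | hz
  · calc min c c' * phaseW n ν p z ^ 2 ≤ c * phaseW n ν p z ^ 2 := by
          gcongr; exact min_le_left _ _
      _ ≤ _ := (hell p hp z hz).trans (le_add_of_nonneg_right (cut_nonneg k z))
  · rw [cut_eq_one (hz.trans hk)]
    calc min c c' * phaseW n ν p z ^ 2 ≤ c' * phaseW n ν p z ^ 2 := by
          gcongr; exact min_le_right _ _
      _ ≤ _ := h' p z hz
      _ ≤ _ := by
        have := mul_nonneg (hh0 z) (sq_nonneg (phaseW n ν p z))
        linarith

/-- At frequency `p = 0`, admissibility is ellipticity on the whole space. -/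
theorem IsAdmissiblePhase.exists_phaseElliptic (hφ : IsAdmissiblePhase n ν φ) :
    ∃ k : ℕ, PhaseElliptic n ν φ 0 (cut k) {0} := by
  obtain ⟨R, -, C, hC, hell⟩ := hφ.nondegenerate
  refine PhaseElliptic.of_large hφ.n_pos hφ.nu_pos hφ.sym_phase
    (Sym.zero fun _ _ => zero_le_one) (fun _ => le_rfl) ⟨R, C, hC, ?_⟩
  rintro p rfl ⟨x, ξ⟩ hz
  have hd : Differentiable ℝ φ := (hφ.sym_phase.smooth ()).differentiable (by simp)
  have h1 : R ≤ ‖x‖ + ‖ξ‖ := hz.trans (by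
    rw [Prod.norm_def]
    exact max_le (le_add_of_nonneg_right (norm_nonneg _)) (le_add_of_nonneg_left (norm_nonneg _)))
  have h2 := hell x ξ h1
  have hW : phaseW n ν (0 : E d) (x, ξ) = sgw n ν (x, ξ) := by simp [phaseW]
  rw [phaseA_eq hd, hW, sgw_sq]
  simpa [sgw, phaseEta] using h2

/-! ### Regularized integrals -/

/-- The integral `∫∫ e^{i(φ(x,ξ) - x·p)} χ_k(x,ξ) b(x,ξ) dx dξ`, regularized by the cut-off `χ_k`. -/
def cutInt (φ : E d × E s → ℝ) (p : E d) (b : E d × E s → ℂ) (k : ℕ) : ℂ :=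
  ∫ z, osc φ p z * (cut k z * b z)

theorem continuous_osc (hφ : Continuous φ) (p : E d) : Continuous (osc φ p) := by
  unfold osc
  fun_prop

theorem integrable_osc_cut (hφ : Continuous φ) (p : E d) {b : E d × E s → ℂ} (hb : Continuous b)
    (k : ℕ) : Integrable (fun z => osc φ p z * (cut k z * b z)) := by
  refine ((continuous_osc hφ p).mul ((Complex.continuous_ofReal.comp
    (cut_contDiff k).continuous).mul hb)).integrable_of_hasCompactSupport ?_
  exact ((cut_hasCompactSupport k).comp_left Complex.ofReal_zero).mul_right.mul_left

theorem cutInt_add (hφ : Continuous φ) (p : E d) {a b : E d × E s → ℂ} (ha : Continuous a)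
    (hb : Continuous b) (k : ℕ) :
    cutInt φ p (fun z => a z + b z) k = cutInt φ p a k + cutInt φ p b k := by
  rw [cutInt, cutInt, cutInt, ← integral_add (integrable_osc_cut hφ p ha k)
    (integrable_osc_cut hφ p hb k)]
  congr 1
  funext z
  ring

theorem cutInt_const_mul (p : E d) (c : ℂ) (a : E d × E s → ℂ) (k : ℕ) :
    cutInt φ p (fun z => c * a z) k = c * cutInt φ p a k := by
  rw [cutInt, cutInt, ← integral_const_mul]
  congr 1
  funext z
  ring

theorem Sym.cut_mul {m μ : ℝ} {b : ι → E d × E s → ℂ} (hb : Sym (fun _ => sgw m μ) b) :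
    Sym (fun _ : ι × ℕ => sgw m μ) (fun i z => (cut i.2 z : ℂ) * b i.1 z) := by
  refine (((sym_cut.reindex (Prod.snd : ι × ℕ → ℕ)).ofReal).mul
    (hb.reindex (Prod.fst : ι × ℕ → ι))).mono' fun i z => by rw [one_mul]

theorem Sym.cut_sub_mul {m μ : ℝ} {b : ι → E d × E s → ℂ} (hb : Sym (fun _ => sgw m μ) b) :
    Sym (fun _ : ι × ℕ => sgw (m + 1) (μ + 1))
      (fun i z => (((2 : ℝ) ^ i.2 * (cut (i.2 + 1) z - cut i.2 z) : ℝ) : ℂ) * b i.1 z) := by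
  refine (((sym_cut_sub_cut.reindex (Prod.snd : ι × ℕ → ℕ)).ofReal).mul
    (hb.reindex (Prod.fst : ι × ℕ → ι))).mono' fun i z => ?_
  rw [sgw_mul, add_comm m, add_comm μ]

theorem hasCompactSupport_cut_sub_mul (k : ℕ) (b : E d × E s → ℂ) : HasCompactSupport
    (fun z => (((2 : ℝ) ^ k * (cut (k + 1) z - cut k z) : ℝ) : ℂ) * b z) := by
  have : HasCompactSupport
      (fun z : E d × E s => ((2 : ℝ) ^ k * (cut (k + 1) z - cut k z) : ℝ)) :=
    ((cut_hasCompactSupport (k + 1)).sub (cut_hasCompactSupport k)).mul_left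
  exact (this.comp_left Complex.ofReal_zero).mul_right

theorem hasCompactSupport_cut_mul (k : ℕ) (b : E d × E s → ℂ) : HasCompactSupport
    (fun z => (cut k z : ℂ) * b z) :=
  ((cut_hasCompactSupport k).comp_left Complex.ofReal_zero).mul_right

theorem cutInt_succ_sub (hφ : Continuous φ) (p : E d) {b : E d × E s → ℂ} (hb : Continuous b)
    (k : ℕ) : cutInt φ p b (k + 1) - cutInt φ p b k = ((2 : ℂ) ^ k)⁻¹ *
      ∫ z, osc φ p z * ((((2 : ℝ) ^ k * (cut (k + 1) z - cut k z) : ℝ) : ℂ) * b z) := by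
  rw [cutInt, cutInt, ← integral_sub (integrable_osc_cut hφ p hb _) (integrable_osc_cut hφ p hb _),
    ← integral_const_mul]
  congr 1
  funext z
  push_cast
  have : (2 : ℂ) ^ k ≠ 0 := pow_ne_zero _ two_ne_zero
  field_simp

namespace PhaseElliptic

variable (H : PhaseElliptic n ν φ h e P) {p : ι → E d} (hp : ∀ i, p i ∈ P) {m μ : ℝ}
  {b : ι → E d × E s → ℂ} (hb : Sym (fun _ => sgw m μ) b) (hhb : ∀ i z, h z ≠ 0 → b i z = 0)
include H hp hb hhb

theorem exists_cutInt_bound (M : ℕ) :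
    ∃ C : ℝ, 0 ≤ C ∧ ∀ i k, (1 + ‖p i‖) ^ M * ‖cutInt φ (p i) (b i) k‖ ≤ C := by
  obtain ⟨C, hC, hbd⟩ := H.exists_bound (p := fun i : ι × ℕ => p i.1) (fun i => hp i.1) hb.cut_mul
    (fun i => hasCompactSupport_cut_mul _ _) (fun i z hz => by rw [hhb _ z hz, mul_zero]) M
  exact ⟨C, hC, fun i k => hbd (i, k)⟩

theorem exists_cutInt_sub_bound :
    ∃ C : ℝ, 0 ≤ C ∧ ∀ i k, ‖cutInt φ (p i) (b i) (k + 1) - cutInt φ (p i) (b i) k‖ ≤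
      C * ((2 : ℝ) ^ k)⁻¹ := by
  obtain ⟨C, hC, hbd⟩ := H.exists_bound (p := fun i : ι × ℕ => p i.1) (fun i => hp i.1)
    hb.cut_sub_mul (fun i => hasCompactSupport_cut_sub_mul _ _)
    (fun i z hz => by rw [hhb _ z hz, mul_zero]) 0
  refine ⟨C, hC, fun i k => ?_⟩
  rw [cutInt_succ_sub (H.sym_phase.smooth ()).continuous _ (hb.smooth i).continuous, norm_mul,
    mul_comm, norm_inv, norm_pow, Complex.norm_ofNat]
  gcongr
  simpa using hbd (i, k)

theorem exists_tendsto_cutInt (i : ι) :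
    ∃ l : ℂ, Filter.Tendsto (cutInt φ (p i) (b i)) Filter.atTop (𝓝 l) := by
  obtain ⟨C, hC, hbd⟩ := H.exists_cutInt_sub_bound hp hb hhb
  refine cauchySeq_tendsto_of_complete (cauchySeq_of_le_geometric (1 / 2) C (by norm_num)
    fun k => ?_)
  rw [dist_comm, dist_eq_norm]
  simpa using hbd i k

end PhaseElliptic

/-! ### Existence and uniqueness of the oscillatory integral -/

theorem sym_mul_schwartz {m μ : ℝ} {a : ι → E d × E s → ℂ} (ha : Sym (fun _ => sgw m μ) a)
    {f : ι → 𝓢(E d, ℂ)} (hf : Bornology.IsVonNBounded ℂ (Set.range f)) :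
    Sym (fun _ => sgw m μ) (fun i z => a i z * f i z.1) :=
  (ha.mul (sym_schwartz hf 0)).mono' fun i z => by simp

theorem isVonNBounded_range_const (f : 𝓢(E d, ℂ)) :
    Bornology.IsVonNBounded ℂ (Set.range fun _ : ι => f) :=
  (Bornology.isVonNBounded_singleton f).subset (Set.range_const_subset)

theorem continuous_of_mem_SGInf (a : SGInf d s) : Continuous (a : E d × E s → ℂ) := by
  obtain ⟨m, μ, ha⟩ := a.2
  exact ha.1.continuous

theorem continuous_mul_schwartz (a : SGInf d s) (f : 𝓢(E d, ℂ)) :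
    Continuous (fun z => (a : E d × E s → ℂ) z * f z.1) :=
  (continuous_of_mem_SGInf a).mul (f.continuous.comp continuous_fst)

theorem IsAdmissiblePhase.exists_tendsto (hφ : IsAdmissiblePhase n ν φ) (a : SGInf d s)
    (f : 𝓢(E d, ℂ)) : ∃ l : ℂ, Filter.Tendsto
      (cutInt φ 0 (fun z => (a : E d × E s → ℂ) z * f z.1)) Filter.atTop (𝓝 l) := by
  obtain ⟨k, H⟩ := hφ.exists_phaseElliptic
  obtain ⟨m, μ, ha⟩ := a.2
  exact H.exists_tendsto_cutInt (p := fun _ : Unit => 0) (fun _ => rfl)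
    (sym_mul_schwartz (SG.sym ha) (isVonNBounded_range_const f)) (by simp) ()

/-- The value of the oscillatory integral `I_φ(a)` at the test function `f`, as the limit of the
regularized integrals. -/
def oscValue (φ : E d × E s → ℝ) (a : SGInf d s) (f : 𝓢(E d, ℂ)) : ℂ :=
  Filter.limUnder Filter.atTop (cutInt φ 0 (fun z => (a : E d × E s → ℂ) z * f z.1))

/-- The seminorms which define the topology of `SG^{m,μ}`. -/
theorem sg_withSeminorms (m μ : ℝ) :
    letI := sgTopology d s m μ
    WithSeminorms (sgSeminorm d s m μ) :=
  letI := sgTopology d s m μ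
  ⟨rfl⟩

/-- Bounded subsets of `SG^{m,μ}` are symbol families. -/
theorem sym_of_isVonNBounded {m μ : ℝ} {S : Set (SG d s m μ)}
    (hS : letI := sgTopology d s m μ; Bornology.IsVonNBounded ℂ S) :
    Sym (fun _ : S => sgw m μ) (fun a => (a : E d × E s → ℂ)) := by
  let := sgTopology d s m μ
  refine Sym.of_partialD (fun a => a.1.2.1) fun L => ?_
  obtain ⟨r, -, h⟩ := (sg_withSeminorms m μ).isVonNBounded_iff_seminorm_bounded.1 hS L
  refine ⟨r, fun a z => ?_⟩
  rw [← div_le_iff₀ (sgWeight_pos _ _ _ _)]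
  exact (le_ciSup (bddAbove_sg L a.1) z).trans (h a a.2).le

theorem mem_SG_of_hasCompactSupport {a : E d × E s → ℂ} (ha : ContDiff ℝ ∞ a)
    (hc : HasCompactSupport a) (m μ : ℝ) : a ∈ SG d s m μ := by
  refine ⟨ha, fun L => ?_⟩
  have h1 : ∀ L : List (Fin d ⊕ Fin s), HasCompactSupport (partialD L a) := by
    intro L
    induction L with
    | nil => exact hc
    | cons j L ih => exact ih.fderiv_apply ℝ _
  have h2 : Continuous fun z : E d × E s => ((sgWeight m μ L z)⁻¹ : ℝ) := by
    have := ((sym_sgw (ι := Unit) (d := d) (s := s) (m - xOrder L) (μ - xiOrder L)).smooth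
      ()).continuous
    exact this.inv₀ fun z => (sgw_pos _ _ z).ne'
  obtain ⟨C, hC⟩ := ((h1 L).smul_left (f := fun z => (sgWeight m μ L z)⁻¹)).exists_bound_of_continuous
    (h2.smul (contDiff_partialD ha L).continuous)
  refine ⟨C, fun z => ?_⟩
  have h3 := sgWeight_pos m μ L z
  have h4 := hC z
  rw [Pi.smul_apply', norm_smul, Real.norm_of_nonneg (inv_pos.2 h3).le] at h4
  rwa [← div_le_iff₀ h3, div_eq_inv_mul]

/-- Every symbol is approximated, in a slightly larger space, by its truncations: the errors are
`2^{-k}` times a bounded sequence. -/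
theorem tendsto_cut_mul {m μ : ℝ} {a : E d × E s → ℂ} (ha : a ∈ SG d s m μ)
    (ha' : a ∈ SG d s (m + 1) (μ + 1))
    (hk : ∀ k, (fun z => (cut k z : ℂ) * a z) ∈ SG d s (m + 1) (μ + 1)) :
    letI := sgTopology d s (m + 1) (μ + 1)
    Filter.Tendsto (fun k => (⟨_, hk k⟩ : SG d s (m + 1) (μ + 1))) Filter.atTop (𝓝 ⟨a, ha'⟩) := by
  let := sgTopology d s (m + 1) (μ + 1)
  rw [(sg_withSeminorms (m + 1) (μ + 1)).tendsto_nhds]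
  intro L ε hε
  have hg : Sym (fun _ : ℕ => sgw (m + 1) (μ + 1))
      (fun k z => (((2 : ℝ) ^ k * (1 - cut k z) : ℝ) : ℂ) * a z) := by
    refine (sym_one_sub_cut.ofReal.mul (SG.sym (ι := ℕ) ha)).mono' fun i z => ?_
    rw [sgw_mul, add_comm m, add_comm μ]
  obtain ⟨C, hC, hbd⟩ := hg.partialD_bound L
  have hlim : Filter.Tendsto (fun k : ℕ => ((1 : ℝ) / 2) ^ k * C) Filter.atTop (𝓝 (0 * C)) :=
    (tendsto_pow_atTop_nhds_zero_of_lt_one (by norm_num) (by norm_num)).mul_const C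
  rw [zero_mul] at hlim
  filter_upwards [hlim.eventually_lt_const hε] with k hlt
  refine lt_of_le_of_lt ?_ hlt
  have heq : (⟨_, hk k⟩ : SG d s (m + 1) (μ + 1)) - ⟨a, ha'⟩ =
      (-((2 : ℂ) ^ k)⁻¹) • (⟨_, hg.mem_SG k⟩ : SG d s (m + 1) (μ + 1)) := by
    ext z
    have : (2 : ℂ) ^ k ≠ 0 := pow_ne_zero _ two_ne_zero
    simp only [AddSubgroupClass.coe_sub, Pi.sub_apply, Submodule.coe_smul, Pi.smul_apply,
      smul_eq_mul]
    push_cast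
    field_simp
    ring
  rw [heq, map_smul_eq_mul, norm_neg, norm_inv, norm_pow, Complex.norm_ofNat, one_div, inv_pow]
  gcongr
  refine ciSup_le fun z => ?_
  rw [div_le_iff₀ (sgWeight_pos _ _ _ _)]
  exact hbd k z

theorem osc_zero (φ : E d × E s → ℝ) (z : E d × E s) :
    osc φ 0 z = Complex.exp (Complex.I * φ z) := by simp [osc]

theorem integral_osc_eq_iterated {a : E d × E s → ℂ} {f : E d → ℂ}
    (hint : Integrable (fun z => osc φ 0 z * (a z * f z.1))) :
    ∫ z, osc φ 0 z * (a z * f z.1) =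
      ∫ x : E d, (∫ ξ : E s, Complex.exp (Complex.I * φ (x, ξ)) * a (x, ξ)) * f x := by
  have h1 := integral_prod (μ := (volume : Measure (E d))) (ν := (volume : Measure (E s))) _ hint
  refine h1.trans ?_
  congr 1
  funext x
  rw [← integral_mul_const]
  congr 1
  funext ξ
  rw [osc_zero, mul_assoc]

theorem tendsto_cutInt_of_integrable (hφ : Continuous φ) (p : E d) {b : E d × E s → ℂ}
    (hb : Continuous b) (hint : Integrable b) :
    Filter.Tendsto (cutInt φ p b) Filter.atTop (𝓝 (∫ z, osc φ p z * b z)) := by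
  refine tendsto_integral_of_dominated_convergence (fun z => ‖b z‖)
    (fun k => (integrable_osc_cut hφ p hb k).aestronglyMeasurable) hint.norm (fun k => ?_) ?_
  · refine Filter.Eventually.of_forall fun z => ?_
    rw [norm_mul, norm_mul, norm_osc, one_mul, Complex.norm_real,
      Real.norm_of_nonneg (cut_nonneg k z)]
    exact mul_le_of_le_one_left (norm_nonneg _) (cut_le_one k z)
  · refine Filter.Eventually.of_forall fun z => tendsto_const_nhds.congr' ?_
    filter_upwards [cut_eventually_eq_one z] with k hk
    simp [hk]

/-- Any oscillatory integral is the limit of the regularized integrals: these are its values at the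
truncations of the symbol, which have compact support. -/
theorem IsOscillatoryIntegral.tendsto (hφ : Continuous φ) {I : SGInf d s →ₗ[ℂ] 𝓢'(E d, ℂ)}
    (hI : IsOscillatoryIntegral φ I) (a : SGInf d s) (f : 𝓢(E d, ℂ)) : Filter.Tendsto
    (cutInt φ 0 (fun z => (a : E d × E s → ℂ) z * f z.1)) Filter.atTop (𝓝 (I a f)) := by
  obtain ⟨m, μ, ha⟩ := a.2
  have hk : ∀ k m μ, (fun z => (cut k z : ℂ) * (a : E d × E s → ℂ) z) ∈ SG d s m μ := fun k m μ =>
    mem_SG_of_hasCompactSupport ((Complex.ofRealCLM.contDiff.comp (cut_contDiff k)).mul ha.1)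
      (hasCompactSupport_cut_mul k _) m μ
  have ha' := SG_mono (by linarith : m ≤ m + 1) (by linarith : μ ≤ μ + 1) ha
  have h1 := tendsto_cut_mul ha ha' (fun k => hk k _ _)
  let := sgTopology d s (m + 1) (μ + 1)
  have h2 := ((hI.continuous_restrict (m + 1) (μ + 1)).tendsto _).comp h1
  have h3 := PointwiseConvergenceCLM.tendsto_iff_forall_tendsto.1 h2 f
  refine h3.congr fun k => ?_
  have h4 := hI.eq_integral ⟨_, SG_le_SGInf d s _ _ (hk k 0 0)⟩ (hk k) f
  refine h4.trans ?_
  rw [← integral_osc_eq_iterated, cutInt]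
  · simp only [mul_assoc]
  · simpa only [mul_assoc] using integrable_osc_cut hφ 0 (continuous_mul_schwartz a f) k

namespace IsAdmissiblePhase

variable (hφ : IsAdmissiblePhase n ν φ)
include hφ

theorem tendsto_oscValue (a : SGInf d s) (f : 𝓢(E d, ℂ)) : Filter.Tendsto
    (cutInt φ 0 (fun z => (a : E d × E s → ℂ) z * f z.1)) Filter.atTop (𝓝 (oscValue φ a f)) :=
  tendsto_nhds_limUnder (hφ.exists_tendsto a f)

theorem continuous_phase : Continuous φ := (hφ.sym_phase.smooth ()).continuous

theorem oscValue_add_left (a b : SGInf d s) (f : 𝓢(E d, ℂ)) :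
    oscValue φ (a + b) f = oscValue φ a f + oscValue φ b f := by
  refine tendsto_nhds_unique (hφ.tendsto_oscValue _ _)
    (((hφ.tendsto_oscValue a f).add (hφ.tendsto_oscValue b f)).congr fun k => ?_)
  rw [← cutInt_add hφ.continuous_phase _ (continuous_mul_schwartz a f)
    (continuous_mul_schwartz b f)]
  congr 1
  funext z
  simp [add_mul]

theorem oscValue_smul_left (c : ℂ) (a : SGInf d s) (f : 𝓢(E d, ℂ)) :
    oscValue φ (c • a) f = c * oscValue φ a f := by
  refine tendsto_nhds_unique (hφ.tendsto_oscValue _ _)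
    (((hφ.tendsto_oscValue a f).const_mul c).congr fun k => ?_)
  rw [← cutInt_const_mul]
  congr 1
  funext z
  simp [mul_assoc]

theorem oscValue_add_right (a : SGInf d s) (f g : 𝓢(E d, ℂ)) :
    oscValue φ a (f + g) = oscValue φ a f + oscValue φ a g := by
  refine tendsto_nhds_unique (hφ.tendsto_oscValue _ _)
    (((hφ.tendsto_oscValue a f).add (hφ.tendsto_oscValue a g)).congr fun k => ?_)
  rw [← cutInt_add hφ.continuous_phase _ (continuous_mul_schwartz a f)
    (continuous_mul_schwartz a g)]
  congr 1
  funext z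
  simp [mul_add]

theorem oscValue_smul_right (c : ℂ) (a : SGInf d s) (f : 𝓢(E d, ℂ)) :
    oscValue φ a (c • f) = c * oscValue φ a f := by
  refine tendsto_nhds_unique (hφ.tendsto_oscValue _ _)
    (((hφ.tendsto_oscValue a f).const_mul c).congr fun k => ?_)
  rw [← cutInt_const_mul]
  congr 1
  funext z
  simp only [smul_apply, smul_eq_mul]
  ring

/-- The values of the oscillatory integral are bounded on bounded families. -/
theorem exists_oscValue_bound {m μ : ℝ} {a : ι → SGInf d s}
    (ha : Sym (fun _ => sgw m μ) (fun i => (a i : E d × E s → ℂ))) {f : ι → 𝓢(E d, ℂ)}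
    (hf : Bornology.IsVonNBounded ℂ (Set.range f)) :
    ∃ C : ℝ, ∀ i, ‖oscValue φ (a i) (f i)‖ ≤ C := by
  obtain ⟨k, H⟩ := hφ.exists_phaseElliptic
  obtain ⟨C, -, hC⟩ := H.exists_cutInt_bound (p := fun _ : ι => 0) (fun _ => rfl)
    (sym_mul_schwartz ha hf) (by simp) 0
  refine ⟨C, fun i => le_of_tendsto (hφ.tendsto_oscValue (a i) (f i)).norm
    (Filter.Eventually.of_forall fun k => ?_)⟩
  simpa using hC i k

/-- The oscillatory integral, as a linear map from symbols to tempered distributions. Continuity in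
the test function holds because bounded linear maps on the Schwartz space are continuous. -/
def oscIntegral : SGInf d s →ₗ[ℂ] 𝓢'(E d, ℂ) where
  toFun a := ContinuousLinearMap.toPointwiseConvergenceCLM ℂ (RingHom.id ℂ) 𝓢(E d, ℂ) ℂ
    { toFun := oscValue φ a
      map_add' := hφ.oscValue_add_right a
      map_smul' := fun c f => hφ.oscValue_smul_right c a f
      cont := by
        let T : 𝓢(E d, ℂ) →ₗ[ℂ] ℂ :=
          { toFun := oscValue φ a
            map_add' := hφ.oscValue_add_right a
            map_smul' := fun c f => hφ.oscValue_smul_right c a f }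
        refine LinearMap.continuous_of_locally_bounded (𝕜 := ℂ) (𝕜' := ℂ) T fun S hS => ?_
        obtain ⟨m, μ, ha⟩ := a.2
        obtain ⟨C, hC⟩ := hφ.exists_oscValue_bound (ι := S) (a := fun _ => a) (SG.sym ha)
          (f := Subtype.val) (by rwa [Subtype.range_coe])
        refine NormedSpace.isVonNBounded_of_isBounded ℂ (isBounded_iff_forall_norm_le.2 ⟨C, ?_⟩)
        rintro _ ⟨f, hf, rfl⟩
        exact hC ⟨f, hf⟩ }
  map_add' a b := by
    ext f
    exact hφ.oscValue_add_left a b f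
  map_smul' c a := by
    ext f
    exact hφ.oscValue_smul_left c a f

theorem isOscillatoryIntegral_oscIntegral : IsOscillatoryIntegral φ hφ.oscIntegral where
  eq_integral a ha f := by
    have hint : Integrable (fun z => (a : E d × E s → ℂ) z * f z.1) := by
      obtain ⟨C, hC, hb⟩ := (sym_mul_schwartz (SG.sym (ι := Unit) (ha (-d - 1) (-s - 1)))
        (isVonNBounded_range_const f)).bound
      refine ((integrable_sgw (d := d) (s := s) (m := -d - 1) (μ := -s - 1) (by linarith)
        (by linarith)).const_mul C).mono' (continuous_mul_schwartz a f).aestronglyMeasurable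
        (Filter.Eventually.of_forall fun z => hb () z)
    have hint' : Integrable (fun z => osc φ 0 z * ((a : E d × E s → ℂ) z * f z.1)) :=
      hint.bdd_mul (c := 1) (continuous_osc hφ.continuous_phase 0).aestronglyMeasurable
        (Filter.Eventually.of_forall fun z => (norm_osc φ 0 z).le)
    rw [← integral_osc_eq_iterated hint']
    exact tendsto_nhds_unique (hφ.tendsto_oscValue a f) (tendsto_cutInt_of_integrable
      hφ.continuous_phase 0 (continuous_mul_schwartz a f) hint)
  continuous_restrict m μ := by
    let := sgTopology d s m μ
    have hp := sg_withSeminorms (d := d) (s := s) m μ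
    have := hp.topologicalAddGroup
    have := hp.continuousSMul
    have : FirstCountableTopology (SG d s m μ) := hp.firstCountableTopology
    refine PointwiseConvergenceCLM.continuous_of_continuous_eval fun f => ?_
    let T : SG d s m μ →ₗ[ℂ] ℂ :=
      { toFun := fun a => hφ.oscIntegral (Submodule.inclusion (SG_le_SGInf d s m μ) a) f
        map_add' := fun a b => by simp
        map_smul' := fun c a => by simp }
    refine LinearMap.continuous_of_locally_bounded (𝕜 := ℂ) (𝕜' := ℂ) T fun S hS => ?_
    obtain ⟨C, hC⟩ := hφ.exists_oscValue_bound (ι := S)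
      (a := fun a => Submodule.inclusion (SG_le_SGInf d s m μ) a.1) (sym_of_isVonNBounded hS)
      (isVonNBounded_range_const f)
    refine NormedSpace.isVonNBounded_of_isBounded ℂ (isBounded_iff_forall_norm_le.2 ⟨C, ?_⟩)
    rintro _ ⟨a, ha, rfl⟩
    exact hC ⟨a, ha⟩

theorem existsUnique_oscillatoryIntegral :
    ∃! I : SGInf d s →ₗ[ℂ] 𝓢'(E d, ℂ), IsOscillatoryIntegral φ I := by
  refine ⟨hφ.oscIntegral, hφ.isOscillatoryIntegral_oscIntegral, fun I hI => ?_⟩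
  ext a f
  exact tendsto_nhds_unique (hI.tendsto hφ.continuous_phase a f) (hφ.tendsto_oscValue a f)

end IsAdmissiblePhase

end

section

variable {d s : ℕ} {ι κ : Type*} {n ν : ℝ} {φ h e : E d × E s → ℝ} {P : Set (E d)}

/-! ### Ellipticity away from the set of stationary phase -/

theorem norm_toBall (x : E d) : ‖(toBall x : E d)‖ = (bracket x)⁻¹ * ‖x‖ := by
  simp [toBall, norm_smul, abs_of_pos (bracket_pos x)]

theorem norm_toBall_lt_one (x : E d) : ‖(toBall x : E d)‖ < 1 := by
  rw [norm_toBall, inv_mul_lt_iff₀ (bracket_pos x), mul_one, bracket]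
  exact Real.lt_sqrt_of_sq_lt (by linarith)

/-- Points of `ℝ^d` which stay away from the boundary of the ball form a bounded set. -/
theorem exists_norm_lt_of_norm_toBall_le {r : ℝ} (hr : r < 1) :
    ∃ R : ℝ, ∀ x : E d, ‖(toBall x : E d)‖ ≤ r → ‖x‖ < R := by
  rcases lt_or_ge r 0 with hr0 | hr0
  · exact ⟨0, fun x hx => absurd (hx.trans_lt hr0) (norm_nonneg _).not_gt⟩
  have h1 : 0 < 1 - r ^ 2 := by nlinarith
  refine ⟨(1 - r ^ 2)⁻¹ + 1, fun x hx => ?_⟩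
  rw [norm_toBall, inv_mul_le_iff₀ (bracket_pos x)] at hx
  have h2 : ‖x‖ ^ 2 ≤ (bracket x * r) ^ 2 := pow_le_pow_left₀ (norm_nonneg _) hx 2
  rw [mul_pow, bracket_sq] at h2
  have h3 : ‖x‖ ^ 2 * (1 - r ^ 2) ≤ 1 := by nlinarith
  have h4 : ‖x‖ ^ 2 ≤ (1 - r ^ 2)⁻¹ := by rwa [← le_div_iff₀ h1, one_div] at h3
  have h5 : 1 ≤ (1 - r ^ 2)⁻¹ := (one_le_inv₀ h1).2 (by nlinarith)
  nlinarith [norm_nonneg x]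

theorem isClosed_ballBoundary : IsClosed (ballBoundary d s) :=
  (isClosed_eq (by fun_prop) continuous_const).union (isClosed_eq (by fun_prop) continuous_const)

theorem isClosed_statM : IsClosed (statM n ν φ) := by
  refine isClosed_ballBoundary.inter (isOpen_compl_iff.1 ?_)
  refine isOpen_iff_forall_mem_open.2 fun w hw => ?_
  obtain ⟨U, hU, hwU, C, hC, h⟩ := not_not.1 hw
  exact ⟨U, fun v hv => not_not.2 ⟨U, hU, hv, C, hC, h⟩, hU, hwU⟩

/-- Ellipticity at all boundary points of a compact set is uniform near infinity. -/
theorem exists_elliptic_of_isCompact {m μ : ℝ} {b : E d × E s → ℝ}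
    {L : Set (Ball d × Ball s)} (hL : IsCompact L)
    (hell : ∀ w ∈ L, w ∈ ballBoundary d s → EllipticAt m μ b w) :
    ∃ R c : ℝ, 0 < c ∧ ∀ (x : E d) (ξ : E s), (toBall x, toBall ξ) ∈ L → R ≤ ‖(x, ξ)‖ →
      c * (bracket x ^ m * bracket ξ ^ μ) ≤ b (x, ξ) := by
  refine hL.induction_on (p := fun S => ∃ R c : ℝ, 0 < c ∧ ∀ (x : E d) (ξ : E s),
    (toBall x, toBall ξ) ∈ S → R ≤ ‖(x, ξ)‖ → c * (bracket x ^ m * bracket ξ ^ μ) ≤ b (x, ξ))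
    ?_ ?_ ?_ ?_
  · exact ⟨0, 1, one_pos, fun x ξ hx => absurd hx (Set.notMem_empty _)⟩
  · rintro S T hST ⟨R, c, hc, h⟩
    exact ⟨R, c, hc, fun x ξ hx => h x ξ (hST hx)⟩
  · rintro S T ⟨R, c, hc, h⟩ ⟨R', c', hc', h'⟩
    refine ⟨max R R', min c c', lt_min hc hc', fun x ξ hx hR => ?_⟩
    have hpos : 0 < bracket x ^ m * bracket ξ ^ μ := sgw_pos m μ (x, ξ)
    rcases hx with hx | hx
    · exact (mul_le_mul_of_nonneg_right (min_le_left _ _) hpos.le).trans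
        (h x ξ hx ((le_max_left _ _).trans hR))
    · exact (mul_le_mul_of_nonneg_right (min_le_right _ _) hpos.le).trans
        (h' x ξ hx ((le_max_right _ _).trans hR))
  · intro w hw
    by_cases hb : w ∈ ballBoundary d s
    · obtain ⟨U, hU, hwU, C, hC, h⟩ := hell w hw hb
      exact ⟨U, mem_nhdsWithin_of_mem_nhds (hU.mem_nhds hwU), 0, C, hC, fun x ξ hx _ => h x ξ hx⟩
    · have hlt : ‖(w.1 : E d)‖ < 1 ∧ ‖(w.2 : E s)‖ < 1 := by
        rw [ballBoundary, Set.mem_ofPred_eq, not_or] at hb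
        exact ⟨lt_of_le_of_ne (mem_closedBall_zero_iff.1 w.1.2) hb.1,
          lt_of_le_of_ne (mem_closedBall_zero_iff.1 w.2.2) hb.2⟩
      obtain ⟨r, hr, hr1⟩ := exists_between (max_lt hlt.1 hlt.2)
      obtain ⟨R, hR⟩ := exists_norm_lt_of_norm_toBall_le (d := d) hr1
      obtain ⟨R', hR'⟩ := exists_norm_lt_of_norm_toBall_le (d := s) hr1
      refine ⟨{v | ‖(v.1 : E d)‖ < r ∧ ‖(v.2 : E s)‖ < r}, mem_nhdsWithin_of_mem_nhds ?_,
        max R R', 1, one_pos, fun x ξ hx hxR => ?_⟩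
      · refine ((isOpen_lt (f := fun v : Ball d × Ball s => ‖(v.1 : E d)‖) (by fun_prop)
          continuous_const).inter (isOpen_lt (f := fun v : Ball d × Ball s => ‖(v.2 : E s)‖)
          (by fun_prop) continuous_const)).mem_nhds ?_
        exact ⟨(le_max_left _ _).trans_lt hr, (le_max_right _ _).trans_lt hr⟩
      · exact absurd hxR (not_le.2 (max_lt_max (hR x hx.1.le) (hR' ξ hx.2.le)))

/-- Near a boundary point outside of the set of stationary phase, the full gradient of the phase
`φ(x,ξ) - x·p` is elliptic for large `(x, ξ)`. Over a neighbourhood of `M_φ` this is the estimate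
which defines the set of stationary phase. Elsewhere `∇_ξ φ` is elliptic, so that a large `p` would
have to be compensated by `∇_x φ`, which is of order `⟨x⟩^(n-1) ⟨ξ⟩^ν` only. -/
theorem IsAdmissiblePhase.exists_elliptic_nhds (hφ : IsAdmissiblePhase n ν φ)
    {w : Ball d × Ball d} (hw : w ∈ ballBoundary d d) (hSP : w ∉ statSP n ν φ) :
    ∃ A ∈ 𝓝 w.1, ∃ B ∈ 𝓝 w.2, ∃ R c : ℝ, 0 < c ∧ ∀ (x : E d) (ξ : E s) (p : E d),
      toBall x ∈ A → toBall p ∈ B → R ≤ ‖(x, ξ)‖ →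
      c * phaseW n ν p (x, ξ) ^ 2 ≤ phaseA φ p (x, ξ) := by
  obtain ⟨U, V, hU, hwU, hV, hUV, C, hC, hest⟩ := not_not.1 fun hn => hSP ⟨hw, hn⟩
  have hd : Differentiable ℝ φ := (hφ.sym_phase.smooth ()).differentiable (by simp)
  obtain ⟨A₀, hA₀, B₀, hB₀, hAB⟩ := mem_nhds_prod_iff.1 (hU.mem_nhds hwU)
  obtain ⟨A, hA, hAc, hAA⟩ := exists_mem_nhds_isClosed_subset hA₀
  obtain ⟨B, hB, hBc, hBB⟩ := exists_mem_nhds_isClosed_subset hB₀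
  have hAuc : IsClosed (A ×ˢ (Set.univ : Set (Ball s))) := hAc.prod isClosed_univ
  have hK : IsCompact (statM n ν φ ∩ A ×ˢ (Set.univ : Set (Ball s))) :=
    (isClosed_statM.inter hAuc).isCompact
  -- `N` is a neighbourhood of the part of `M_φ` over `A` on which the estimate outside of `SP_φ` holds
  obtain ⟨N, B', hN, -, hKN, hBB', hNV⟩ := generalized_tube_lemma hK hBc.isCompact hV (by
    rintro ⟨⟨y, θ⟩, q⟩ ⟨⟨hM, hy, -⟩, hq⟩
    exact hUV y θ q hM (hAB ⟨hAA hy, hBB hq⟩))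
  obtain ⟨R, c, hc, hell⟩ := exists_elliptic_of_isCompact (m := 2 * n) (μ := 2 * ν - 2)
    (b := fun z => ‖gradXi φ z.1 z.2‖ ^ 2) ((hAuc.inter hN.isClosed_compl).isCompact) (by
      rintro v ⟨hvA, hvN⟩ hvb
      by_contra hv
      exact hvN (hKN ⟨⟨hvb, hv⟩, hvA⟩))
  obtain ⟨K, hK0, hKW⟩ := exists_phaseW_sq_le hφ.sym_phase
  refine ⟨A, hA, B, hB, R, min (C ^ 2) (K * (c⁻¹ + 1))⁻¹, by positivity,
    fun x ξ p hx hp hR => ?_⟩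
  have hbx := bracket_pos x
  have hbξ := bracket_pos ξ
  by_cases hxN : (toBall x, toBall ξ) ∈ N
  · have h1 := hest x ξ p (hNV ⟨hxN, hBB' hp⟩)
    have h2 : C * phaseW n ν p (x, ξ) ≤ bracket x * ‖gradX φ x ξ - p‖ := by
      have : phaseW n ν p (x, ξ) =
          bracket x * (bracket x ^ (n - 1) * bracket ξ ^ ν + ‖p‖) := by
        simp only [phaseW, sgw, Real.rpow_sub_one hbx.ne']
        field_simp
      rw [this]
      calc C * (bracket x * (bracket x ^ (n - 1) * bracket ξ ^ ν + ‖p‖))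
          = bracket x * (C * (bracket x ^ (n - 1) * bracket ξ ^ ν + ‖p‖)) := by ring
        _ ≤ _ := by gcongr
    have h3 := pow_le_pow_left₀ (mul_pos hC (phaseW_pos n ν p (x, ξ))).le h2 2
    rw [phaseA_eq hd]
    calc min (C ^ 2) (K * (c⁻¹ + 1))⁻¹ * phaseW n ν p (x, ξ) ^ 2
        ≤ C ^ 2 * phaseW n ν p (x, ξ) ^ 2 := by gcongr; exact min_le_left _ _
      _ ≤ bracket x ^ 2 * ‖gradX φ x ξ - p‖ ^ 2 := by rwa [← mul_pow, ← mul_pow]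
      _ ≤ _ := le_add_of_nonneg_right (by positivity)
  · have h1 := hell x ξ ⟨⟨hx, trivial⟩, hxN⟩ hR
    have h2 : c * sgw n ν (x, ξ) ^ 2 ≤ phaseA φ p (x, ξ) := by
      have : sgw n ν (x, ξ) ^ 2 =
          bracket ξ ^ 2 * (bracket x ^ (2 * n) * bracket ξ ^ (2 * ν - 2)) := by
        rw [sgw_sq]
        simp only [sgw, Real.rpow_sub hbξ]
        norm_num
        field_simp
      rw [this, phaseA_eq hd]
      calc c * (bracket ξ ^ 2 * (bracket x ^ (2 * n) * bracket ξ ^ (2 * ν - 2)))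
          = bracket ξ ^ 2 * (c * (bracket x ^ (2 * n) * bracket ξ ^ (2 * ν - 2))) := by ring
        _ ≤ bracket ξ ^ 2 * ‖gradXi φ x ξ‖ ^ 2 := by gcongr
        _ ≤ _ := le_add_of_nonneg_left (by positivity)
    have h3 : phaseW n ν p (x, ξ) ^ 2 ≤ K * (c⁻¹ + 1) * phaseA φ p (x, ξ) := by
      refine (hKW p (x, ξ)).trans ?_
      rw [mul_assoc]
      gcongr
      rw [add_mul, one_mul]
      gcongr
      rwa [← div_eq_inv_mul, le_div_iff₀ hc, mul_comm]
    calc min (C ^ 2) (K * (c⁻¹ + 1))⁻¹ * phaseW n ν p (x, ξ) ^ 2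
        ≤ (K * (c⁻¹ + 1))⁻¹ * phaseW n ν p (x, ξ) ^ 2 := by gcongr; exact min_le_right _ _
      _ ≤ _ := by rwa [inv_mul_le_iff₀ (by positivity)]

/-- Near a boundary point outside of the set of stationary phase, the phase is elliptic in the sense
of `PhaseElliptic`, where `h` is `1` minus a bump function of `toBall x`. -/
theorem IsAdmissiblePhase.exists_phaseElliptic_nhds (hφ : IsAdmissiblePhase n ν φ)
    {w : Ball d × Ball d} (hw : w ∈ ballBoundary d d) (hSP : w ∉ statSP n ν φ) :
    ∃ A ∈ 𝓝 w.1, ∃ B ∈ 𝓝 w.2, ∃ (h e : E d × E s → ℝ),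
      PhaseElliptic n ν φ h e {p | toBall p ∈ B} ∧ ∀ z, toBall z.1 ∈ A → h z = 0 := by
  obtain ⟨A, hA, B, hB, R, c, hc, hell⟩ := hφ.exists_elliptic_nhds hw hSP
  obtain ⟨ε, hε, hεA⟩ := Metric.mem_nhds_iff.1 hA
  let f : ContDiffBump (w.1 : E d) := ⟨ε / 2, ε, by positivity, by linarith⟩
  have hf : ContDiff ℝ ∞ (fun y : E d => 1 - f y) := contDiff_const.sub f.contDiff
  obtain ⟨k, H⟩ := PhaseElliptic.of_large (P := {p | toBall p ∈ B})
    (h := fun z => 1 - f (toBall z.1)) hφ.n_pos hφ.nu_pos hφ.sym_phase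
    (sym_comp_toBall hf) (fun z => sub_nonneg.2 f.le_one) (by
      refine ⟨R, min c 1, lt_min hc one_pos, ?_⟩
      rintro p hp ⟨x, ξ⟩ hz
      have h0 := phaseA_nonneg (φ := φ) p (x, ξ)
      have h1 : 0 ≤ 1 - f (toBall x) := sub_nonneg.2 f.le_one
      by_cases hx : toBall x ∈ A
      · calc min c 1 * phaseW n ν p (x, ξ) ^ 2 ≤ c * phaseW n ν p (x, ξ) ^ 2 := by
              gcongr; exact min_le_left _ _
          _ ≤ _ := (hell x ξ p hx hp hz).trans (le_add_of_nonneg_right (by positivity))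
      · have h2 : f (toBall x) = 0 := f.zero_of_le_dist (by
          by_contra hlt
          exact hx (hεA (by simpa [Subtype.dist_eq] using hlt)))
        calc min c 1 * phaseW n ν p (x, ξ) ^ 2 ≤ 1 * phaseW n ν p (x, ξ) ^ 2 := by
              gcongr; exact min_le_right _ _
          _ ≤ _ := by simpa [h2] using h0)
  refine ⟨Metric.ball w.1 (ε / 2), Metric.ball_mem_nhds _ (by positivity), B, hB, _, _, H,
    fun z hz => ?_⟩
  have : f (toBall z.1) = 1 := f.one_of_mem_closedBall (by
    have := (Metric.mem_ball.1 hz).le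
    simpa [Subtype.dist_eq] using this)
  simp [this]

end

section

variable {d s : ℕ} {ι κ : Type*} {n ν : ℝ} {φ h e : E d × E s → ℝ} {P : Set (E d)}

/-! ### Oscillatory integrals as functions of the frequency -/

/-- The oscillatory integral `∫ e^{i(φ(z) - x·p)} b(z) dz` as a function of the frequency `p`: the
partial Fourier transform of `e^{iφ} b`. -/
def freqInt (φ : E d × E s → ℝ) (b : E d × E s → ℂ) (p : E d) : ℂ := ∫ z, osc φ p z * b z

/-- The pairing `(z, p) ↦ (2π)⁻¹ x·p` which makes `freqInt` an instance of Mathlib's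
`VectorFourier.fourierIntegral`. -/
def freqPairing (d s : ℕ) : (E d × E s) →L[ℝ] E d →L[ℝ] ℝ :=
  (2 * Real.pi)⁻¹ • (innerSL ℝ ∘L ContinuousLinearMap.fst ℝ (E d) (E s))

theorem freqPairing_apply (z : E d × E s) (p : E d) :
    freqPairing d s z p = (2 * Real.pi)⁻¹ * inner ℝ z.1 p := rfl

theorem fourierChar_freqPairing (z : E d × E s) (p : E d) :
    (Real.fourierChar (-freqPairing d s z p) : ℂ) =
      Complex.exp (-(Complex.I * (inner ℝ z.1 p : ℝ))) := by
  rw [Real.fourierChar_apply, freqPairing_apply]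
  congr 1
  have : (Real.pi : ℂ) ≠ 0 := by exact_mod_cast Real.pi_ne_zero
  push_cast
  field_simp

theorem osc_eq_mul (φ : E d × E s → ℝ) (p : E d) (z : E d × E s) :
    osc φ p z = Complex.exp (-(Complex.I * (inner ℝ z.1 p : ℝ))) * osc φ 0 z := by
  rw [osc, osc, ← Complex.exp_add]
  congr 1
  simp
  ring

theorem freqInt_eq (φ : E d × E s → ℝ) (b : E d × E s → ℂ) :
    freqInt φ b = VectorFourier.fourierIntegral Real.fourierChar volume
      (freqPairing d s).toLinearMap₁₂ (fun z => osc φ 0 z * b z) := by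
  funext p
  refine integral_congr_ae (Filter.Eventually.of_forall fun z => ?_)
  change osc φ p z * b z = Real.fourierChar (-freqPairing d s z p) • (osc φ 0 z * b z)
  rw [Circle.smul_def, smul_eq_mul, fourierChar_freqPairing, ← mul_assoc, ← osc_eq_mul]

theorem integrable_pow_mul_osc (hφ : Continuous φ) {b : E d × E s → ℂ} (hb : Continuous b)
    (hc : HasCompactSupport b) (k : ℕ) :
    Integrable (fun z => ‖z‖ ^ k * ‖osc φ 0 z * b z‖) := by
  refine Continuous.integrable_of_hasCompactSupport ?_ ?_
  · have := continuous_osc hφ (0 : E d)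
    fun_prop
  · exact (HasCompactSupport.mul_left (f := osc φ 0) hc).norm.mul_left

theorem contDiff_freqInt (hφ : Continuous φ) {b : E d × E s → ℂ} (hb : Continuous b)
    (hc : HasCompactSupport b) : ContDiff ℝ ∞ (freqInt φ b) := by
  rw [freqInt_eq]
  exact VectorFourier.contDiff_fourierIntegral (N := ⊤) _ fun k _ =>
    integrable_pow_mul_osc hφ hb hc k

/-- Differentiation in the frequency multiplies the amplitude by a coordinate. -/
theorem fderiv_freqInt (hφ : Continuous φ) {b : E d × E s → ℂ} (hb : Continuous b)
    (hc : HasCompactSupport b) (j : Fin d) (p : E d) :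
    fderiv ℝ (freqInt φ b) p (EuclideanSpace.single j 1) =
      freqInt φ (fun z => -Complex.I * ((z.1 j : ℝ) * b z)) p := by
  have h0 : Integrable (fun z => osc φ 0 z * b z) :=
    Continuous.integrable_of_hasCompactSupport ((continuous_osc hφ 0).mul hb) hc.mul_left
  have h1 : Integrable (fun z => ‖z‖ * ‖osc φ 0 z * b z‖) := by
    simpa using integrable_pow_mul_osc hφ hb hc 1
  have h2 : Continuous (VectorFourier.fourierSMulRight (freqPairing d s)
      (fun z => osc φ 0 z * b z)) := by
    have := continuous_osc hφ (0 : E d)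
    unfold VectorFourier.fourierSMulRight
    have aux : Continuous fun p : (E d →L[ℝ] ℝ) × ℂ => p.1.smulRight p.2 :=
      (ContinuousLinearMap.smulRightL ℝ (E d) ℂ).continuous₂
    have h := aux.comp ((freqPairing d s).continuous.prodMk (this.mul hb))
    exact (continuous_const (y := -(2 * Real.pi * Complex.I : ℂ))).smul h
  have h3 : Integrable (fun z => Real.fourierChar (-(freqPairing d s).toLinearMap₁₂ z p) •
      VectorFourier.fourierSMulRight (freqPairing d s) (fun z => osc φ 0 z * b z) z) := by
    refine (VectorFourier.fourierIntegral_convergent_iff Real.continuous_fourierChar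
      (by apply (freqPairing d s).continuous₂ :
        Continuous (fun q : (E d × E s) × E d => (freqPairing d s).toLinearMap₁₂ q.1 q.2)) p).2 ?_
    refine h2.integrable_of_hasCompactSupport (hc.mono fun z hz => ?_)
    contrapose! hz
    simp only [Function.mem_support, not_not] at hz ⊢
    ext
    simp [hz]
  rw [freqInt_eq, freqInt_eq,
    VectorFourier.fderiv_fourierIntegral (freqPairing d s) h0 h1, VectorFourier.fourierIntegral,
    VectorFourier.fourierIntegral, ContinuousLinearMap.integral_apply h3]
  refine integral_congr_ae (Filter.Eventually.of_forall fun z => ?_)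
  simp only [Circle.smul_def, smul_apply,
    VectorFourier.fourierSMulRight_apply,
    freqPairing_apply, EuclideanSpace.inner_single_right, smul_eq_mul, Complex.real_smul]
  have : (Real.pi : ℂ) ≠ 0 := by exact_mod_cast Real.pi_ne_zero
  push_cast
  simp
  field_simp

/-- Fubini's theorem for `freqInt`: the Fourier transform can be moved to the test function. -/
theorem integral_freqInt_mul (hφ : Continuous φ) {b : E d × E s → ℂ} (hb : Continuous b)
    (hc : HasCompactSupport b) (g : 𝓢(E d, ℂ)) :
    ∫ p, freqInt φ b p * g p = ∫ z, osc φ 0 z * (b z * fourierS d g z.1) := by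
  have h0 : Integrable (fun z => osc φ 0 z * b z) :=
    Continuous.integrable_of_hasCompactSupport ((continuous_osc hφ 0).mul hb) hc.mul_left
  have := VectorFourier.integral_fourierIntegral_smul_eq_flip (L := (freqPairing d s).toLinearMap₁₂)
    Real.continuous_fourierChar (by apply (freqPairing d s).continuous₂) h0 (g.integrable (μ := volume))
  rw [← freqInt_eq] at this
  simp only [smul_eq_mul] at this
  rw [this]
  refine integral_congr_ae (Filter.Eventually.of_forall fun z => ?_)
  simp only [mul_assoc]
  congr 2
  rw [fourierS_apply]
  refine integral_congr_ae (Filter.Eventually.of_forall fun p => ?_)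
  change Real.fourierChar (-freqPairing d s z p) • g p = _
  rw [Circle.smul_def, smul_eq_mul, fourierChar_freqPairing, real_inner_comm]

/-- Iterated derivatives are controlled by those of the partial derivatives. -/
theorem norm_iteratedFDeriv_succ_le_sum {Y : E d → ℂ} (hY : ContDiff ℝ ∞ Y) (k : ℕ) (p : E d) :
    ‖iteratedFDeriv ℝ (k + 1) Y p‖ ≤
      ∑ j, ‖iteratedFDeriv ℝ k (fun q => fderiv ℝ Y q (EuclideanSpace.single j 1)) p‖ := by
  have hd : ContDiff ℝ ∞ (fderiv ℝ Y) := hY.fderiv_right (by simp)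
  have h1 : fderiv ℝ Y = fun q => ∑ j, ContinuousLinearMap.smulRightL ℝ (E d) ℂ
      (EuclideanSpace.proj j) (fderiv ℝ Y q (EuclideanSpace.single j 1)) := by
    funext q
    ext v
    have : v = ∑ j, v j • (EuclideanSpace.single j (1 : ℝ) : E d) := by
      simpa using ((EuclideanSpace.basisFun (Fin d) ℝ).sum_repr v).symm
    conv_lhs => rw [this]
    simp
  have hj (j : Fin d) : ContDiff ℝ ∞ fun q => fderiv ℝ Y q (EuclideanSpace.single j 1) :=
    hd.clm_apply contDiff_const
  rw [← norm_iteratedFDeriv_fderiv, congrArg (iteratedFDeriv ℝ k) h1,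
    iteratedFDeriv_fun_sum_apply (f := fun j q => ContinuousLinearMap.smulRightL ℝ (E d) ℂ
      (EuclideanSpace.proj j) (fderiv ℝ Y q (EuclideanSpace.single j 1)))
      fun j _ => (((ContinuousLinearMap.contDiff _).comp (hj j)).of_le
        (by exact_mod_cast le_top)).contDiffAt]
  refine (norm_sum_le _ _).trans (Finset.sum_le_sum fun j _ => ?_)
  refine ((ContinuousLinearMap.smulRightL ℝ (E d) ℂ
    (EuclideanSpace.proj j)).norm_iteratedFDeriv_comp_left ((hj j).contDiffAt)
    (by exact_mod_cast le_top)).trans ?_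
  refine mul_le_of_le_one_left (norm_nonneg _) ?_
  refine ContinuousLinearMap.opNorm_le_bound _ zero_le_one fun c => ?_
  rw [one_mul]
  refine ContinuousLinearMap.opNorm_le_bound _ (norm_nonneg _) fun v => ?_
  change ‖v j • c‖ ≤ _
  rw [norm_smul, mul_comm]
  gcongr
  exact PiLp.norm_apply_le v j

/-- All `p`-derivatives of the oscillatory integrals decrease rapidly in the region `P` of ellipticity,
since they are oscillatory integrals with amplitudes of larger order. -/
theorem PhaseElliptic.exists_iteratedFDeriv_freqInt_bound (H : PhaseElliptic n ν φ h e P) (k : ℕ) :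
    ∀ {m μ : ℝ} {b : ι → E d × E s → ℂ}, Sym (fun _ => sgw m μ) b →
    (∀ i, HasCompactSupport (b i)) → (∀ i z, h z ≠ 0 → b i z = 0) → ∀ M : ℕ,
    ∃ C : ℝ, 0 ≤ C ∧ ∀ i, ∀ p ∈ P, (1 + ‖p‖) ^ M * ‖iteratedFDeriv ℝ k (freqInt φ (b i)) p‖ ≤ C := by
  have hφ : Continuous φ := (H.sym_phase.smooth ()).continuous
  induction k with
  | zero =>
    intro m μ b hb hc hhb M
    obtain ⟨C, hC, hbd⟩ := H.exists_bound (ι := ι × P) (p := fun i => i.2) (fun i => i.2.2)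
      (hb.reindex Prod.fst) (fun i => hc i.1) (fun i => hhb i.1) M
    refine ⟨C, hC, fun i p hp => ?_⟩
    rw [norm_iteratedFDeriv_zero]
    exact hbd (i, ⟨p, hp⟩)
  | succ k ih =>
    intro m μ b hb hc hhb M
    have hb' (j : Fin d) : Sym (fun _ => sgw (m + 1) μ)
        (fun i z => -Complex.I * (((z.1 j : ℝ) : ℂ) * b i z)) := by
      have h1 := ((sym_coord (ι := ι) (d := d) (s := s) (Sum.inl j)).ofReal.mul hb).clm
        ((ContinuousLinearMap.mul ℝ ℂ) (-Complex.I))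
      refine h1.mono' fun i z => ?_
      rw [add_comm m, ← zero_add μ, ← sgw_mul]
      simp [sgw, br]
    have key (j : Fin d) := ih (hb' j) (fun i => (hc i).mul_left.mul_left)
      (fun i z hz => by simp [hhb i z hz]) M
    choose C hC hbd using key
    refine ⟨∑ j, C j, Finset.sum_nonneg fun j _ => hC j, fun i p hp => ?_⟩
    refine (mul_le_mul_of_nonneg_left (norm_iteratedFDeriv_succ_le_sum
      (contDiff_freqInt hφ (hb.smooth i).continuous (hc i)) k p) (by positivity)).trans ?_
    rw [Finset.mul_sum]
    refine Finset.sum_le_sum fun j _ => ?_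
    rw [funext (fderiv_freqInt hφ (hb.smooth i).continuous (hc i) j)]
    exact hbd j i p hp

end

section

variable {d s : ℕ} {ι κ : Type*} {n ν : ℝ} {φ h e : E d × E s → ℝ} {P : Set (E d)}

/-! ### Localization in frequency gives Schwartz functions -/

/-- A series of smooth functions which converges geometrically in all Schwartz seminorms has a
Schwartz function as its sum. -/
theorem exists_schwartz_hasSum {F : ℕ → E d → ℂ} (hF : ∀ k, ContDiff ℝ ∞ (F k))
    (hb : ∀ M N : ℕ, ∃ C : ℝ, ∀ k p,
      (1 + ‖p‖) ^ M * ‖iteratedFDeriv ℝ N (F k) p‖ ≤ C * (1 / 2) ^ k) :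
    ∃ G : 𝓢(E d, ℂ), ∀ p, HasSum (fun k => F k p) (G p) := by
  choose C hC using hb
  have hgeo (c : ℝ) : Summable fun k : ℕ => c * (1 / 2 : ℝ) ^ k :=
    (summable_geometric_of_lt_one (by norm_num) (by norm_num)).mul_left c
  have h0 (N k : ℕ) (p : E d) : ‖iteratedFDeriv ℝ N (F k) p‖ ≤ C 0 N * (1 / 2) ^ k := by
    simpa using hC 0 N k p
  have hsum (p : E d) : Summable fun k => F k p :=
    .of_norm_bounded (hgeo (C 0 0)) fun k => by simpa using h0 0 k p
  have hsmooth : ContDiff ℝ ∞ fun p => ∑' k, F k p :=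
    contDiff_tsum (N := ⊤) hF (fun N _ => hgeo (C 0 N)) fun N k p _ => h0 N k p
  refine ⟨⟨fun p => ∑' k, F k p, hsmooth, fun M N => ⟨∑' k : ℕ, C M N * (1 / 2 : ℝ) ^ k,
    fun p => ?_⟩⟩, fun p => (hsum p).hasSum⟩
  rw [iteratedFDeriv_tsum_apply (N := ⊤) hF (fun N _ => hgeo (C 0 N)) (fun N k p _ => h0 N k p)
    le_top]
  have h1 (k : ℕ) : ‖‖p‖ ^ M • iteratedFDeriv ℝ N (F k) p‖ ≤ C M N * (1 / 2 : ℝ) ^ k := by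
    rw [norm_smul, norm_pow, norm_norm]
    refine le_trans ?_ (hC M N k p)
    gcongr
    linarith
  rw [← norm_norm p, ← norm_pow, ← norm_smul, ← tsum_const_smul'']
  exact tsum_of_norm_bounded (hgeo _).hasSum h1

namespace PhaseElliptic

variable (H : PhaseElliptic n ν φ h e P) {m μ : ℝ} {ζ : E d → ℂ} (hζ : ζ.HasTemperateGrowth)
  (hζP : tsupport ζ ⊆ P)
include H hζ hζP

/-- Localized to the region `P` of frequencies on which the phase is elliptic, oscillatory integrals
are bounded in all Schwartz seminorms. -/
theorem exists_schwartz_bound {b : ι → E d × E s → ℂ} (hb : Sym (fun _ => sgw m μ) b)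
    (hc : ∀ i, HasCompactSupport (b i)) (hhb : ∀ i z, h z ≠ 0 → b i z = 0) (M N : ℕ) :
    ∃ C : ℝ, 0 ≤ C ∧ ∀ i p,
      (1 + ‖p‖) ^ M * ‖iteratedFDeriv ℝ N (fun p => ζ p * freqInt φ (b i) p) p‖ ≤ C := by
  have hφ : Continuous φ := (H.sym_phase.smooth ()).continuous
  obtain ⟨k, D, hD, hζD⟩ := hζ.norm_iteratedFDeriv_le_uniform N
  have key (j : ℕ) := H.exists_iteratedFDeriv_freqInt_bound j hb hc hhb (M + k)
  choose C hC hbd using key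
  refine ⟨∑ j ∈ Finset.range (N + 1), (N.choose j : ℝ) * (D * C (N - j)),
    Finset.sum_nonneg fun j _ => by have := hC (N - j); positivity, fun i p => ?_⟩
  by_cases hp : p ∈ tsupport ζ
  · refine (mul_le_mul_of_nonneg_left (norm_iteratedFDeriv_mul_le hζ.1
      (contDiff_freqInt hφ (hb.smooth i).continuous (hc i)) p
      (by exact_mod_cast le_top)) (by positivity)).trans ?_
    rw [Finset.mul_sum]
    refine Finset.sum_le_sum fun j hj => ?_
    have h1 := hζD j (Nat.lt_succ_iff.1 (Finset.mem_range.1 hj)) p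
    have h2 := hbd (N - j) i p (hζP hp)
    calc _ = (N.choose j : ℝ) * (‖iteratedFDeriv ℝ j ζ p‖ *
          ((1 + ‖p‖) ^ M * ‖iteratedFDeriv ℝ (N - j) (freqInt φ (b i)) p‖)) := by ring
      _ ≤ (N.choose j : ℝ) * ((D * (1 + ‖p‖) ^ k) *
          ((1 + ‖p‖) ^ M * ‖iteratedFDeriv ℝ (N - j) (freqInt φ (b i)) p‖)) := by gcongr
      _ = (N.choose j : ℝ) * (D * ((1 + ‖p‖) ^ (M + k) *
          ‖iteratedFDeriv ℝ (N - j) (freqInt φ (b i)) p‖)) := by ring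
      _ ≤ _ := by gcongr
  · have h0 : (fun p => ζ p * freqInt φ (b i) p) =ᶠ[𝓝 p] fun _ => 0 := by
      filter_upwards [notMem_tsupport_iff_eventuallyEq.1 hp] with q hq
      rw [hq, Pi.zero_apply, zero_mul]
    rw [(h0.iteratedFDeriv ℝ N).eq_of_nhds]
    have : iteratedFDeriv ℝ N (fun _ : E d => (0 : ℂ)) p = 0 := by
      exact congrFun iteratedFDeriv_fun_zero p
    rw [this, norm_zero, mul_zero]
    exact Finset.sum_nonneg fun j _ => by have := hC (N - j); positivity

/-- The Fourier transform of an oscillatory integral is a Schwartz function on the region of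
frequencies on which the phase is elliptic. -/
theorem exists_schwartz_tendsto {b : E d × E s → ℂ} (hb : Sym (fun _ : Unit => sgw m μ) fun _ => b)
    (hhb : ∀ z, h z ≠ 0 → b z = 0) :
    ∃ G : 𝓢(E d, ℂ), ∀ f : 𝓢(E d, ℂ), Filter.Tendsto
      (cutInt φ 0 fun z => b z * fourierS d (SchwartzMap.smulLeftCLM ℂ ζ f) z.1) Filter.atTop
      (𝓝 (∫ p, G p * f p)) := by
  have hφ : Continuous φ := (H.sym_phase.smooth ()).continuous
  have hbs : ContDiff ℝ ∞ b := hb.smooth ()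
  have hcs (k : ℕ) := hasCompactSupport_cut_sub_mul k b
  have hcc (k : ℕ) := hasCompactSupport_cut_mul k b
  have hcutc (k : ℕ) : Continuous fun z => (cut k z : ℂ) * b z :=
    (Complex.continuous_ofReal.comp (cut_contDiff k).continuous).mul hbs.continuous
  have hs1 := hb.cut_sub_mul
  have hs0 := hb.cut_mul
  have hsm (k : ℕ) : ContDiff ℝ ∞ fun p => ζ p * freqInt φ
      (fun z => (((2 : ℝ) ^ k * (cut (k + 1) z - cut k z) : ℝ) : ℂ) * b z) p :=
    hζ.1.mul (contDiff_freqInt hφ (hs1.smooth ((), k)).continuous (hcs k))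
  -- the term of index zero, and the telescoping series of the differences
  obtain ⟨G₀, hG₀⟩ : ∃ G : 𝓢(E d, ℂ), ∀ p,
      G p = ζ p * freqInt φ (fun z => (cut 0 z : ℂ) * b z) p := by
    refine ⟨⟨fun p => ζ p * freqInt φ (fun z => (cut 0 z : ℂ) * b z) p,
      hζ.1.mul (contDiff_freqInt hφ (hcutc 0) (hcc 0)), fun M N => ?_⟩, fun p => rfl⟩
    obtain ⟨C, -, hC⟩ := H.exists_schwartz_bound hζ hζP hs0 (fun i => hcc i.2)
      (fun i z hz => by rw [hhb z hz, mul_zero]) M N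
    refine ⟨C, fun p => le_trans ?_ (hC ((), 0) p)⟩
    gcongr
    linarith [norm_nonneg p]
  obtain ⟨G₁, hG₁⟩ := exists_schwartz_hasSum
    (F := fun k p => ((2 : ℝ) ^ k)⁻¹ • (ζ p * freqInt φ
      (fun z => (((2 : ℝ) ^ k * (cut (k + 1) z - cut k z) : ℝ) : ℂ) * b z) p))
    (fun k => contDiff_const.fun_smul (hsm k)) (fun M N => by
      obtain ⟨C, -, hC⟩ := H.exists_schwartz_bound hζ hζP hs1 (fun i => hcs i.2)
        (fun i z hz => by rw [hhb z hz, mul_zero]) M N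
      refine ⟨C, fun k p => ?_⟩
      rw [iteratedFDeriv_const_smul_apply' ((hsm k).of_le (by exact_mod_cast le_top)).contDiffAt,
        norm_smul, Real.norm_of_nonneg (by positivity), one_div, inv_pow, mul_left_comm, mul_comm C]
      gcongr
      exact hC ((), k) p)
  have hpt (p : E d) : Filter.Tendsto (fun K => ζ p * cutInt φ p b K) Filter.atTop
      (𝓝 ((G₀ + G₁) p)) := by
    have h1 := ((hG₁ p).tendsto_sum_nat).const_add (G₀ p)
    refine h1.congr fun K => ?_
    have h2 (k : ℕ) : ((2 : ℝ) ^ k)⁻¹ • (ζ p * freqInt φ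
        (fun z => (((2 : ℝ) ^ k * (cut (k + 1) z - cut k z) : ℝ) : ℂ) * b z) p) =
        ζ p * cutInt φ p b (k + 1) - ζ p * cutInt φ p b k := by
      rw [← mul_sub, cutInt_succ_sub hφ p hbs.continuous, Complex.real_smul, freqInt]
      push_cast
      ring
    rw [Finset.sum_congr rfl fun k _ => h2 k,
      Finset.sum_range_sub fun k => ζ p * cutInt φ p b k, hG₀]
    change ζ p * cutInt φ p b 0 + _ = _
    ring
  obtain ⟨C, hC0, hC⟩ := H.exists_schwartz_bound hζ hζP hs0 (fun i => hcc i.2)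
    (fun i z hz => by rw [hhb z hz, mul_zero]) 0 0
  refine ⟨G₀ + G₁, fun f => ?_⟩
  have hint (K : ℕ) : cutInt φ 0 (fun z => b z * fourierS d (SchwartzMap.smulLeftCLM ℂ ζ f) z.1) K =
      ∫ p, ζ p * cutInt φ p b K * f p := by
    have h1 := integral_freqInt_mul hφ (hcutc K) (hcc K) (SchwartzMap.smulLeftCLM ℂ ζ f)
    rw [cutInt]
    simp only [← mul_assoc] at h1 ⊢
    rw [← h1]
    refine integral_congr_ae (Filter.Eventually.of_forall fun p => ?_)
    simp only [SchwartzMap.smulLeftCLM_apply_apply hζ, smul_eq_mul]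
    change cutInt φ p b K * _ = _
    ring
  rw [funext hint]
  refine tendsto_integral_of_dominated_convergence (fun p => C * ‖f p‖) (fun K => ?_)
    (f.integrable.norm.const_mul C) (fun K => Filter.Eventually.of_forall fun p => ?_)
    (Filter.Eventually.of_forall fun p => (hpt p).mul_const _)
  · have h1 : Continuous fun p => cutInt φ p b K :=
      (contDiff_freqInt hφ (hcutc K) (hcc K)).continuous
    exact ((hζ.1.continuous.mul h1).mul f.continuous).aestronglyMeasurable
  · rw [norm_mul]
    gcongr
    have h1 := hC ((), K) p
    rwa [pow_zero, one_mul, norm_iteratedFDeriv_zero] at h1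

end PhaseElliptic

end

section

variable {d s : ℕ} {ι κ : Type*} {n ν : ℝ} {φ h e : E d × E s → ℝ} {P : Set (E d)}

/-! ### Asymptotic cut-offs -/

theorem continuous_bracket : Continuous (bracket : E d → ℝ) := by
  unfold bracket
  fun_prop

theorem continuous_toBall : Continuous (toBall : E d → Ball d) :=
  ((continuous_bracket.inv₀ fun x => (bracket_pos x).ne').smul continuous_id).subtype_mk _

/-- The ray through `x` ends in the direction `x / |x|`, at distance `1 - |toBall x|`. -/
theorem norm_toBall_sub_normalize {x : E d} (hx : x ≠ 0) :
    ‖(toBall x : E d) - ‖x‖⁻¹ • x‖ = 1 - ‖(toBall x : E d)‖ := by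
  have h0 : ‖x‖ ≠ 0 := norm_ne_zero_iff.2 hx
  have h1 : (toBall x : E d) - ‖x‖⁻¹ • x = (‖(toBall x : E d)‖ - 1) • (‖x‖⁻¹ • x) := by
    rw [sub_smul, one_smul, norm_toBall, smul_smul, mul_assoc, mul_inv_cancel₀ h0, mul_one]
    rfl
  have h2 : ‖‖x‖⁻¹ • x‖ = 1 := by rw [norm_smul, norm_inv, norm_norm, inv_mul_cancel₀ h0]
  rw [h1, norm_smul, h2, mul_one, Real.norm_eq_abs, abs_sub_comm,
    abs_of_pos (by linarith [norm_toBall_lt_one x])]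

/-- A neighbourhood of an asymptotic direction `y` contains the far end of a cone. -/
theorem exists_cone_subset {y : Ball d} {A : Set (Ball d)} (hA : A ∈ 𝓝 y) :
    ∃ A' ⊆ A, IsClosed A' ∧ ∃ ε : ℝ, 0 < ε ∧ ∃ R : ℝ, 0 < R ∧ ∀ x : E d, R ≤ ‖x‖ →
      ‖‖x‖⁻¹ • x - y‖ < ε → toBall x ∈ A' := by
  obtain ⟨δ, hδ, hA⟩ := Metric.nhds_basis_closedBall.mem_iff.1 hA
  obtain ⟨R, hR⟩ := exists_norm_lt_of_norm_toBall_le (d := d) (r := 1 - δ / 2) (by linarith)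
  refine ⟨_, hA, Metric.isClosed_closedBall, δ / 2, by linarith, max R 1, by positivity,
    fun x hx hxy => ?_⟩
  have hx0 : x ≠ 0 := norm_pos_iff.1 (one_pos.trans_le ((le_max_right _ _).trans hx))
  have h1 : 1 - δ / 2 < ‖(toBall x : E d)‖ := by
    by_contra! h1
    exact absurd ((le_max_left _ _).trans hx) (hR x h1).not_ge
  rw [Metric.mem_closedBall, Subtype.dist_eq, dist_eq_norm]
  have := norm_sub_le_norm_sub_add_norm_sub (toBall x : E d) (‖x‖⁻¹ • x) (y : E d)
  rw [norm_toBall_sub_normalize hx0] at this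
  linarith

theorem IsCutoff.exists_eq_one {χ : E d → ℂ} (hχ : IsCutoff χ) (R : ℝ) :
    ∃ R' : ℝ, 0 < R' ∧ ∀ x : E d, ‖x‖ < R → χ (R'⁻¹ • x) = 1 := by
  obtain ⟨ρ, hρ, hρ'⟩ := Metric.eventually_nhds_iff.1 hχ.eq_one
  refine ⟨(|R| + 1) / ρ, by positivity, fun x hx => hρ' ?_⟩
  rw [dist_zero_right, norm_smul, inv_div, Real.norm_of_nonneg (by positivity), div_mul_eq_mul_div,
    div_lt_iff₀ (by positivity)]
  gcongr
  linarith [le_abs_self R]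

theorem contDiffAt_normalize {x : E d} (hx : x ≠ 0) : ContDiffAt ℝ ∞ (fun x : E d => ‖x‖⁻¹ • x) x :=
  ((contDiffAt_norm ℝ hx).inv (norm_ne_zero_iff.2 hx)).smul contDiffAt_id

/-- Every neighbourhood `A` of an asymptotic direction contains the support of an asymptotic cut-off
at that direction, which is a smooth function on the closed ball `𝔹^d` where it is not cut off
by `χ`. -/
theorem IsCutoff.exists_asympCutoff {χ : E d → ℂ} (hχ : IsCutoff χ) {y : Ball d}
    {A : Set (Ball d)} (hA : A ∈ 𝓝 y) :
    ∃ (R : ℝ) (ψ : E d → ℂ), 0 < R ∧ SmoothOnSphere ψ ∧ ψ y ≠ 0 ∧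
      (∀ x ∈ tsupport (asympCutoff χ ψ R), toBall x ∈ A) ∧
      ∃ G : E d → ℝ, ContDiff ℝ ∞ G ∧
        asympCutoff χ ψ R = fun x => (1 - χ (R⁻¹ • x)) * (G (toBall x) : ℂ) := by
  obtain ⟨A', hA', hA'c, ε, hε, R₀, hR₀, hcone⟩ := exists_cone_subset hA
  obtain ⟨R₁, hR₁⟩ := exists_norm_lt_of_norm_toBall_le (d := d) (r := 1 / 2) (by norm_num)
  obtain ⟨R, hR, hR'⟩ := hχ.exists_eq_one (max R₀ R₁)
  let g : ContDiffBump (y : E d) := ⟨ε / 2, ε, by linarith, by linarith⟩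
  let g₀ : ContDiffBump (0 : E d) := ⟨1 / 4, 1 / 2, by norm_num, by norm_num⟩
  have hg : ContDiff ℝ ∞ g := g.contDiff (n := ⊤)
  have hg₀ : ContDiff ℝ ∞ g₀ := g₀.contDiff (n := ⊤)
  refine ⟨R, fun x => (g x : ℂ), hR, fun x hx => ?_, ?_, fun x hx => ?_,
    -- the factor `1 - g₀` removes the singularity of `x / |x|` at the origin; where it is not `1`, the
    -- asymptotic cut-off vanishes
    fun x => g (‖x‖⁻¹ • x) * (1 - g₀ x), ?_, ?_⟩
  · exact ((Complex.ofRealCLM.contDiff.contDiffAt.comp _ hg.contDiffAt).comp x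
      (contDiffAt_normalize hx)).contDiffWithinAt
  · have : g y = 1 := g.one_of_mem_closedBall (Metric.mem_closedBall_self g.rIn_pos.le)
    simp [this]
  · refine hA' (closure_minimal (fun x hx => ?_) (hA'c.preimage continuous_toBall) hx)
    have h1 : χ (R⁻¹ • x) ≠ 1 := fun h1 => hx (by simp [asympCutoff, h1])
    have h2 : g (‖x‖⁻¹ • x) ≠ 0 := fun h2 => hx (by simp [asympCutoff, h2])
    have h3 : ‖x‖⁻¹ • x ∈ Metric.ball (y : E d) ε := by
      rw [← g.support_eq]
      exact h2
    refine hcone x ?_ (by rwa [mem_ball_iff_norm] at h3)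
    by_contra! h4
    exact h1 (hR' x (h4.trans_le (le_max_left _ _)))
  · rw [contDiff_iff_contDiffAt]
    intro x
    rcases eq_or_ne x 0 with rfl | hx
    · refine (contDiffAt_const (c := (0 : ℝ))).congr_of_eventuallyEq ?_
      filter_upwards [g₀.eventuallyEq_one] with x hx
      simp [hx]
    · exact (hg.contDiffAt.comp x (contDiffAt_normalize hx)).mul
        (contDiffAt_const.sub hg₀.contDiffAt)
  · funext x
    rcases lt_or_ge ‖(toBall x : E d)‖ (1 / 2) with hx | hx
    · simp [asympCutoff, hR' x ((hR₁ x hx.le).trans_le (le_max_right _ _))]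
    · have h0 : x ≠ 0 := by
        rintro rfl
        rw [norm_toBall, norm_zero, mul_zero] at hx
        norm_num at hx
      have h1 : g₀ (toBall x : E d) = 0 := g₀.zero_of_le_dist (by rwa [dist_zero_right])
      have h2 : ‖(toBall x : E d)‖⁻¹ • (toBall x : E d) = ‖x‖⁻¹ • x := by
        rw [norm_toBall]
        change _ • ((bracket x)⁻¹ • x) = _
        have := (bracket_pos x).ne'
        rw [smul_smul]
        congr 1
        field_simp
      simp [asympCutoff, h1, h2]

theorem hasTemperateGrowth_toBall : (fun x : E d => (toBall x : E d)).HasTemperateGrowth := by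
  have h1 := (Function.hasTemperateGrowth_one_add_norm_sq_rpow (E d) (-1 / 2)).smul
    (Function.HasTemperateGrowth.id (E := E d))
  have h2 : (fun x : E d => (toBall x : E d)) =
      (fun x : E d => (1 + ‖x‖ ^ 2) ^ (-1 / 2 : ℝ)) • id := by
    funext x
    change (bracket x)⁻¹ • x = (1 + ‖x‖ ^ 2) ^ (-1 / 2 : ℝ) • x
    rw [bracket, Real.sqrt_eq_rpow, ← Real.rpow_neg (by positivity)]
    norm_num
  rw [h2]
  exact h1

theorem hasTemperateGrowth_comp_toBall {G : E d → ℝ} (hG : ContDiff ℝ ∞ G) :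
    (fun x : E d => G (toBall x)).HasTemperateGrowth := by
  -- only the values of `G` on the unit ball matter, so that `G` may be assumed compactly supported
  let g : ContDiffBump (0 : E d) := ⟨1, 2, by norm_num, by norm_num⟩
  have h1 : (fun x => g x * G x).HasTemperateGrowth :=
    (g.hasCompactSupport.mul_right).hasTemperateGrowth ((g.contDiff (n := ⊤)).mul hG)
  convert h1.comp hasTemperateGrowth_toBall using 1
  funext x
  have h2 : g (toBall x : E d) = 1 := g.one_of_mem_closedBall (toBall x).2
  simp [h2]

section

variable {χ : E d → ℂ} (hχ : IsCutoff χ) {R : ℝ} (hR : 0 < R) {G : E d → ℝ} (hG : ContDiff ℝ ∞ G)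
include hχ

theorem IsCutoff.contDiff_dilate (R : ℝ) : ContDiff ℝ ∞ fun x => χ (R⁻¹ • x) :=
  hχ.smooth.comp (contDiff_const_smul _)

include hR

theorem IsCutoff.hasCompactSupport_dilate : HasCompactSupport fun x => χ (R⁻¹ • x) :=
  hχ.compact.comp_smul (inv_ne_zero hR.ne')

include hG

theorem IsCutoff.hasTemperateGrowth_one_sub_mul :
    (fun x => (1 - χ (R⁻¹ • x)) * (G (toBall x) : ℂ)).HasTemperateGrowth :=
  ((Function.HasTemperateGrowth.const 1).sub ((hχ.hasCompactSupport_dilate hR).hasTemperateGrowth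
    (hχ.contDiff_dilate R))).mul
    (Function.Complex.hasTemperateGrowth_ofReal.comp (hasTemperateGrowth_comp_toBall hG))

end

theorem sym_fst_of_hasCompactSupport {f : E d → ℂ} (hf : ContDiff ℝ ∞ f)
    (hc : HasCompactSupport f) :
    Sym (fun (_ : ι) (_ : E d × E s) => (1 : ℝ)) (fun _ z => f z.1) := by
  have h1 := sym_modulation (s := s) hf hc (p := fun _ : ι => 0) (R := 0) (by simp) 0
  simpa using h1

theorem IsCutoff.sym_one_sub_mul {χ : E d → ℂ} (hχ : IsCutoff χ) {R : ℝ} (hR : 0 < R)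
    {G : E d → ℝ} (hG : ContDiff ℝ ∞ G) :
    Sym (fun (_ : ι) (_ : E d × E s) => (1 : ℝ))
      (fun _ z => (1 - χ (R⁻¹ • z.1)) * (G (toBall z.1) : ℂ)) := by
  have h1 : Sym (fun (_ : ι) (_ : E d × E s) => (1 : ℝ)) (fun _ _ => (1 : ℂ)) :=
    Sym.const fun i z => by simp
  exact ((h1.sub (sym_fst_of_hasCompactSupport (hχ.contDiff_dilate R)
    (hχ.hasCompactSupport_dilate hR))).mul (sym_comp_toBall hG).ofReal).mono' fun i z => by simp

end

section

variable {d s : ℕ} {ι κ : Type*} {n ν : ℝ} {φ h e : E d × E s → ℝ} {P : Set (E d)}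

/-! ### The wave front set -/

theorem isOpen_cone (y : E d) (ε : ℝ) : IsOpen {x : E d | x ≠ 0 ∧ ‖‖x‖⁻¹ • x - y‖ < ε} := by
  have h1 : ContinuousOn (fun x : E d => ‖‖x‖⁻¹ • x - y‖) {0}ᶜ := fun x hx =>
    (((contDiffAt_normalize hx).continuousAt.sub continuousAt_const).norm).continuousWithinAt
  exact h1.isOpen_inter_preimage isOpen_compl_singleton (isOpen_Iio (a := ε))

theorem modulate_apply {κ : E d → ℂ} (hκ : ContDiff ℝ ∞ κ) (hκ' : HasCompactSupport κ) (p x : E d) :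
    modulate κ hκ hκ' p x = κ x * Complex.exp (-(Complex.I * (inner ℝ x p : ℝ))) := rfl

/-- An oscillatory integral is smooth, microlocally, at the finite points `x` and the directions `q`
near which its phase is elliptic. -/
theorem PhaseElliptic.notMem_classicalWF (hφ : IsAdmissiblePhase n ν φ)
    {I : SGInf d s →ₗ[ℂ] 𝓢'(E d, ℂ)} (hI : IsOscillatoryIntegral φ I) (a : SGInf d s)
    {A B : Set (Ball d)} (H : PhaseElliptic n ν φ h e {p | toBall p ∈ B})
    (hA : ∀ z, toBall z.1 ∈ A → h z = 0) {x : E d} {q : Ball d} (hx : A ∈ 𝓝 (toBall x))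
    (hq : B ∈ 𝓝 q) : (x, (q : E d)) ∉ classicalWF (I a) := by
  rintro ⟨hq1 : ‖(q : E d)‖ = 1, hnot⟩
  refine hnot ?_
  obtain ⟨B', hB', -, ε, hε, R, hR, hcone⟩ := exists_cone_subset hq
  obtain ⟨r, hr, hrA⟩ := Metric.nhds_basis_closedBall.mem_iff.1
    (continuous_toBall.continuousAt.preimage_mem_nhds hx)
  let g : ContDiffBump x := ⟨r / 2, r, by linarith, by linarith⟩
  set κ : E d → ℂ := fun y => (g y : ℂ) with hκdef
  have hκ : ContDiff ℝ ∞ κ := Complex.ofRealCLM.contDiff.comp (g.contDiff (n := ⊤))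
  have hκ' : HasCompactSupport κ := g.hasCompactSupport.comp_left Complex.ofReal_zero
  have hκA (z : E d × E s) (hz : h z ≠ 0) : κ z.1 = 0 := by
    by_contra h1
    have h2 : z.1 ∈ Metric.ball x r := by
      rw [← g.support_eq]
      exact fun h2 => h1 (by simp [hκdef, h2])
    exact hz (hA z (hrA (Metric.ball_subset_closedBall h2)))
  have hκx : κ x ≠ 0 := by
    have : g x = 1 := g.one_of_mem_closedBall (Metric.mem_closedBall_self g.rIn_pos.le)
    simp [hκdef, this]
  refine ⟨κ, hκ, hκ', hκx, {p | p ≠ 0 ∧ ‖‖p‖⁻¹ • p - (q : E d)‖ < ε}, isOpen_cone _ _,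
    ⟨norm_ne_zero_iff.1 (by rw [hq1]; exact one_ne_zero), by simpa [hq1] using hε⟩, ?_, fun N => ?_⟩
  · rintro p ⟨hp, hp'⟩ t ht
    refine ⟨smul_ne_zero ht.ne' hp, ?_⟩
    have : ‖t • p‖⁻¹ • t • p = ‖p‖⁻¹ • p := by
      rw [norm_smul, Real.norm_of_nonneg ht.le, smul_smul]
      congr 1
      field_simp
    rwa [this]
  obtain ⟨m, μ, ha⟩ := a.2
  have hlim (p : E d) := hI.tendsto hφ.continuous_phase a (modulate κ hκ hκ' p)
  -- large frequencies in the cone: the phase is elliptic on the support of the amplitude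
  obtain ⟨C₁, hC₁, hbd₁⟩ := H.exists_cutInt_bound
    (ι := {p : E d // (p ≠ 0 ∧ ‖‖p‖⁻¹ • p - (q : E d)‖ < ε) ∧ R ≤ ‖p‖}) (p := fun p => p.1)
    (fun p => hB' (hcone p.1 p.2.2 p.2.1.2)) (m := m) (μ := μ)
    (b := fun _ z => (a : E d × E s → ℂ) z * κ z.1)
    (((SG.sym ha).mul (sym_fst_of_hasCompactSupport hκ hκ')).mono' fun i z => by rw [mul_one])
    (fun i z hz => by rw [hκA z hz, mul_zero]) N
  -- bounded frequencies: `e^{-ix·p}` is part of the amplitude, and the phase `φ` is admissible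
  obtain ⟨k, H₀⟩ := hφ.exists_phaseElliptic
  obtain ⟨C₂, hC₂, hbd₂⟩ := H₀.exists_cutInt_bound
    (ι := {p : E d // ‖p‖ ≤ R}) (p := fun _ => 0) (fun _ => rfl) (m := m) (μ := μ)
    (b := fun p z => (a : E d × E s → ℂ) z *
      (κ z.1 * Complex.exp (-(Complex.I * (inner ℝ z.1 p.1 : ℝ)))))
    (((SG.sym ha).mul (sym_modulation hκ hκ' (fun p => p.2) 0)).mono' fun i z => by simp)
    (fun i z hz => absurd rfl hz) 0
  refine ⟨C₁ + C₂ * (1 + R) ^ N, fun p hp => ?_⟩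
  refine le_of_tendsto ((hlim p).norm.mul_const _) (Filter.Eventually.of_forall fun K => ?_)
  rcases le_or_gt R ‖p‖ with hRp | hRp
  · have h1 : cutInt φ 0 (fun z => (a : E d × E s → ℂ) z * modulate κ hκ hκ' p z.1) K =
        cutInt φ p (fun z => (a : E d × E s → ℂ) z * κ z.1) K := by
      refine integral_congr_ae (Filter.Eventually.of_forall fun z => ?_)
      simp only [modulate_apply]
      rw [osc_eq_mul φ p]
      ring
    rw [h1, mul_comm]
    have := hbd₁ ⟨p, hp, hRp⟩ K
    have h2 : 0 ≤ C₂ * (1 + R) ^ N := by positivity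
    linarith
  · have h1 := hbd₂ ⟨p, hRp.le⟩ K
    rw [pow_zero, one_mul] at h1
    have h2 : (1 + ‖p‖) ^ N ≤ (1 + R) ^ N := by gcongr
    have h3 : ‖cutInt φ 0 (fun z => (a : E d × E s → ℂ) z * modulate κ hκ hκ' p z.1) K‖ *
        (1 + ‖p‖) ^ N ≤ C₂ * (1 + R) ^ N := mul_le_mul h1 h2 (by positivity) hC₂
    linarith

/-- A tempered distribution which becomes a Schwartz function when it is cut off to the region `B`
has no cone singularity in the interior of that region. -/
theorem notMem_Css {χ : E d → ℂ} (hχ : IsCutoff χ) {v : 𝓢'(E d, ℂ)} {B : Set (Ball d)} {q : Ball d}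
    (hq : B ∈ 𝓝 q)
    (hv : ∀ ζ : E d → ℂ, ζ.HasTemperateGrowth → tsupport ζ ⊆ {p | toBall p ∈ B} →
      ∃ G : 𝓢(E d, ℂ), ∀ f : 𝓢(E d, ℂ), v (SchwartzMap.smulLeftCLM ℂ ζ f) = ∫ p, G p * f p) :
    q ∉ Css χ v := by
  rintro (⟨x, rfl, hx⟩ | ⟨-, hnot⟩)
  · refine hx ?_
    obtain ⟨r, hr, hrB⟩ := Metric.nhds_basis_closedBall.mem_iff.1
      (continuous_toBall.continuousAt.preimage_mem_nhds hq)
    let g : ContDiffBump x := ⟨r / 2, r, by linarith, by linarith⟩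
    have hg : (fun y => (g y : ℂ)).HasTemperateGrowth :=
      (g.hasCompactSupport.comp_left Complex.ofReal_zero).hasTemperateGrowth
        (Complex.ofRealCLM.contDiff.comp (g.contDiff (n := ⊤)))
    have hsupp : tsupport (fun y => (g y : ℂ)) ⊆ tsupport g :=
      closure_mono fun y (hy : (g y : ℂ) ≠ 0) => fun h0 => hy (by rw [h0, Complex.ofReal_zero])
    obtain ⟨G, hG⟩ := hv _ hg (hsupp.trans (g.tsupport_eq.trans_subset hrB))
    refine ⟨Metric.ball x (r / 2), Metric.isOpen_ball, Metric.mem_ball_self (by linarith), G,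
      (G.smooth ⊤).contDiffOn, fun f _ hf => ?_⟩
    rw [← hG]
    congr 1
    ext y
    rw [SchwartzMap.smulLeftCLM_apply_apply hg]
    by_cases hy : y ∈ tsupport f
    · rw [g.one_of_mem_closedBall (Metric.ball_subset_closedBall (hf hy))]
      simp
    · rw [image_eq_zero_of_notMem_tsupport hy, smul_zero]
  · obtain ⟨R, ψ, hR, hψ, hψq, hsupp, G, hG, hψG⟩ := hχ.exists_asympCutoff hq
    refine hnot ⟨R, ψ, hR, hψ, hψq, ?_⟩
    exact hv _ (hψG ▸ hχ.hasTemperateGrowth_one_sub_mul hR hG) hsupp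

/-- The Fourier transform of the oscillatory integral, cut off at an asymptotic direction `y`, has no
cone singularities at the frequencies `q` for which the phase is elliptic near `(y, q)`. -/
theorem PhaseElliptic.exists_notMem_Css (hφ : IsAdmissiblePhase n ν φ) {χ : E d → ℂ}
    (hχ : IsCutoff χ) {I : SGInf d s →ₗ[ℂ] 𝓢'(E d, ℂ)} (hI : IsOscillatoryIntegral φ I)
    (a : SGInf d s) {A B : Set (Ball d)} (H : PhaseElliptic n ν φ h e {p | toBall p ∈ B})
    (hA : ∀ z, toBall z.1 ∈ A → h z = 0) {y q : Ball d} (hy : A ∈ 𝓝 y) (hq : B ∈ 𝓝 q) :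
    ∃ (R : ℝ) (ψ : E d → ℂ), 0 < R ∧ SmoothOnSphere ψ ∧ ψ y ≠ 0 ∧
      q ∉ Css χ (fourierD (cutMul χ ψ R (I a))) := by
  obtain ⟨R, ψ, hR, hψ, hψy, hsupp, G, hG, hψG⟩ := hχ.exists_asympCutoff hy
  refine ⟨R, ψ, hR, hψ, hψy, notMem_Css hχ hq fun ζ hζ hζB => ?_⟩
  obtain ⟨m, μ, ha⟩ := a.2
  -- without this, multiplication by the cut-off would be the junk value `0`
  have hgrowth : (asympCutoff χ ψ R).HasTemperateGrowth :=
    hψG ▸ hχ.hasTemperateGrowth_one_sub_mul hR hG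
  have hsym : Sym (fun (_ : Unit) (_ : E d × E s) => (1 : ℝ)) fun _ z => asympCutoff χ ψ R z.1 := by
    rw [hψG]
    exact hχ.sym_one_sub_mul hR hG
  obtain ⟨F, hF⟩ := H.exists_schwartz_tendsto hζ hζB (m := m) (μ := μ)
    (b := fun z => (a : E d × E s → ℂ) z * asympCutoff χ ψ R z.1)
    (((SG.sym ha).mul hsym).mono' fun i z => by rw [mul_one])
    (fun z hz => by
      rw [image_eq_zero_of_notMem_tsupport fun h1 => hz (hA z (hsupp _ h1)), mul_zero])
  refine ⟨F, fun f => tendsto_nhds_unique ?_ (hF f)⟩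
  have h1 := hI.tendsto hφ.continuous_phase a (SchwartzMap.smulLeftCLM ℂ (asympCutoff χ ψ R)
    (fourierS d (SchwartzMap.smulLeftCLM ℂ ζ f)))
  simp only [SchwartzMap.smulLeftCLM_apply_apply hgrowth, smul_eq_mul, ← mul_assoc] at h1
  exact h1

theorem IsAdmissiblePhase.globalWF_subset (hφ : IsAdmissiblePhase n ν φ) {χ : E d → ℂ}
    (hχ : IsCutoff χ) {I : SGInf d s →ₗ[ℂ] 𝓢'(E d, ℂ)} (hI : IsOscillatoryIntegral φ I)
    (a : SGInf d s) : globalWF χ (I a) ⊆ statSP n ν φ := by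
  intro w hw
  have hwb : w ∈ ballBoundary d d := by
    rcases hw with ⟨x, -, hx⟩ | ⟨hx, -⟩
    exacts [Or.inr hx.1, Or.inl hx]
  by_contra hSP
  obtain ⟨A, hA, B, hB, h, e, H, hh⟩ := hφ.exists_phaseElliptic_nhds hwb hSP
  rcases hw with ⟨x, hx, hwf⟩ | ⟨-, hnot⟩
  · exact H.notMem_classicalWF hφ hI a hh (hx ▸ hA) hB hwf
  · exact hnot (H.exists_notMem_Css hφ hχ hI a hh hA hB)

end

end SGOsc

end

theorem theorem3p2 {d s : ℕ} (n ν : ℝ) (φ : E d × E s → ℝ) (hφ : IsAdmissiblePhase n ν φ)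
    (χ : E d → ℂ) (hχ : IsCutoff χ) :
    (∃! I : SGInf d s →ₗ[ℂ] 𝓢'(E d, ℂ), IsOscillatoryIntegral φ I) ∧
      ∀ I : SGInf d s →ₗ[ℂ] 𝓢'(E d, ℂ), IsOscillatoryIntegral φ I →
        ∀ a : SGInf d s, globalWF χ (I a) ⊆ statSP n ν φ := by
  exact ⟨hφ.existsUnique_oscillatoryIntegral, fun I hI a => hφ.globalWF_subset hχ hI a⟩
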